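/- Let $L>0$, let $N$ be a positive integer and let $\alpha\in[0,2\pi)$. Identify $\mathbb R^2$ with $\mathbb C$. For $\varepsilon>0$ and $u\in L^2((0,1);\mathbb R^2)$ put $$E_\varepsilon(u)=\int_0^1 \frac{\varepsilon}{2}|u'|^2+\frac{1}{4\varepsilon}(|u|^2-1)^2+\frac L2\,(u_1u_2'-u_2u_1'-2\pi N)^2\,dx$$ if $u\in H^1((0,1);\mathbb R^2)$, $u(0)=1$ and $u(1)=e^{i\alpha}$, and $E_\varepsilon(u)=+\infty$ otherwise. Define $E_0:L^2((0,1);\mathbb R^2)\to[0,\infty]$ as follows. If there is a finite set $J\subset(0,1)$ with $u\in H^1((0,1)\setminus J;S^1)$ (that is, $|u|=1$ a.e. and $u\in H^1((0,1)\setminus J;\mathbb R^2)$), let $J_u$ be the minimal such set, to which the point $0$ is added if and only if $u(0^+)\neq1$ and the point $1$ is added if and only if $u(1^-)\neq e^{i\alpha}$, where $u(0^+)$ and $u(1^-)$ are the traces of $u$; then $$E_0(u)=\frac L2\int_0^1 (u_1u_2'-u_2u_1'-2\pi N)^2\,dx+\frac{2\sqrt2}{3}\,\#J_u ,$$ where $u'$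 is the weak derivative of $u$ on $(0,1)\setminus J_u$. If there is no such finite set, $E_0(u)=+\infty$. **Theorem.** As $\varepsilon\to0^+$, $E_\varepsilon$ $\Gamma$-converges to $E_0$ in $L^2((0,1);\mathbb R^2)$. That is, for every $u\in L^2((0,1);\mathbb R^2)$: 1. whenever $\varepsilon_j\to0^+$ and $u_j\to u$ in $L^2((0,1);\mathbb R^2)$, one has $E_0(u)\le\liminf_{j\to\infty}E_{\varepsilon_j}(u_j)$; 2. there is a family $(v_\varepsilon)_{\varepsilon>0}$ with $v_\varepsilon\to u$ in $L^2((0,1);\mathbb R^2)$ and $E_\varepsilon(v_\varepsilon)\to E_0(u)$ as $\varepsilon\to0^+$. -/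

import Mathlib

open MeasureTheory Set Filter Topology
open scoped ENNReal ContDiff

noncomputable section

namespace Twist

/-- The space `L²((0,1); ℝ²)`, with `ℝ²` identified with `ℂ` (`u₁ = re u`, `u₂ = im u`). -/
abbrev L2 : Type := Lp ℂ 2 (volume.restrict (Ioo (0 : ℝ) 1))

/-- `g` is a weak (distributional) derivative of `u` on the open set `U ⊆ ℝ`. -/
def IsWeakDeriv (U : Set ℝ) (u g : ℝ → ℂ) : Prop :=
  ∀ φ : ℝ → ℝ, ContDiff ℝ ∞ φ → HasCompactSupport φ → tsupport φ ⊆ U →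
    ∫ x in U, deriv φ x • u x = -∫ x in U, φ x • g x

/-- `u ∈ H¹(U; ℝ²)`: `u ∈ L²(U)` has a weak derivative on `U` that belongs to `L²(U)`. -/
def MemH1 (U : Set ℝ) (u : ℝ → ℂ) : Prop :=
  MemLp u 2 (volume.restrict U) ∧
    ∃ g : ℝ → ℂ, MemLp g 2 (volume.restrict U) ∧ IsWeakDeriv U u g

open scoped Classical in
/-- The weak derivative of `u ∈ H¹(U; ℝ²)` (unique up to a null subset of `U`). -/
def weakDeriv (U : Set ℝ) (u : ℝ → ℂ) : ℝ → ℂ :=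
  if h : MemH1 U u then h.2.choose else 0

/-- `u(0⁺) = c`: for every neighbourhood `V` of `c` there is a `δ > 0` with `u(x) ∈ V` for
almost every `x ∈ (0, δ)`. For a map that is `H¹` near `0` this is the value at `0⁺` of its
continuous representative. -/
def TraceAtZero (u : ℝ → ℂ) (c : ℂ) : Prop :=
  Tendsto u (𝓝[>] (0 : ℝ) ⊓ ae volume) (𝓝 c)

/-- `u(1⁻) = c`, in the same sense. -/
def TraceAtOne (u : ℝ → ℂ) (c : ℂ) : Prop :=
  Tendsto u (𝓝[<] (1 : ℝ) ⊓ ae volume) (𝓝 c)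

/-- The admissible class of `H¹((0,1); ℝ²)`-maps with `u(0) = 1` and `u(1) = e^{iα}`. -/
def Admissible (α : ℝ) (u : ℝ → ℂ) : Prop :=
  MemH1 (Ioo 0 1) u ∧ TraceAtZero u 1 ∧ TraceAtOne u (Complex.exp (α * Complex.I))

/-- The twist density `u₁ v₂ - u₂ v₁`, to be used with `v = u'`. -/
def twist (u v : ℂ) : ℝ := u.re * v.im - u.im * v.re

open scoped Classical in
/-- The energy `E_ε` on `L²((0,1); ℝ²)`, equal to `+∞` off the admissible class. -/
def energy (L : ℝ) (N : ℕ) (α ε : ℝ) (u : L2) : ℝ≥0∞ :=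
  if Admissible α u then
    ∫⁻ x in Ioo (0 : ℝ) 1, ENNReal.ofReal
      (ε / 2 * ‖weakDeriv (Ioo 0 1) u x‖ ^ 2 + 1 / (4 * ε) * (‖u x‖ ^ 2 - 1) ^ 2
        + L / 2 * (twist (u x) (weakDeriv (Ioo 0 1) u x) - 2 * Real.pi * N) ^ 2)
  else ⊤

/-- `u ∈ H¹((0,1) ∖ J; S¹)`. -/
def MemH1Circle (J : Finset ℝ) (u : ℝ → ℂ) : Prop :=
  MemH1 (Ioo 0 1 \ J) u ∧ ∀ᵐ x ∂(volume.restrict (Ioo (0 : ℝ) 1)), ‖u x‖ = 1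

/-- `J` is the jump set of `u`: a finite subset of `[0,1]` with `u ∈ H¹((0,1) ∖ J; S¹)`, from
which no interior point can be removed, and which contains `0` (or `1`) exactly when the trace
of `u` there differs from the prescribed boundary value. There is at most one such `J`. -/
structure IsJumpSet (α : ℝ) (u : ℝ → ℂ) (J : Finset ℝ) : Prop where
  subset : (J : Set ℝ) ⊆ Icc 0 1
  memH1 : MemH1Circle J u
  minimal : ∀ x ∈ J, x ∈ Ioo (0 : ℝ) 1 → ¬ MemH1Circle (J.erase x) u
  zero_mem : (0 : ℝ) ∈ J ↔ ¬ TraceAtZero u 1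
  one_mem : (1 : ℝ) ∈ J ↔ ¬ TraceAtOne u (Complex.exp (α * Complex.I))

open scoped Classical in
/-- The limit energy `E₀` on `L²((0,1); ℝ²)`. -/
def limitEnergy (L : ℝ) (N : ℕ) (α : ℝ) (u : L2) : ℝ≥0∞ :=
  if h : ∃ J : Finset ℝ, IsJumpSet α u J then
    (∫⁻ x in Ioo (0 : ℝ) 1, ENNReal.ofReal
      (L / 2 * (twist (u x) (weakDeriv (Ioo 0 1 \ (h.choose : Set ℝ)) u x)
        - 2 * Real.pi * N) ^ 2))
      + ENNReal.ofReal (2 * Real.sqrt 2 / 3) * (h.choose.card : ℝ≥0∞)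
  else ⊤

/-- `Γ`-convergence of `F ε` to `F₀` as `ε → 0⁺` in a (metric) space `X`: the lower bound holds
along every sequence `εⱼ → 0⁺`, and every point has a recovery family. -/
def GammaConverges {X : Type*} [TopologicalSpace X] (F : ℝ → X → ℝ≥0∞) (F₀ : X → ℝ≥0∞) : Prop :=
  (∀ (u : X) (ε : ℕ → ℝ) (v : ℕ → X), Tendsto ε atTop (𝓝[>] 0) → Tendsto v atTop (𝓝 u) →
      F₀ u ≤ liminf (fun j => F (ε j) (v j)) atTop) ∧
    ∀ u : X, ∃ v : ℝ → X, Tendsto v (𝓝[>] 0) (𝓝 u) ∧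
      Tendsto (fun ε => F ε (v ε)) (𝓝[>] 0) (𝓝 (F₀ u))

end Twist

end

/-! Lower bound. Only ε‖f'‖² is bounded along a sequence of bounded energy, so f' itself is not
controlled. But where |f| ≥ δ > 0 the direction f/|f| has derivative twist(f, f') |f|⁻² · i f/|f|
(`hasDerivAt_radial`): the radial part of f' drops out, and the twist, bounded in L² by the energy,
controls the direction. The twists therefore have a weak limit τ (`exists_weak_limit`), taken along
an ultrafilter.

Call p a dip if the moduli come arbitrarily close to 0 arbitrarily near p. Since |f| − |f|³/3 is a
primitive of 1 − |f|² in |f|, the Modica–Mortola inequality charges a descent of the modulus from 1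
to 0 and the return to 1 at least (4/3)/√2 = 2√2/3 (`modica_mortola`, `dip_cost`). At an endpoint
the boundary value supplies the modulus 1 on the missing side, so the price is the same there. Hence
the dips form a finite set B, with #B bounded by the energy. Off B the equation for the direction
passes to the limit: |u| = 1 and u' = iτu (`isWeakDeriv_limit`), so the twist of u is τ, and weak
lower semicontinuity handles the twist term. At an endpoint outside B the directions are uniformly
1/2-Hölder, so u takes the boundary value there. By minimality the jump set of u lies in B; a dip
need not be a jump, but that only helps.

Upper bound. Take η = √ε. Jumps at 0 and 1 are moved to η and 1 − η, with the map set to its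
boundary value in between. The resulting circle-valued map F is multiplied by a modulus ρ that
vanishes at the jumps, follows a rescaled tanh(t/(√2 ε)) within distance η of them, and is 1
elsewhere. The zeros of ρ make ρF absolutely continuous (`acWith_smul_of_jumps`), its twist is ρ²
times that of F, and each zero costs at most 2√2/3 up to a factor tending to 1
(`exists_le_recoveryBound`). An upper bound suffices, since the lower bound along sequences then
forces convergence of the energies. -/

namespace Twist

/-! ### Absolutely continuous maps and the fundamental theorem of calculus -/

section AbsolutelyContinuous

open AbsolutelyContinuousOnInterval

/-- Every absolute continuity needed below for primitives, norms, truncated directions and profiles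
is obtained by this comparison of increments. -/
theorem ac_of_dist_le {X Y : Type*} [PseudoMetricSpace X] [PseudoMetricSpace Y] {f : ℝ → X}
    {G : ℝ → Y} {a b : ℝ} (K : ℝ) (hG : AbsolutelyContinuousOnInterval G a b)
    (h : ∀ x ∈ uIcc a b, ∀ y ∈ uIcc a b, dist (f x) (f y) ≤ K * dist (G x) (G y)) :
    AbsolutelyContinuousOnInterval f a b := by
  unfold AbsolutelyContinuousOnInterval at hG
  refine squeeze_zero' ?_ ?_ (by simpa using hG.const_mul K)
  · exact Eventually.of_forall fun _ => Finset.sum_nonneg fun i hi => dist_nonneg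
  · rw [eventually_inf_principal]
    filter_upwards with ⟨n, I⟩ hnI
    rw [Finset.mul_sum]
    exact Finset.sum_le_sum fun i hi => h _ (hnI.1 i hi).1 _ (hnI.1 i hi).2

variable {E : Type*} [NormedAddCommGroup E] [NormedSpace ℝ E]

/-- The increments are dominated by those of the primitive of ‖g‖, which reduces the claim to a
real-valued integrand. -/
theorem ac_integral [CompleteSpace E] {g : ℝ → E} {a b c : ℝ}
    (hg : IntervalIntegrable g volume a b) (hc : c ∈ uIcc a b) :
    AbsolutelyContinuousOnInterval (fun x => ∫ t in c..x, g t) a b := by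
  have hn := hg.norm
  have hsub : ∀ x ∈ uIcc a b, ∀ y ∈ uIcc a b, IntervalIntegrable g volume x y :=
    fun x hx y hy => hg.mono_set (uIcc_subset_uIcc hx hy)
  refine ac_of_dist_le 1 (hn.absolutelyContinuousOnInterval_intervalIntegral hc) ?_
  intro x hx y hy
  rw [dist_comm, dist_comm (∫ t in c..x, ‖g t‖), dist_eq_norm, dist_eq_norm,
    intervalIntegral.integral_interval_sub_left (hsub _ hc _ hy) (hsub _ hc _ hx),
    intervalIntegral.integral_interval_sub_left (hsub _ hc _ hy).norm (hsub _ hc _ hx).norm,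
    one_mul, Real.norm_eq_abs]
  exact intervalIntegral.norm_integral_le_abs_integral_norm

/-- `f` is absolutely continuous on the interval with end points `a` and `b`, and `g` is an
integrable version of its almost everywhere derivative. -/
structure ACWith (f g : ℝ → E) (a b : ℝ) : Prop where
  ac : AbsolutelyContinuousOnInterval f a b
  hasDerivAt : ∀ᵐ x, x ∈ uIcc a b → HasDerivAt f (g x) x
  integrable : IntervalIntegrable g volume a b

theorem ACWith.mono {f g : ℝ → E} {a b c d : ℝ} (h : ACWith f g a b)
    (hs : uIcc c d ⊆ uIcc a b) : ACWith f g c d where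
  ac := h.ac.mono hs
  hasDerivAt := by filter_upwards [h.hasDerivAt] with x hx hxc using hx (hs hxc)
  integrable := h.integrable.mono_set hs

/-- The difference of f and the primitive of g is absolutely continuous with derivative 0 almost
everywhere, hence constant. -/
theorem ACWith.integral_eq_sub [CompleteSpace E] {f g : ℝ → E} {a b : ℝ} (h : ACWith f g a b) :
    ∫ x in a..b, g x = f b - f a := by
  have hI := ac_integral h.integrable (left_mem_uIcc (a := a) (b := b))
  have hd : ∀ᵐ x, x ∈ uIcc a b →
      HasDerivAt (fun x => f x - ∫ t in a..x, g t) 0 x := by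
    filter_upwards [h.hasDerivAt, h.integrable.ae_hasDerivAt_integral] with x h1 h2 hx
    simpa using (h1 hx).fun_sub (h2 hx a left_mem_uIcc)
  obtain ⟨C, hC⟩ := (h.ac.fun_sub hI).const_of_ae_hasDerivAt_zero hd
  have h1 := hC a left_mem_uIcc
  have h2 := hC b right_mem_uIcc
  simp only [intervalIntegral.integral_same, sub_zero] at h1
  rw [← h1] at h2
  rw [← h2]; abel

theorem ae_mem_uIoo_of_mem_uIcc (a b : ℝ) :
    ∀ᵐ x : ℝ, x ∈ uIcc a b → x ∈ Ioo (min a b) (max a b) := by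
  have h₁ : ∀ᵐ x : ℝ, x ≠ min a b := by simp [ae_iff, measure_singleton]
  have h₂ : ∀ᵐ x : ℝ, x ≠ max a b := by simp [ae_iff, measure_singleton]
  filter_upwards [h₁, h₂] with x h1 h2 hx
  exact ⟨lt_of_le_of_ne hx.1 (Ne.symm h1), lt_of_le_of_ne hx.2 h2⟩

theorem ACWith.of_integral [CompleteSpace E] {f g : ℝ → E} {a b : ℝ}
    (hg : IntervalIntegrable g volume a b) (h : ∀ x ∈ uIcc a b, f x = f a + ∫ t in a..x, g t) :
    ACWith f g a b where
  ac := by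
    refine ac_of_dist_le 1 (ac_integral hg left_mem_uIcc) fun x hx y hy => ?_
    rw [h x hx, h y hy, dist_add_left, one_mul]
  hasDerivAt := by
    filter_upwards [hg.ae_hasDerivAt_integral, ae_mem_uIoo_of_mem_uIcc a b] with x h1 h2 hx
    refine ((h1 hx a left_mem_uIcc).const_add (f a)).congr_of_eventuallyEq ?_
    filter_upwards [Ioo_mem_nhds (h2 hx).1 (h2 hx).2] with y hy
    exact h y ⟨hy.1.le, hy.2.le⟩
  integrable := hg

theorem ACWith.continuousOn {f g : ℝ → E} {a b : ℝ} (h : ACWith f g a b) :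
    ContinuousOn f (uIcc a b) := h.ac.continuousOn

theorem ACWith.smul {f g : ℝ → E} {φ ψ : ℝ → ℝ} {a b : ℝ} (h : ACWith f g a b)
    (hφ : ACWith φ ψ a b) :
    ACWith (fun x => φ x • f x) (fun x => ψ x • f x + φ x • g x) a b where
  ac := hφ.ac.fun_smul h.ac
  hasDerivAt := by
    filter_upwards [h.hasDerivAt, hφ.hasDerivAt] with x h1 h2 hx
    rw [add_comm]
    exact (h2 hx).fun_smul (h1 hx)
  integrable :=
    (hφ.integrable.smul_continuousOn h.continuousOn).add
      (h.integrable.continuousOn_smul hφ.continuousOn)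

theorem ACWith.add {f g φ ψ : ℝ → E} {a b : ℝ} (h : ACWith f g a b)
    (hφ : ACWith φ ψ a b) :
    ACWith (fun x => f x + φ x) (fun x => g x + ψ x) a b where
  ac := h.ac.fun_add hφ.ac
  hasDerivAt := by
    filter_upwards [h.hasDerivAt, hφ.hasDerivAt] with x h1 h2 hx
    exact (h1 hx).fun_add (h2 hx)
  integrable := h.integrable.add hφ.integrable

theorem ACWith.of_ac {f : ℝ → ℝ} {a b : ℝ} (h : AbsolutelyContinuousOnInterval f a b) :
    ACWith f (deriv f) a b where
  ac := h
  hasDerivAt := by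
    filter_upwards [h.ae_differentiableAt] with x hx hm using (hx hm).hasDerivAt
  integrable := h.intervalIntegrable_deriv

theorem ACWith.of_contDiff {f : ℝ → ℝ} (h : ContDiff ℝ ∞ f) (a b : ℝ) :
    ACWith f (deriv f) a b :=
  .of_ac (h.of_le (by exact_mod_cast le_top)).contDiffOn.absolutelyContinuousOnInterval

end AbsolutelyContinuous

/-! ### Weak derivatives, continuous representatives and traces in one dimension -/

section WeakDerivative

theorem weakDeriv_memLp {U : Set ℝ} {u : ℝ → ℂ} (h : MemH1 U u) :
    MemLp (weakDeriv U u) 2 (volume.restrict U) := by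
  rw [weakDeriv, dif_pos h]; exact h.2.choose_spec.1

theorem isWeakDeriv_weakDeriv {U : Set ℝ} {u : ℝ → ℂ} (h : MemH1 U u) :
    IsWeakDeriv U u (weakDeriv U u) := by
  rw [weakDeriv, dif_pos h]; exact h.2.choose_spec.2

theorem integrableOn_smul_test {U : Set ℝ} {g : ℝ → ℂ} (hg : IntegrableOn g U) {φ : ℝ → ℝ}
    (hφ : Continuous φ) (hc : HasCompactSupport φ) :
    IntegrableOn (fun x => φ x • g x) U := by
  obtain ⟨C, hC⟩ := hc.exists_bound_of_continuous hφ
  exact Integrable.bdd_smul hg C hφ.aestronglyMeasurable (Eventually.of_forall hC)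

theorem deriv_eq_zero_of_notMem_tsupport {φ : ℝ → ℝ} {x : ℝ} (hx : x ∉ tsupport φ) :
    deriv φ x = 0 := by
  by_contra h
  exact hx (support_deriv_subset h)

theorem continuous_deriv_of_smooth {φ : ℝ → ℝ} (hφ : ContDiff ℝ ∞ φ) : Continuous (deriv φ) :=
  hφ.continuous_deriv (by exact_mod_cast le_top)

theorem IsWeakDeriv.unique {U : Set ℝ} (hU : IsOpen U) {u g g' : ℝ → ℂ} (hg : IntegrableOn g U)
    (hg' : IntegrableOn g' U) (h : IsWeakDeriv U u g) (h' : IsWeakDeriv U u g') :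
    ∀ᵐ x, x ∈ U → g x = g' x := by
  have key := hU.ae_eq_zero_of_integral_contDiff_smul_eq_zero (μ := volume)
    (f := fun x => g x - g' x) (hg.sub hg').locallyIntegrableOn (fun φ h1 h2 h3 => by
      rw [← setIntegral_eq_integral_of_forall_compl_eq_zero (s := U)]
      · simp only [smul_sub]
        rw [integral_sub (integrableOn_smul_test hg h1.continuous h2)
          (integrableOn_smul_test hg' h1.continuous h2), sub_eq_zero, ← neg_inj,
          ← h φ h1 h2 h3, ← h' φ h1 h2 h3]
      · intro x hx
        rw [image_eq_zero_of_notMem_tsupport fun hm => hx (h3 hm), zero_smul])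
  filter_upwards [key] with x hx hm using sub_eq_zero.1 (hx hm)

theorem IsWeakDeriv.mono {U V : Set ℝ} {u g : ℝ → ℂ} (h : IsWeakDeriv U u g)
    (hV : IsOpen V) (hVU : V ⊆ U) : IsWeakDeriv V u g := by
  intro φ h1 h2 h3
  have e : ∀ F : ℝ → ℂ, (∀ x, x ∉ tsupport φ → F x = 0) → ∫ x in V, F x = ∫ x in U, F x :=
    fun F hF => by
      rw [← setIntegral_eq_integral_of_forall_compl_eq_zero (s := V) (μ := volume.restrict U)
        fun x hx => hF x fun hm => hx (h3 hm), Measure.restrict_restrict hV.measurableSet,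
        inter_eq_left.2 hVU]
  rw [e _ fun x hx => by rw [deriv_eq_zero_of_notMem_tsupport hx, zero_smul],
    e _ fun x hx => by rw [image_eq_zero_of_notMem_tsupport hx, zero_smul]]
  exact h φ h1 h2 (h3.trans hVU)

theorem IsWeakDeriv.congr {U : Set ℝ} {u u' g g' : ℝ → ℂ} (h : IsWeakDeriv U u g)
    (hu : ∀ᵐ x ∂volume.restrict U, u x = u' x) (hg : ∀ᵐ x ∂volume.restrict U, g x = g' x) :
    IsWeakDeriv U u' g' := by
  intro φ h1 h2 h3
  have e1 : ∫ x in U, deriv φ x • u' x = ∫ x in U, deriv φ x • u x :=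
    integral_congr_ae (by filter_upwards [hu] with x hx; rw [hx])
  have e2 : ∫ x in U, φ x • g' x = ∫ x in U, φ x • g x :=
    integral_congr_ae (by filter_upwards [hg] with x hx; rw [hx])
  rw [e1, e2]; exact h φ h1 h2 h3

theorem ACWith.isWeakDeriv {f g : ℝ → ℂ} {a b : ℝ} (hab : a ≤ b) (h : ACWith f g a b) :
    IsWeakDeriv (Ioo a b) f g := by
  intro φ h1 h2 h3
  have hz : ∀ x, x ∉ Ioo a b → φ x = 0 := fun x hx =>
    image_eq_zero_of_notMem_tsupport fun hm => hx (h3 hm)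
  have hφ := ACWith.of_contDiff h1 a b
  have := (h.smul hφ).integral_eq_sub
  rw [hz a (by simp), hz b (by simp), zero_smul, zero_smul, sub_zero,
    intervalIntegral.integral_add (hφ.integrable.smul_continuousOn h.continuousOn)
      (h.integrable.continuousOn_smul hφ.continuousOn),
    intervalIntegral.integral_of_le hab, intervalIntegral.integral_of_le hab,
    integral_Ioc_eq_integral_Ioo, integral_Ioc_eq_integral_Ioo] at this
  exact eq_neg_of_add_eq_zero_left this

/-- The primitive started left of the support vanishes again to its right exactly because η has mean
zero. -/
theorem exists_primitive_test {η : ℝ → ℝ} {c d : ℝ} (hη : ContDiff ℝ ∞ η)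
    (hc : HasCompactSupport η) (hs : tsupport η ⊆ Ioo c d) (h0 : ∫ x, η x = 0) :
    ∃ φ : ℝ → ℝ, ContDiff ℝ ∞ φ ∧ HasCompactSupport φ ∧ tsupport φ ⊆ Ioo c d ∧
      deriv φ = η := by
  rcases (tsupport η).eq_empty_or_nonempty with he | hne
  · refine ⟨0, contDiff_const, HasCompactSupport.zero, by simp [tsupport], ?_⟩
    rw [tsupport_eq_empty_iff] at he
    rw [he]; ext x; simp
  set m := sInf (tsupport η)
  set M := sSup (tsupport η)
  have hK : IsCompact (tsupport η) := hc
  have hm : m ∈ tsupport η := hK.sInf_mem hne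
  have hM : M ∈ tsupport η := hK.sSup_mem hne
  have hsub : ∀ x, x ∉ Icc m M → η x = 0 := fun x hx =>
    image_eq_zero_of_notMem_tsupport fun h =>
      hx ⟨csInf_le hK.bddBelow h, le_csSup hK.bddAbove h⟩
  have hcont := hη.continuous
  have hint : Integrable η := hcont.integrable_of_hasCompactSupport hc
  set φ : ℝ → ℝ := fun x => ∫ t in c..x, η t
  have hd : ∀ x, HasDerivAt φ (η x) x := fun x =>
    intervalIntegral.integral_hasDerivAt_right (hcont.intervalIntegrable _ _)
      hcont.aestronglyMeasurable.stronglyMeasurableAtFilter hcont.continuousAt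
  have hde : deriv φ = η := funext fun x => (hd x).deriv
  have hφ0 : ∀ x, x ∉ Icc m M → φ x = 0 := by
    intro x hx
    rw [mem_Icc, not_and_or, not_le, not_le] at hx
    rcases hx with hx | hx
    · have : EqOn η (fun _ => 0) (uIcc c x) := by
        intro t ht
        exact hsub t fun h => absurd (ht.2.trans_lt (max_lt (hs hm).1 hx)) (not_lt.2 h.1)
      simp only [φ]
      rw [intervalIntegral.integral_congr this, intervalIntegral.integral_zero]
    · simp only [φ]
      rw [intervalIntegral.integral_eq_integral_of_support_subset, h0]
      intro t ht
      have : t ∈ Icc m M := by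
        by_contra h
        exact ht (hsub t h)
      exact ⟨(hs hm).1.trans_le this.1, this.2.trans hx.le⟩
  have hts : tsupport φ ⊆ Icc m M := closure_minimal (fun x hx => by
    by_contra h; exact hx (hφ0 x h)) isClosed_Icc
  refine ⟨φ, ?_, ?_, hts.trans ?_, hde⟩
  · rw [show ((⊤ : ℕ∞) : WithTop ℕ∞) = (⊤ : ℕ∞) + 1 from rfl, contDiff_succ_iff_deriv]
    exact ⟨fun x => (hd x).differentiableAt, by simp, hde ▸ hη⟩
  · exact isCompact_Icc.of_isClosed_subset (isClosed_tsupport _) hts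
  · exact fun x hx => ⟨(hs hm).1.trans_le hx.1, hx.2.trans_lt (hs hM).2⟩

/-- With a bump χ of integral 1, any test function ψ becomes a derivative after subtracting (∫ψ)χ.
Hence ∫ψw = (∫ψ)(∫χw), and the constant is ∫χw. -/
theorem ae_eq_const_of_integral_deriv_eq_zero {w : ℝ → ℂ} {c d : ℝ} (hcd : c < d)
    (hw : IntegrableOn w (Ioo c d))
    (h : ∀ φ : ℝ → ℝ, ContDiff ℝ ∞ φ → HasCompactSupport φ → tsupport φ ⊆ Ioo c d →
      ∫ x in Ioo c d, deriv φ x • w x = 0) :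
    ∃ C : ℂ, ∀ᵐ x, x ∈ Ioo c d → w x = C := by
  let B : ContDiffBump ((c + d) / 2) := ⟨(d - c) / 8, (d - c) / 4, by linarith, by linarith⟩
  set χ := B.normed volume
  have hχ1 : ContDiff ℝ ∞ χ := B.contDiff_normed
  have hχ2 : HasCompactSupport χ := B.hasCompactSupport_normed
  have hχ3 : tsupport χ ⊆ Ioo c d := by
    rw [B.tsupport_normed_eq, Real.closedBall_eq_Icc]
    intro x hx
    simp only [mem_Icc, B] at hx
    constructor <;> linarith [hx.1, hx.2]
  have hχ4 : ∫ x, χ x = 1 := B.integral_normed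
  refine ⟨∫ x in Ioo c d, χ x • w x, ?_⟩
  have key := isOpen_Ioo.ae_eq_zero_of_integral_contDiff_smul_eq_zero (μ := volume)
    (U := Ioo c d) (f := fun x => w x - ∫ x in Ioo c d, χ x • w x)
    (hw.sub (integrableOn_const (by simp))).locallyIntegrableOn (fun ψ h1 h2 h3 => by
      rw [← setIntegral_eq_integral_of_forall_compl_eq_zero (s := Ioo c d)]
      swap
      · intro x hx
        rw [image_eq_zero_of_notMem_tsupport fun hm => hx (h3 hm), zero_smul]
      have hψi : Integrable ψ := h1.continuous.integrable_of_hasCompactSupport h2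
      have hχi : Integrable χ := hχ1.continuous.integrable_of_hasCompactSupport hχ2
      have hψU : ∫ x in Ioo c d, ψ x = ∫ x, ψ x :=
        setIntegral_eq_integral_of_forall_compl_eq_zero fun x hx =>
          image_eq_zero_of_notMem_tsupport fun hm => hx (h3 hm)
      obtain ⟨φ, p1, p2, p3, p4⟩ := exists_primitive_test (η := fun x => ψ x - (∫ y, ψ y) * χ x)
        (c := c) (d := d) (h1.sub (contDiff_const.mul hχ1)) (h2.sub (hχ2.mul_left))
        ((tsupport_sub _ _).trans (union_subset h3 ((tsupport_mul_subset_right).trans hχ3)))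
        (by rw [integral_sub hψi (hχi.const_mul _), integral_const_mul, hχ4]; ring)
      have := h φ p1 p2 p3
      rw [p4] at this
      simp only [sub_smul, mul_smul] at this
      have hχw : IntegrableOn (fun x => (∫ y, ψ y) • χ x • w x) (Ioo c d) :=
        Integrable.smul (∫ y, ψ y) (integrableOn_smul_test hw hχ1.continuous hχ2)
      rw [integral_sub (integrableOn_smul_test hw h1.continuous h2) hχw, integral_smul] at this
      simp only [smul_sub]
      rw [integral_sub (integrableOn_smul_test hw h1.continuous h2)
        ((hψi.integrableOn).smul_const _), integral_smul_const, hψU]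
      exact this)
  filter_upwards [key] with x hx hm using sub_eq_zero.1 (hx hm)

/-- The constant near each point is chosen separately. Two of them agree whenever one centre lies in
the interval of the other, because the intervals then overlap in positive measure. -/
theorem exists_locallyConst_of_integral_deriv_eq_zero {w : ℝ → ℂ} {U : Set ℝ} (hU : IsOpen U)
    (hw : IntegrableOn w U) (h : IsWeakDeriv U w 0) :
    ∃ s : ℝ → ℂ, (∀ x ∈ U, ∀ᶠ y in 𝓝 x, s y = s x) ∧ ∀ᵐ x, x ∈ U → w x = s x := by
  have h1 : ∀ x ∈ U, ∃ C : ℂ, ∃ r > 0, Ioo (x - r) (x + r) ⊆ U ∧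
      ∀ᵐ y, y ∈ Ioo (x - r) (x + r) → w y = C := by
    intro x hx
    obtain ⟨r, hr, hrU⟩ := Metric.isOpen_iff.1 hU x hx
    rw [Real.ball_eq_Ioo] at hrU
    obtain ⟨C, hC⟩ := ae_eq_const_of_integral_deriv_eq_zero (by linarith) (hw.mono_set hrU)
      (fun φ p1 p2 p3 => by simpa using h.mono isOpen_Ioo hrU φ p1 p2 p3)
    exact ⟨C, r, hr, hrU, hC⟩
  choose! s r hr hrU hs using h1
  have h2 : ∀ x ∈ U, ∀ y ∈ Ioo (x - r x) (x + r x), s y = s x := by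
    intro x hx y hy
    have hyU := hrU x hx hy
    have hpos : volume (Ioo (max (x - r x) (y - r y)) (min (x + r x) (y + r y))) ≠ 0 := by
      rw [Real.volume_Ioo]
      simp only [ne_eq, ENNReal.ofReal_eq_zero, not_le, sub_pos]
      have := hr y hyU
      have := hr x hx
      exact max_lt (lt_min (by linarith) (by linarith [hy.1])) (lt_min (by linarith [hy.2])
        (by linarith))
    by_contra hne
    apply hpos
    rw [measure_eq_zero_iff_ae_notMem]
    filter_upwards [hs x hx, hs y hyU] with z hz1 hz2 hz
    rw [mem_Ioo, max_lt_iff, lt_min_iff] at hz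
    exact hne ((hz2 ⟨hz.1.2, hz.2.2⟩).symm.trans (hz1 ⟨hz.1.1, hz.2.1⟩))
  refine ⟨s, fun x hx => ?_, ?_⟩
  · filter_upwards [Ioo_mem_nhds (show x - r x < x by linarith [hr x hx])
      (show x < x + r x by linarith [hr x hx])] with y hy using h2 x hx y hy
  · have : volume {x | ¬ (x ∈ U → w x = s x)} = 0 := by
      refine measure_null_of_locally_null _ fun x hx => ?_
      simp only [mem_ofPred_eq, Classical.not_imp] at hx
      refine ⟨_, inter_mem_nhdsWithin _ (Ioo_mem_nhds (show x - r x < x by linarith [hr x hx.1])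
        (show x < x + r x by linarith [hr x hx.1])), ?_⟩
      rw [measure_eq_zero_iff_ae_notMem]
      filter_upwards [hs x hx.1] with y hy hym
      have := hym.1
      simp only [mem_ofPred_eq, Classical.not_imp] at this
      exact this.2 ((hy hym.2).trans (h2 x hx.1 y hym.2).symm)
    exact this

theorem isOpen_Ioo_diff (J : Finset ℝ) : IsOpen (Ioo (0 : ℝ) 1 \ (J : Set ℝ)) :=
  isOpen_Ioo.sdiff J.finite_toSet.isClosed

theorem Ioo_diff_ae_eq (J : Finset ℝ) :
    (Ioo (0 : ℝ) 1 \ (J : Set ℝ) : Set ℝ) =ᵐ[volume] Ioo (0 : ℝ) 1 :=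
  sdiff_null_ae_eq_self (J.finite_toSet.measure_zero volume)

theorem restrict_Ioo_diff (J : Finset ℝ) :
    (volume : Measure ℝ).restrict (Ioo (0 : ℝ) 1 \ (J : Set ℝ)) = volume.restrict (Ioo 0 1) :=
  Measure.restrict_congr_set (Ioo_diff_ae_eq J)

theorem intervalIntegrable_iff_Ioo {g : ℝ → ℂ} :
    IntervalIntegrable g volume 0 1 ↔ IntegrableOn g (Ioo 0 1) := by
  rw [intervalIntegrable_iff_integrableOn_Ioo_of_le zero_le_one]

/-- The difference of u and the primitive of g has weak derivative 0 off J. All jumps of u are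
thereby stored in a locally constant function, while the primitive is absolutely continuous across
them. -/
theorem exists_rep {J : Finset ℝ} {u g : ℝ → ℂ} (hu : IntegrableOn u (Ioo 0 1))
    (hg : IntegrableOn g (Ioo 0 1)) (h : IsWeakDeriv (Ioo 0 1 \ (J : Set ℝ)) u g) :
    ∃ s : ℝ → ℂ, (∀ x ∈ Ioo (0 : ℝ) 1 \ (J : Set ℝ), ∀ᶠ y in 𝓝 x, s y = s x) ∧
      ∀ᵐ x, x ∈ Ioo (0 : ℝ) 1 \ (J : Set ℝ) → u x = (∫ t in (0 : ℝ)..x, g t) + s x := by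
  have hgi := intervalIntegrable_iff_Ioo.2 hg
  have hW : ACWith (fun x => ∫ t in (0 : ℝ)..x, g t) g 0 1 := .of_integral hgi (by simp)
  have hWw := (hW.isWeakDeriv zero_le_one).mono (isOpen_Ioo_diff J) sdiff_subset
  have hWi : IntegrableOn (fun x => ∫ t in (0 : ℝ)..x, g t) (Ioo 0 1) := 
    intervalIntegrable_iff_Ioo.1 (hW.continuousOn.intervalIntegrable)
  obtain ⟨s, h1, h2⟩ := exists_locallyConst_of_integral_deriv_eq_zero (isOpen_Ioo_diff J)
    (w := fun x => u x - ∫ t in (0 : ℝ)..x, g t) ((hu.sub hWi).mono_set sdiff_subset) (by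
      intro φ p1 p2 p3
      have q1 := h φ p1 p2 p3
      have q2 := hWw φ p1 p2 p3
      simp only [smul_sub, Pi.zero_apply, smul_zero, integral_zero, neg_zero]
      rw [integral_sub, q1, q2, sub_self]
      · exact integrableOn_smul_test (hu.mono_set sdiff_subset) (continuous_deriv_of_smooth p1)
          p2.deriv
      · exact integrableOn_smul_test (hWi.mono_set sdiff_subset) (continuous_deriv_of_smooth p1)
          p2.deriv)
  refine ⟨s, h1, ?_⟩
  filter_upwards [h2] with x hx hm
  rw [← hx hm]; ring

theorem eq_of_eventually_const {s : ℝ → ℂ} {c d : ℝ}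
    (h : ∀ x ∈ Ioo c d, ∀ᶠ y in 𝓝 x, s y = s x) {x y : ℝ} (hx : x ∈ Ioo c d)
    (hy : y ∈ Ioo c d) : s x = s y := by
  have hd : ∀ z ∈ Ioo c d, HasDerivAt s 0 z := fun z hz =>
    (hasDerivAt_const z (s z)).congr_of_eventuallyEq (h z hz)
  exact isOpen_Ioo.is_const_of_deriv_eq_zero isPreconnected_Ioo
    (fun z hz => (hd z hz).differentiableAt.differentiableWithinAt)
    (fun z hz => (hd z hz).deriv) hx hy

/-- Nontriviality of the filter defining the traces is what makes a trace unique. -/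
instance neBot_nhdsGT_inf_ae (a : ℝ) : (𝓝[>] a ⊓ ae volume).NeBot := by
  rw [inf_neBot_iff]
  intro s hs t ht
  obtain ⟨b, hb, hbs⟩ := (mem_nhdsGT_iff_exists_Ioo_subset).1 hs
  by_contra hne
  have : volume (Ioo a b) = 0 := by
    refine measure_mono_null ?_ (mem_ae_iff.1 ht)
    exact fun x hx hxt => hne ⟨x, hbs hx, hxt⟩
  rw [Real.volume_Ioo, ENNReal.ofReal_eq_zero, sub_nonpos] at this
  exact absurd hb (not_lt.2 this)

instance neBot_nhdsLT_inf_ae (a : ℝ) : (𝓝[<] a ⊓ ae volume).NeBot := by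
  rw [inf_neBot_iff]
  intro s hs t ht
  obtain ⟨b, hb, hbs⟩ := (mem_nhdsLT_iff_exists_Ioo_subset).1 hs
  by_contra hne
  have : volume (Ioo b a) = 0 := by
    refine measure_mono_null ?_ (mem_ae_iff.1 ht)
    exact fun x hx hxt => hne ⟨x, hbs hx, hxt⟩
  rw [Real.volume_Ioo, ENNReal.ofReal_eq_zero, sub_nonpos] at this
  exact absurd hb (not_lt.2 this)

theorem eventually_nhdsGT_zero_inf_ae {p : ℝ → Prop} (h : ∀ᵐ x, x ∈ Ioo (0 : ℝ) 1 → p x) :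
    ∀ᶠ x in 𝓝[>] (0 : ℝ) ⊓ ae volume, p x := by
  filter_upwards [mem_inf_of_right (f := 𝓝[>] (0 : ℝ)) h,
    mem_inf_of_left (g := ae volume) (Ioo_mem_nhdsGT (zero_lt_one' ℝ))] with x h1 h2 using h1 h2

theorem eventually_nhdsLT_one_inf_ae {p : ℝ → Prop} (h : ∀ᵐ x, x ∈ Ioo (0 : ℝ) 1 → p x) :
    ∀ᶠ x in 𝓝[<] (1 : ℝ) ⊓ ae volume, p x := by
  filter_upwards [mem_inf_of_right (f := 𝓝[<] (1 : ℝ)) h,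
    mem_inf_of_left (g := ae volume) (Ioo_mem_nhdsLT (zero_lt_one' ℝ))] with x h1 h2 using h1 h2

theorem TraceAtZero.congr {u v : ℝ → ℂ} {c : ℂ} (h : TraceAtZero u c)
    (huv : ∀ᵐ x, x ∈ Ioo (0 : ℝ) 1 → u x = v x) : TraceAtZero v c :=
  Tendsto.congr' (eventually_nhdsGT_zero_inf_ae huv) h

theorem TraceAtOne.congr {u v : ℝ → ℂ} {c : ℂ} (h : TraceAtOne u c)
    (huv : ∀ᵐ x, x ∈ Ioo (0 : ℝ) 1 → u x = v x) : TraceAtOne v c :=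
  Tendsto.congr' (eventually_nhdsLT_one_inf_ae huv) h

theorem TraceAtZero.eq_of_tendsto {u f : ℝ → ℂ} {c c' : ℂ} (h : TraceAtZero u c)
    (huf : ∀ᵐ x, x ∈ Ioo (0 : ℝ) 1 → u x = f x) (hf : Tendsto f (𝓝[>] 0) (𝓝 c')) : c' = c :=
  tendsto_nhds_unique (hf.mono_left inf_le_left) (h.congr huf)

theorem TraceAtOne.eq_of_tendsto {u f : ℝ → ℂ} {c c' : ℂ} (h : TraceAtOne u c)
    (huf : ∀ᵐ x, x ∈ Ioo (0 : ℝ) 1 → u x = f x) (hf : Tendsto f (𝓝[<] 1) (𝓝 c')) : c' = c :=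
  tendsto_nhds_unique (hf.mono_left inf_le_left) (h.congr huf)

theorem integrableOn_of_memLp {U : Set ℝ} {g : ℝ → ℂ} (hU : U ⊆ Ioo 0 1)
    (hg : MemLp g 2 (volume.restrict U)) : IntegrableOn g U := by
  have : IsFiniteMeasure ((volume : Measure ℝ).restrict U) := ⟨by
    rw [Measure.restrict_apply_univ]
    exact (measure_mono hU).trans_lt (by simp)⟩
  exact hg.integrable (by norm_num)

theorem Admissible.exists_rep {α : ℝ} {u : ℝ → ℂ} (h : Admissible α u) :
    ∃ f : ℝ → ℂ, (∀ᵐ x, x ∈ Ioo (0 : ℝ) 1 → u x = f x) ∧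
      ACWith f (weakDeriv (Ioo 0 1) u) 0 1 ∧ f 0 = 1 ∧ f 1 = Complex.exp (α * Complex.I) := by
  obtain ⟨hH, h0, h1⟩ := h
  have hg := integrableOn_of_memLp Subset.rfl (weakDeriv_memLp hH)
  set g := weakDeriv (Ioo 0 1) u
  obtain ⟨s, hs, hus⟩ := Twist.exists_rep (J := ∅) (integrableOn_of_memLp Subset.rfl hH.1) hg
    (by simpa using isWeakDeriv_weakDeriv hH)
  simp only [Finset.coe_empty, sdiff_empty] at hs hus
  set f : ℝ → ℂ := fun x => s (1 / 2) + ∫ t in (0 : ℝ)..x, g t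
  have huf : ∀ᵐ x, x ∈ Ioo (0 : ℝ) 1 → u x = f x := by
    filter_upwards [hus] with x hx hm
    rw [hx hm, eq_of_eventually_const hs hm (show (1 / 2 : ℝ) ∈ Ioo 0 1 by norm_num), add_comm]
  have hf : ACWith f g 0 1 := .of_integral (intervalIntegrable_iff_Ioo.2 hg) (by simp [f])
  have hc := hf.continuousOn
  rw [uIcc_of_le zero_le_one] at hc
  refine ⟨f, huf, hf, ?_, ?_⟩
  · refine h0.eq_of_tendsto huf ((hc 0 (by simp)).mono_left ?_)
    rw [← nhdsWithin_Ioo_eq_nhdsGT (zero_lt_one' ℝ)]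
    exact nhdsWithin_mono _ Ioo_subset_Icc_self
  · refine h1.eq_of_tendsto huf ((hc 1 (by simp)).mono_left ?_)
    rw [← nhdsWithin_Ioo_eq_nhdsLT (zero_lt_one' ℝ)]
    exact nhdsWithin_mono _ Ioo_subset_Icc_self

end WeakDerivative

/-! ### Weak limits in L² along an ultrafilter -/

section WeakLimits

/-- Banach–Alaoglu in the dual, carried back by the Riesz isomorphism. With an ultrafilter no
subsequence has to be extracted. -/
theorem exists_weak_limit_hilbert {H : Type*} [NormedAddCommGroup H] [InnerProductSpace ℝ H]
    [CompleteSpace H] (𝒰 : Ultrafilter ℕ) {S : ℕ → H} {R : ℝ} (hS : ∀ j, ‖S j‖ ≤ R) :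
    ∃ s : H, ∀ h : H, Tendsto (fun j => inner ℝ (S j) h) 𝒰 (𝓝 (inner ℝ s h)) := by
  let T : ℕ → WeakDual ℝ H := fun j => StrongDual.toWeakDual (InnerProductSpace.toDual ℝ H (S j))
  have hK := WeakDual.isCompact_closedBall (𝕜 := ℝ) (E := H) 0 R
  have hmem : ∀ j, T j ∈ WeakDual.toStrongDual ⁻¹' Metric.closedBall (0 : StrongDual ℝ H) R := by
    intro j
    have : ‖InnerProductSpace.toDual ℝ H (S j)‖ ≤ R := by
      rw [LinearIsometryEquiv.norm_map]; exact hS j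
    simpa [T] using this
  obtain ⟨t, -, ht⟩ := hK.ultrafilter_le_nhds (𝒰.map T) (by
    rw [le_principal_iff]
    exact mem_map.2 (Filter.univ_mem' hmem))
  refine ⟨(InnerProductSpace.toDual ℝ H).symm (WeakDual.toStrongDual t), fun h => ?_⟩
  rw [InnerProductSpace.toDual_symm_apply]
  have h1 : Tendsto T 𝒰 (𝓝 t) := ht
  have := ((WeakDual.eval_continuous h).tendsto t).comp h1
  simpa [T, Function.comp_def] using this

variable {X : Type*} [MeasurableSpace X] {μ : Measure X}

theorem inner_toLp {f g : X → ℝ} (hf : MemLp f 2 μ) (hg : MemLp g 2 μ) :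
    inner ℝ (hf.toLp f) (hg.toLp g) = ∫ x, f x * g x ∂μ := by
  rw [L2.inner_def]
  refine integral_congr_ae ?_
  filter_upwards [hf.coeFn_toLp, hg.coeFn_toLp] with x h1 h2
  rw [h1, h2, Real.inner_apply]

theorem norm_toLp_sq {f : X → ℝ} (hf : MemLp f 2 μ) :
    ‖hf.toLp f‖ ^ 2 = ∫ x, f x ^ 2 ∂μ := by
  rw [← real_inner_self_eq_norm_sq, inner_toLp]
  simp only [sq]

/-- The first property is the product of weak and strong convergence: uniformly bounded, almost
everywhere convergent factors converge in L² by dominated convergence. The second is weak lower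
semicontinuity of the distance to c; its bound is only required 𝒰-eventually, because the cost of
the dips is subtracted from the energy bound only for such j. -/
theorem exists_weak_limit [IsFiniteMeasure μ] {σ : ℕ → X → ℝ} (hσ : ∀ j, MemLp (σ j) 2 μ) {R : ℝ}
    (hR : ∀ j, ∫ x, σ j x ^ 2 ∂μ ≤ R) (𝒰 : Ultrafilter ℕ) (h𝒰 : (𝒰 : Filter ℕ) ≤ atTop) :
    ∃ τ : X → ℝ, MemLp τ 2 μ ∧
      (∀ (k : ℕ → X → ℝ) (k' : X → ℝ) (C : ℝ), (∀ j, AEStronglyMeasurable (k j) μ) →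
        (∀ j, ∀ᵐ x ∂μ, |k j x| ≤ C) →
        (∀ᵐ x ∂μ, Tendsto (fun j => k j x) atTop (𝓝 (k' x))) →
        Tendsto (fun j => ∫ x, σ j x * k j x ∂μ) 𝒰 (𝓝 (∫ x, τ x * k' x ∂μ))) ∧
      ∀ (c : X → ℝ) (R' : ℝ), MemLp c 2 μ →
        (∀ᶠ j in (𝒰 : Filter ℕ), ∫ x, (σ j x - c x) ^ 2 ∂μ ≤ R') →
        ∫ x, (τ x - c x) ^ 2 ∂μ ≤ R' := by
  have hR0 : 0 ≤ R := (integral_nonneg fun x => sq_nonneg _).trans (hR 0)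
  let S : ℕ → Lp ℝ 2 μ := fun j => (hσ j).toLp (σ j)
  have hS : ∀ j, ‖S j‖ ≤ √R := fun j => by
    rw [Real.le_sqrt (norm_nonneg _) hR0, norm_toLp_sq]; exact hR j
  obtain ⟨s, hs⟩ := exists_weak_limit_hilbert 𝒰 hS
  have hsm : MemLp s 2 μ := Lp.memLp s
  have hse : hsm.toLp s = s := Lp.toLp_coeFn s hsm
  refine ⟨s, hsm, ?_, ?_⟩
  · intro k k' C hk hC hlim
    have hk2 : ∀ j, MemLp (k j) 2 μ := fun j => MemLp.of_bound (hk j) C (hC j)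
    have hk'm : AEStronglyMeasurable k' μ := aestronglyMeasurable_of_tendsto_ae atTop hk hlim
    have hC' : ∀ᵐ x ∂μ, |k' x| ≤ C := by
      filter_upwards [ae_all_iff.2 hC, hlim] with x h1 h2
      exact le_of_tendsto h2.abs (Eventually.of_forall h1)
    have hk'2 : MemLp k' 2 μ := MemLp.of_bound hk'm C hC'
    have h0 : Tendsto (fun j => ∫ x, (k j x - k' x) ^ 2 ∂μ) atTop (𝓝 0) := by
      have : (0 : ℝ) = ∫ x : X, (0 : ℝ) ∂μ := by simp
      rw [this]
      refine tendsto_integral_of_dominated_convergence (fun _ => (2 * C) ^ 2)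
        (fun j => ((hk j).sub hk'm).pow 2) (integrable_const _) (fun j => ?_) ?_
      · filter_upwards [hC j, hC'] with x h1 h2
        rw [Real.norm_eq_abs, abs_pow]
        refine pow_le_pow_left₀ (abs_nonneg _) ?_ 2
        exact (abs_sub _ _).trans (by linarith)
      · filter_upwards [hlim] with x hx
        simpa using ((hx.sub_const (k' x)).pow 2)
    have h1 : Tendsto (fun j => ‖(hk2 j).toLp (k j) - hk'2.toLp k'‖) atTop (𝓝 0) := by
      have : (fun j => ‖(hk2 j).toLp (k j) - hk'2.toLp k'‖) =
          fun j => √(∫ x, (k j x - k' x) ^ 2 ∂μ) := by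
        ext j
        rw [← MemLp.toLp_sub, ← Real.sqrt_sq (norm_nonneg (MemLp.toLp _ _)), norm_toLp_sq]
        rfl
      rw [this]
      simpa using h0.sqrt
    have h2 : Tendsto (fun j => inner ℝ (S j) ((hk2 j).toLp (k j) - hk'2.toLp k')) atTop (𝓝 0) := by
      refine squeeze_zero_norm (a := fun j => √R * ‖(hk2 j).toLp (k j) - hk'2.toLp k'‖)
        (fun j => ?_) (by simpa using h1.const_mul (√R))
      exact (norm_inner_le_norm _ _).trans (by gcongr; exact hS j)
    have h3 := (h2.mono_left h𝒰).add (hs (hk'2.toLp k'))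
    rw [zero_add, ← hse, inner_toLp] at h3
    refine h3.congr fun j => ?_
    rw [← inner_add_right, sub_add_cancel, inner_toLp]
  · intro c R' hc hR'
    obtain ⟨j, hj⟩ := hR'.exists
    have hR'0 : 0 ≤ R' := (integral_nonneg fun x => sq_nonneg _).trans hj
    have e : ∫ x, (s x - c x) ^ 2 ∂μ = ‖s - hc.toLp c‖ ^ 2 := by
      conv_rhs => rw [← hse]
      rw [← MemLp.toLp_sub, norm_toLp_sq]; rfl
    rw [e]
    -- Testing the weak convergence against s − c itself and using Cauchy–Schwarz gives ‖s − c‖² ≤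
    -- √R' ‖s − c‖.
    have h1 : ‖s - hc.toLp c‖ ^ 2 ≤ √R' * ‖s - hc.toLp c‖ := by
      rw [← real_inner_self_eq_norm_sq]
      have h0 := (hs (s - hc.toLp c)).sub_const (inner ℝ (hc.toLp c) (s - hc.toLp c))
      simp only [← inner_sub_left] at h0
      refine le_of_tendsto h0 ?_
      filter_upwards [hR'] with j hj
      refine (real_inner_le_norm _ _).trans ?_
      gcongr
      rw [Real.le_sqrt (norm_nonneg _) hR'0, ← MemLp.toLp_sub, norm_toLp_sq]; exact hj
    have h2 : ‖s - hc.toLp c‖ ≤ √R' := by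
      by_contra! h
      nlinarith [Real.sqrt_nonneg R']
    rwa [Real.le_sqrt (norm_nonneg _) hR'0] at h2

end WeakLimits

/-! ### The Modica–Mortola inequality and the direction of a map -/

section Modulus

theorem abs_deriv_norm_le {f : ℝ → ℂ} {g : ℂ} {ρ' x : ℝ} (hf : HasDerivAt f g x)
    (hρ : HasDerivAt (fun y => ‖f y‖) ρ' x) : |ρ'| ≤ ‖g‖ := by
  rw [hasDerivAt_iff_tendsto_slope] at hf hρ
  refine le_of_tendsto_of_tendsto' hρ.abs hf.norm fun y => ?_
  rw [slope_def_module, slope_def_module, norm_smul, smul_eq_mul, abs_mul, Real.norm_eq_abs]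
  gcongr
  exact abs_norm_sub_norm_le _ _

/-- The Modica–Mortola part of the energy density. -/
noncomputable def wellDensity (ε : ℝ) (f g : ℝ → ℂ) (x : ℝ) : ℝ :=
  ε / 2 * ‖g x‖ ^ 2 + 1 / (4 * ε) * (‖f x‖ ^ 2 - 1) ^ 2

theorem wellDensity_nonneg {ε : ℝ} (hε : 0 < ε) (f g : ℝ → ℂ) (x : ℝ) :
    0 ≤ wellDensity ε f g x := by
  unfold wellDensity; positivity

/-- Young's inequality; the difference of the two sides is an explicit multiple of the square (√2
ε‖g‖ − |1 − ‖f‖²|)². -/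
theorem mul_le_wellDensity {ε : ℝ} (hε : 0 < ε) (f g : ℝ → ℂ) (x : ℝ) :
    |1 - ‖f x‖ ^ 2| * ‖g x‖ ≤ √2 * wellDensity ε f g x := by
  have h2 : √2 ^ 2 = 2 := Real.sq_sqrt (by norm_num)
  have h2p : 0 < √2 := by positivity
  have hs : (‖f x‖ ^ 2 - 1) ^ 2 = |1 - ‖f x‖ ^ 2| ^ 2 := by rw [sq_abs]; ring
  rw [wellDensity, hs]
  set a := |1 - ‖f x‖ ^ 2|
  set b := ‖g x‖
  have key : √2 * (ε / 2 * b ^ 2 + 1 / (4 * ε) * a ^ 2) - a * b =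
      √2 / (4 * ε) * (√2 * ε * b - a) ^ 2 := by
    field_simp
    linear_combination 2 * (-b ^ 2 * ε ^ 2 * √2 + 2 * a * b * ε) * h2
  have : 0 ≤ √2 / (4 * ε) * (√2 * ε * b - a) ^ 2 := by positivity
  linarith

theorem ac_norm {f : ℝ → ℂ} {a b : ℝ} (h : AbsolutelyContinuousOnInterval f a b) :
    AbsolutelyContinuousOnInterval (fun x => ‖f x‖) a b :=
  ac_of_dist_le 1 h fun x _ y _ => by
    rw [one_mul, Real.dist_eq, dist_eq_norm]; exact abs_norm_sub_norm_le _ _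

theorem intervalIntegrable_sq {g : ℝ → ℂ} (hg : MemLp g 2 (volume.restrict (Ioo 0 1))) :
    IntervalIntegrable (fun x => ‖g x‖ ^ 2) volume 0 1 := by
  rw [intervalIntegrable_iff_integrableOn_Ioo_of_le zero_le_one]
  exact hg.integrable_norm_pow (by norm_num)

theorem ACWith.intervalIntegrable_wellDensity {f g : ℝ → ℂ} (h : ACWith f g 0 1)
    (hg : MemLp g 2 (volume.restrict (Ioo 0 1))) (ε : ℝ) :
    IntervalIntegrable (wellDensity ε f g) volume 0 1 := by
  refine ((intervalIntegrable_sq hg).const_mul _).add (ContinuousOn.intervalIntegrable ?_)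
  have := h.continuousOn
  fun_prop

/-- The chain rule gives (‖f‖ − ‖f‖³/3)' = (1 − ‖f‖²)‖f‖', and |‖f‖'| ≤ ‖g‖, so the integrand is
bounded by the well density. -/
theorem modica_mortola {f g : ℝ → ℂ} (h : ACWith f g 0 1)
    (hg : MemLp g 2 (volume.restrict (Ioo 0 1))) {ε : ℝ} (hε : 0 < ε) {x y : ℝ} (hxy : x ≤ y)
    (hx : 0 ≤ x) (hy : y ≤ 1) :
    |(‖f y‖ - ‖f y‖ ^ 3 / 3) - (‖f x‖ - ‖f x‖ ^ 3 / 3)| ≤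
      √2 * ∫ t in x..y, wellDensity ε f g t := by
  have hsub : uIcc x y ⊆ uIcc 0 1 := by
    rw [uIcc_of_le hxy, uIcc_of_le zero_le_one]; exact Icc_subset_Icc hx hy
  have hm := h.mono hsub
  have hρ := ac_norm hm.ac
  have hac : AbsolutelyContinuousOnInterval (fun t => ‖f t‖ - ‖f t‖ ^ 3 / 3) x y := by
    have := hρ.fun_sub (((hρ.fun_mul hρ).fun_mul hρ).const_mul (1 / 3))
    refine (congrArg (AbsolutelyContinuousOnInterval · x y) (funext fun t => ?_)).mp this
    ring
  have hΦ := ACWith.of_ac hac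
  rw [← hΦ.integral_eq_sub, ← intervalIntegral.integral_const_mul, ← Real.norm_eq_abs]
  refine intervalIntegral.norm_integral_le_of_norm_le hxy ?_
    (((h.intervalIntegrable_wellDensity hg ε).mono_set hsub).const_mul _)
  filter_upwards [hm.hasDerivAt, (ACWith.of_ac hρ).hasDerivAt] with t h1 h2 ht
  have ht' : t ∈ uIcc x y := by rw [uIcc_of_le hxy]; exact Ioc_subset_Icc_self ht
  have h3 := (h2 ht').fun_sub (((h2 ht').fun_pow 3).div_const 3)
  rw [h3.deriv, Real.norm_eq_abs]
  refine le_trans (le_of_eq ?_) ((mul_le_mul_of_nonneg_left (abs_deriv_norm_le (h1 ht') (h2 ht'))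
    (abs_nonneg (1 - ‖f t‖ ^ 2))).trans (mul_le_wellDensity hε f g t))
  rw [← abs_mul]
  congr 1
  push_cast
  ring

/-- Normalisation of a complex number, truncated near the origin so as to be Lipschitz. -/
noncomputable def radial (δ : ℝ) (z : ℂ) : ℂ := (max ‖z‖ δ)⁻¹ • z

theorem norm_radial_le {δ : ℝ} (hδ : 0 < δ) (z : ℂ) : ‖radial δ z‖ ≤ 1 := by
  have : 0 < max ‖z‖ δ := lt_max_of_lt_right hδ
  rw [radial, norm_smul, norm_inv, Real.norm_of_nonneg this.le, inv_mul_le_one₀ this]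
  exact le_max_left _ _

/-- The difference splits into a change of the vector and a change of the divisor; each contributes
δ⁻¹ ‖z − w‖. -/
theorem dist_radial_le {δ : ℝ} (hδ : 0 < δ) (z w : ℂ) :
    dist (radial δ z) (radial δ w) ≤ 2 / δ * dist z w := by
  have hz : 0 < max ‖z‖ δ := lt_max_of_lt_right hδ
  have hw : 0 < max ‖w‖ δ := lt_max_of_lt_right hδ
  have e : radial δ z - radial δ w = (max ‖z‖ δ)⁻¹ • (z - w) +
      ((max ‖w‖ δ - max ‖z‖ δ) * (max ‖z‖ δ)⁻¹) • radial δ w := by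
    have : (max ‖w‖ δ - max ‖z‖ δ) * (max ‖z‖ δ)⁻¹ * (max ‖w‖ δ)⁻¹ =
        (max ‖z‖ δ)⁻¹ - (max ‖w‖ δ)⁻¹ := by field_simp
    rw [radial, radial, smul_smul, this, sub_smul, smul_sub]
    abel
  rw [dist_eq_norm, dist_eq_norm, e]
  refine (norm_add_le _ _).trans ?_
  have h1 : (max ‖z‖ δ)⁻¹ ≤ δ⁻¹ := inv_anti₀ hδ (le_max_right _ _)
  have h2 : |max ‖w‖ δ - max ‖z‖ δ| ≤ ‖z - w‖ := by
    refine (abs_max_sub_max_le_abs _ _ _).trans ?_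
    rw [norm_sub_rev]; exact abs_norm_sub_norm_le _ _
  rw [norm_smul, norm_smul, norm_mul, Real.norm_eq_abs (_ - _), Real.norm_of_nonneg
    (inv_nonneg.2 hz.le)]
  have h3 := norm_radial_le hδ w
  have h4 : (max ‖z‖ δ)⁻¹ * ‖z - w‖ ≤ δ⁻¹ * ‖z - w‖ := by gcongr
  have h5 : |max ‖w‖ δ - max ‖z‖ δ| * (max ‖z‖ δ)⁻¹ * ‖radial δ w‖ ≤ ‖z - w‖ * δ⁻¹ * 1 := by
    gcongr
  calc _ ≤ _ := add_le_add h4 h5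
    _ = _ := by ring

theorem continuous_radial {δ : ℝ} (hδ : 0 < δ) : Continuous (radial δ) := by
  unfold radial
  refine Continuous.smul (Continuous.inv₀ (f := fun z : ℂ => max ‖z‖ δ) (by fun_prop) fun z => ?_)
    continuous_id
  exact (lt_max_of_lt_right hδ).ne'

theorem ac_radial {f : ℝ → ℂ} {a b δ : ℝ} (hδ : 0 < δ)
    (h : AbsolutelyContinuousOnInterval f a b) :
    AbsolutelyContinuousOnInterval (fun x => radial δ (f x)) a b :=
  ac_of_dist_le (2 / δ) h fun _ _ _ _ => dist_radial_le hδ _ _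

theorem radial_of_le {δ : ℝ} {z : ℂ} (h : δ ≤ ‖z‖) : radial δ z = ‖z‖⁻¹ • z := by
  rw [radial, max_eq_left h]

/-- Normalising removes the component of g parallel to f x. What remains is tangential, a multiple
of i f/|f|, with size given by the twist. This is how the twist energy controls oscillation
uniformly in ε. -/
theorem hasDerivAt_radial {f : ℝ → ℂ} {g : ℂ} {x δ : ℝ} (hδ : 0 < δ) (hf : HasDerivAt f g x)
    (h : δ < ‖f x‖) :
    HasDerivAt (fun y => radial δ (f y))
      ((twist (f x) g * ((max ‖f x‖ δ) ^ 2)⁻¹ : ℝ) • (Complex.I * radial δ (f x))) x := by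
  have hpos : 0 < ‖f x‖ := hδ.trans h
  have hn : HasDerivAt (fun y => ‖f y‖) (inner ℝ (f x) g / ‖f x‖) x := by
    have h1 := hf.norm_sq.sqrt (by positivity)
    simp only [Real.sqrt_sq (norm_nonneg _)] at h1
    convert h1 using 1
    field_simp
  have h2 := (hn.fun_inv hpos.ne').fun_smul hf
  have h3 := h2.congr_of_eventuallyEq (f₁ := fun y => radial δ (f y)) (by
    filter_upwards [hf.continuousAt.norm.eventually (lt_mem_nhds h)] with y hy
    exact radial_of_le hy.le)
  refine h3.congr_deriv ?_
  rw [radial_of_le h.le, max_eq_left h.le]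
  have hsq : ‖f x‖ ^ 2 = (f x).re ^ 2 + (f x).im ^ 2 := by
    rw [Complex.sq_norm, Complex.normSq_apply]; ring
  have hin : inner ℝ (f x) g = (f x).re * g.re + (f x).im * g.im := by
    rw [Complex.inner]; simp; ring
  rw [hin]
  generalize ‖f x‖ = n at hpos hsq
  apply Complex.ext
  all_goals
    simp only [twist, Complex.add_re, Complex.add_im, Complex.smul_re, Complex.smul_im,
      smul_eq_mul, Complex.mul_re, Complex.mul_im, Complex.I_re, Complex.I_im]
    field_simp
    rw [hsq]
    ring

end Modulus

/-! ### Sequences of bounded energy and the cost of their dips -/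

section Compactness

theorem abs_twist_le (a b : ℂ) : |twist a b| ≤ ‖a‖ * ‖b‖ := by
  have : twist a b = (starRingEnd ℂ a * b).im := by simp [twist]; ring
  rw [this]
  refine (Complex.abs_im_le_norm _).trans ?_
  rw [norm_mul, RCLike.norm_conj]

theorem aestronglyMeasurable_twist {μ : Measure ℝ} {f g : ℝ → ℂ} (hf : AEStronglyMeasurable f μ)
    (hg : AEStronglyMeasurable g μ) : AEStronglyMeasurable (fun x => twist (f x) (g x)) μ := by
  have h : ∀ {f : ℝ → ℂ}, AEStronglyMeasurable f μ →
      AEStronglyMeasurable (fun x => (f x).re) μ ∧ AEStronglyMeasurable (fun x => (f x).im) μ :=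
    fun hf => ⟨Complex.continuous_re.comp_aestronglyMeasurable hf,
      Complex.continuous_im.comp_aestronglyMeasurable hf⟩
  exact ((h hf).1.mul (h hg).2).sub ((h hf).2.mul (h hg).1)

theorem memLp_twist {μ : Measure ℝ} {f g : ℝ → ℂ} (hf : AEStronglyMeasurable f μ)
    (hg : MemLp g 2 μ) {C : ℝ} (hC : ∀ᵐ x ∂μ, ‖f x‖ ≤ C) :
    MemLp (fun x => twist (f x) (g x)) 2 μ := by
  refine MemLp.of_le_mul (c := C) hg (aestronglyMeasurable_twist hf hg.1) ?_
  filter_upwards [hC] with x hx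
  rw [Real.norm_eq_abs]
  exact (abs_twist_le _ _).trans (by gcongr)

theorem ACWith.aestronglyMeasurable {f g : ℝ → ℂ} (h : ACWith f g 0 1) :
    AEStronglyMeasurable f (volume.restrict (Ioo 0 1)) := by
  have := h.continuousOn
  rw [uIcc_of_le zero_le_one] at this
  exact (this.mono Ioo_subset_Icc_self).aestronglyMeasurable measurableSet_Ioo

theorem ACWith.exists_bound {f g : ℝ → ℂ} (h : ACWith f g 0 1) :
    ∃ C, ∀ x ∈ Icc (0 : ℝ) 1, ‖f x‖ ≤ C := by
  have := h.continuousOn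
  rw [uIcc_of_le zero_le_one] at this
  exact isCompact_Icc.exists_bound_of_continuousOn this

theorem ACWith.memLp_twist {f g : ℝ → ℂ} (h : ACWith f g 0 1)
    (hg : MemLp g 2 (volume.restrict (Ioo 0 1))) :
    MemLp (fun x => twist (f x) (g x)) 2 (volume.restrict (Ioo 0 1)) := by
  obtain ⟨C, hC⟩ := h.exists_bound
  exact Twist.memLp_twist h.aestronglyMeasurable hg
    ((ae_restrict_iff' measurableSet_Ioo).2
      (Eventually.of_forall fun x hx => hC x (Ioo_subset_Icc_self hx)))

/-- A sequence of admissible maps with energies at most `M`, converging almost everywhere. -/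
structure BoundedSequence (L : ℝ) (N : ℕ) (e : ℂ) (M : ℝ) (ε : ℕ → ℝ) (f g : ℕ → ℝ → ℂ)
    (u : ℝ → ℂ) : Prop where
  L_pos : 0 < L
  norm_e : ‖e‖ = 1
  eps_pos : ∀ j, 0 < ε j
  eps_tendsto : Tendsto ε atTop (𝓝 0)
  ac : ∀ j, ACWith (f j) (g j) 0 1
  memLp : ∀ j, MemLp (g j) 2 (volume.restrict (Ioo 0 1))
  zero : ∀ j, f j 0 = 1
  one : ∀ j, f j 1 = e
  bound : ∀ j, (∫ x in (0 : ℝ)..1, wellDensity (ε j) (f j) (g j) x) +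
    L / 2 * ∫ x in Ioo 0 1, (twist (f j x) (g j x) - 2 * Real.pi * N) ^ 2 ≤ M
  tendsto : ∀ᵐ x, x ∈ Ioo (0 : ℝ) 1 → Tendsto (fun j => f j x) atTop (𝓝 (u x))

namespace BoundedSequence

variable {L : ℝ} {N : ℕ} {e : ℂ} {M : ℝ} {ε : ℕ → ℝ} {f g : ℕ → ℝ → ℂ} {u : ℝ → ℂ}

theorem well_nonneg (h : BoundedSequence L N e M ε f g u) (j : ℕ) {a b : ℝ} (hab : a ≤ b) :
    0 ≤ ∫ x in a..b, wellDensity (ε j) (f j) (g j) x :=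
  intervalIntegral.integral_nonneg hab fun x _ => wellDensity_nonneg (h.eps_pos j) _ _ x

theorem twist_nonneg (h : BoundedSequence L N e M ε f g u) (j : ℕ) :
    0 ≤ L / 2 * ∫ x in Ioo 0 1, (twist (f j x) (g j x) - 2 * Real.pi * N) ^ 2 :=
  mul_nonneg (half_pos h.L_pos).le (integral_nonneg fun _ => sq_nonneg _)

theorem well_le (h : BoundedSequence L N e M ε f g u) (j : ℕ) :
    ∫ x in (0 : ℝ)..1, wellDensity (ε j) (f j) (g j) x ≤ M := by
  linarith [h.bound j, h.twist_nonneg j]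

/-- The potential term gives ∫ (‖f j‖² − 1)² ≤ 4 ε j M, which tends to 0, and Fatou's lemma passes
to the limit. -/
theorem norm_limit (h : BoundedSequence L N e M ε f g u) :
    ∀ᵐ x, x ∈ Ioo (0 : ℝ) 1 → ‖u x‖ = 1 := by
  have hM : 0 ≤ M := (h.well_nonneg 0 zero_le_one).trans (h.well_le 0)
  have hb : ∀ j, ∫⁻ x in Ioo (0 : ℝ) 1, ENNReal.ofReal ((‖f j x‖ ^ 2 - 1) ^ 2) ≤
      ENNReal.ofReal (4 * ε j * M) := by
    intro j
    have hεj := h.eps_pos j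
    have hi : IntervalIntegrable (fun x => (‖f j x‖ ^ 2 - 1) ^ 2) volume 0 1 := by
      have := (h.ac j).continuousOn
      exact ContinuousOn.intervalIntegrable (by fun_prop)
    rw [← ofReal_integral_eq_lintegral_ofReal
      ((intervalIntegrable_iff_integrableOn_Ioo_of_le zero_le_one).1 hi)
      (Eventually.of_forall fun x => sq_nonneg _)]
    refine ENNReal.ofReal_le_ofReal ?_
    rw [← integral_Ioc_eq_integral_Ioo, ← intervalIntegral.integral_of_le zero_le_one]
    calc ∫ x in (0 : ℝ)..1, (‖f j x‖ ^ 2 - 1) ^ 2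
        ≤ ∫ x in (0 : ℝ)..1, 4 * ε j * wellDensity (ε j) (f j) (g j) x := by
          refine intervalIntegral.integral_mono_on zero_le_one hi
            (((h.ac j).intervalIntegrable_wellDensity (h.memLp j) _).const_mul _) fun x _ => ?_
          have : 4 * ε j * wellDensity (ε j) (f j) (g j) x =
              2 * ε j ^ 2 * ‖g j x‖ ^ 2 + (‖f j x‖ ^ 2 - 1) ^ 2 := by
            rw [wellDensity]; field_simp; ring
          rw [this]
          have : 0 ≤ 2 * ε j ^ 2 * ‖g j x‖ ^ 2 := by positivity
          linarith
      _ ≤ 4 * ε j * M := by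
          rw [intervalIntegral.integral_const_mul]
          exact mul_le_mul_of_nonneg_left (h.well_le j) (by positivity)
  have hlim : Tendsto (fun j => ENNReal.ofReal (4 * ε j * M)) atTop (𝓝 0) := by
    have := ENNReal.tendsto_ofReal ((h.eps_tendsto.const_mul 4).mul_const M)
    simpa using this
  have hliminf : ∫⁻ x in Ioo (0 : ℝ) 1,
      liminf (fun j => ENNReal.ofReal ((‖f j x‖ ^ 2 - 1) ^ 2)) atTop = 0 := by
    refine le_antisymm ?_ zero_le
    refine (lintegral_liminf_le' fun j => ?_).trans ?_
    · have := (h.ac j).aestronglyMeasurable.norm.aemeasurable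
      fun_prop
    · refine (liminf_le_liminf (Eventually.of_forall hb)).trans ?_
      rw [hlim.liminf_eq]
  have ht := (ae_restrict_iff' measurableSet_Ioo).2 h.tendsto
  have hum := aestronglyMeasurable_of_tendsto_ae atTop (fun j => (h.ac j).aestronglyMeasurable) ht
  rw [lintegral_congr_ae (g := fun x => ENNReal.ofReal ((‖u x‖ ^ 2 - 1) ^ 2)),
    lintegral_eq_zero_iff' (by have := hum.norm.aemeasurable; fun_prop)] at hliminf
  · filter_upwards [(ae_restrict_iff' measurableSet_Ioo).1 hliminf] with x h3 hx
    have h6 := h3 hx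
    simp only [Pi.zero_apply, ENNReal.ofReal_eq_zero] at h6
    have h7 : ‖u x‖ ^ 2 - 1 = 0 := by nlinarith [sq_nonneg (‖u x‖ ^ 2 - 1)]
    nlinarith [norm_nonneg (u x)]
  · filter_upwards [ht] with x hx
    exact (ENNReal.tendsto_ofReal (((hx.norm.pow 2).sub_const 1).pow 2)).liminf_eq

theorem integral_twist_sq_le (h : BoundedSequence L N e M ε f g u) (j : ℕ) :
    ∫ x in Ioo 0 1, twist (f j x) (g j x) ^ 2 ≤ 4 * M / L + 2 * (2 * Real.pi * N) ^ 2 := by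
  have hT := (h.ac j).memLp_twist (h.memLp j)
  set c := 2 * Real.pi * N
  have h1 : ∫ x in Ioo 0 1, (twist (f j x) (g j x) - c) ^ 2 ≤ 2 * M / L := by
    rw [le_div_iff₀ h.L_pos]
    linarith [h.bound j, h.well_nonneg j zero_le_one]
  have hσ : Integrable (fun x => (twist (f j x) (g j x) - c) ^ 2) (volume.restrict (Ioo 0 1)) :=
    (hT.sub (memLp_const c)).integrable_sq
  calc ∫ x in Ioo 0 1, twist (f j x) (g j x) ^ 2
      ≤ ∫ x in Ioo 0 1, (2 * (twist (f j x) (g j x) - c) ^ 2 + 2 * c ^ 2) := by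
        refine integral_mono hT.integrable_sq ((hσ.const_mul 2).add (integrable_const _))
          fun x => ?_
        nlinarith [sq_nonneg (twist (f j x) (g j x) - 2 * c)]
    _ = 2 * (∫ x in Ioo 0 1, (twist (f j x) (g j x) - c) ^ 2) + 2 * c ^ 2 := by
        rw [integral_add (hσ.const_mul 2) (integrable_const _), integral_const_mul]
        simp
    _ ≤ _ := by
        have : 4 * M / L = 2 * (2 * M / L) := by ring
        linarith

/-- The moduli of the maps `f j` come arbitrarily close to `0` arbitrarily near to `p`. -/
def IsDip (𝒰 : Ultrafilter ℕ) (f : ℕ → ℝ → ℂ) (p : ℝ) : Prop :=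
  ∀ r > 0, ∀ δ > 0, ∀ᶠ j in (𝒰 : Filter ℕ), ∃ x ∈ Icc (0 : ℝ) 1, |x - p| < r ∧ ‖f j x‖ < δ

/-- The ultrafilter enters here: the failure of an eventual statement is itself eventual, so the
lower bound holds for all j in a set of 𝒰 and not merely for infinitely many. -/
theorem exists_of_not_isDip {𝒰 : Ultrafilter ℕ} {p : ℝ} (hp : ¬ IsDip 𝒰 f p) :
    ∃ r > 0, ∃ δ > 0, ∀ᶠ j in (𝒰 : Filter ℕ), ∀ x ∈ Icc (0 : ℝ) 1, |x - p| < r → δ ≤ ‖f j x‖ := by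
  simp only [IsDip, not_forall] at hp
  obtain ⟨r, hr, δ, hδ, hev⟩ := hp
  refine ⟨r, hr, δ, hδ, ?_⟩
  rw [← Ultrafilter.eventually_not] at hev
  filter_upwards [hev] with j hj x hx hxp
  by_contra! hlt
  exact hj ⟨x, hx, hxp, hlt⟩

theorem exists_mem_of_lt (h : BoundedSequence L N e M ε f g u) {a b : ℝ} (hab : a < b)
    (ha : 0 ≤ a) (hb : b ≤ 1) :
    ∃ x ∈ Ioo a b, Tendsto (fun j => ‖f j x‖) atTop (𝓝 1) := by
  by_contra! hne
  have : volume (Ioo a b) = 0 := by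
    rw [measure_eq_zero_iff_ae_notMem]
    filter_upwards [h.norm_limit, h.tendsto] with x h1 h2 hx
    have hx' : x ∈ Ioo (0 : ℝ) 1 := ⟨ha.trans_lt hx.1, hx.2.trans_le hb⟩
    have := (h2 hx').norm
    rw [h1 hx'] at this
    exact hne x hx this
  rw [Real.volume_Ioo, ENNReal.ofReal_eq_zero] at this
  linarith

/-- There is no room to the left of p = 0, but the boundary value has modulus 1, so y = 0 serves.
This is why a dip at an endpoint costs as much as an interior one. -/
theorem exists_left (h : BoundedSequence L N e M ε f g u) {p s : ℝ} (hp : p ∈ Icc (0 : ℝ) 1)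
    (hs : 0 < s) : ∃ y r, 0 < r ∧ 0 ≤ y ∧ p - s < y ∧ y ≤ p ∧
      (∀ x ∈ Icc (0 : ℝ) 1, |x - p| < r → y ≤ x) ∧ Tendsto (fun j => ‖f j y‖) atTop (𝓝 1) := by
  rcases hp.1.eq_or_lt with rfl | hp0
  · refine ⟨0, 1, one_pos, le_rfl, by linarith, le_rfl, fun x hx _ => hx.1, ?_⟩
    simp [h.zero]
  · obtain ⟨y, hy, hyl⟩ := h.exists_mem_of_lt (max_lt hp0 (sub_lt_self p hs)) (le_max_left _ _) hp.2
    have h1 := (max_lt_iff.1 hy.1)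
    refine ⟨y, p - y, sub_pos.2 hy.2, h1.1.le, h1.2, hy.2.le, fun x _ hx => ?_, hyl⟩
    linarith [(abs_lt.1 hx).1]

theorem exists_right (h : BoundedSequence L N e M ε f g u) {p s : ℝ} (hp : p ∈ Icc (0 : ℝ) 1)
    (hs : 0 < s) : ∃ z r, 0 < r ∧ z ≤ 1 ∧ z < p + s ∧ p ≤ z ∧
      (∀ x ∈ Icc (0 : ℝ) 1, |x - p| < r → x ≤ z) ∧ Tendsto (fun j => ‖f j z‖) atTop (𝓝 1) := by
  rcases hp.2.eq_or_lt with rfl | hp1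
  · refine ⟨1, 1, one_pos, le_rfl, by linarith, le_rfl, fun x hx _ => hx.2, ?_⟩
    simp [h.one, h.norm_e]
  · obtain ⟨z, hz, hzl⟩ := h.exists_mem_of_lt (lt_min hp1 (lt_add_of_pos_right p hs)) hp.1
      (min_le_left _ _)
    have h1 := (lt_min_iff.1 hz.2)
    refine ⟨z, z - p, sub_pos.2 hz.1, h1.1.le, h1.2, hz.1.le, fun x _ hx => ?_, hzl⟩
    linarith [(abs_lt.1 hx).2]

/-- With Φ(r) = r − r³/3, the modulus takes Φ from nearly 2/3 at y to nearly 0 at the dip and back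
to nearly 2/3 at z. The total variation is nearly 4/3, and dividing by √2 gives 2√2/3. -/
theorem dip_cost (h : BoundedSequence L N e M ε f g u) {𝒰 : Ultrafilter ℕ}
    (h𝒰 : (𝒰 : Filter ℕ) ≤ atTop) {p s : ℝ} (hp : p ∈ Icc (0 : ℝ) 1) (hd : IsDip 𝒰 f p)
    (hs : 0 < s) : ∃ y z, y ≤ z ∧ 0 ≤ y ∧ z ≤ 1 ∧ p - s < y ∧ z < p + s ∧
      ∀ η > 0, ∀ᶠ j in (𝒰 : Filter ℕ),
        2 * √2 / 3 - η ≤ ∫ x in y..z, wellDensity (ε j) (f j) (g j) x := by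
  obtain ⟨y, r, hr, hy0, hys, hyp, hyx, hyl⟩ := h.exists_left hp hs
  obtain ⟨z, r', hr', hz1, hzs, hzp, hzx, hzl⟩ := h.exists_right hp hs
  refine ⟨y, z, hyp.trans hzp, hy0, hz1, hys, hzs, fun η hη => ?_⟩
  -- Each of the two passages loses η/4 at the dip and η/4 at the far end, hence η in all; the final
  -- division by √2 ≥ 1 keeps this loss below η.
  have hdj := hd (min r r') (lt_min hr hr') (η / 4) (by positivity)
  have hΦ : ∀ t, Tendsto (fun j => ‖f j t‖) atTop (𝓝 1) →
      ∀ᶠ j in (𝒰 : Filter ℕ), 2 / 3 - η / 4 < ‖f j t‖ - ‖f j t‖ ^ 3 / 3 := by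
    intro t ht
    have := ((ht.sub ((ht.pow 3).div_const 3)).mono_left h𝒰).eventually
      (lt_mem_nhds (show 2 / 3 - η / 4 < 1 - 1 ^ 3 / 3 by linarith))
    exact this
  filter_upwards [hdj, hΦ y hyl, hΦ z hzl] with j hj hy hz
  obtain ⟨x, hx, hxp, hxδ⟩ := hj
  have hyx' := hyx x hx (hxp.trans_le (min_le_left _ _))
  have hxz' := hzx x hx (hxp.trans_le (min_le_right _ _))
  have m1 := modica_mortola (h.ac j) (h.memLp j) (h.eps_pos j) hyx' hy0 hx.2
  have m2 := modica_mortola (h.ac j) (h.memLp j) (h.eps_pos j) hxz' hx.1 hz1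
  have hint := (h.ac j).intervalIntegrable_wellDensity (h.memLp j) (ε j)
  have hadd : ∫ t in y..z, wellDensity (ε j) (f j) (g j) t =
      (∫ t in y..x, wellDensity (ε j) (f j) (g j) t) +
        ∫ t in x..z, wellDensity (ε j) (f j) (g j) t := by
    rw [intervalIntegral.integral_add_adjacent_intervals]
    · refine hint.mono_set ?_
      rw [uIcc_of_le hyx', uIcc_of_le zero_le_one]; exact Icc_subset_Icc hy0 hx.2
    · refine hint.mono_set ?_
      rw [uIcc_of_le hxz', uIcc_of_le zero_le_one]; exact Icc_subset_Icc hx.1 hz1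
  have h3 : 0 ≤ ‖f j x‖ ^ 3 / 3 := by positivity
  have k1 := neg_abs_le (‖f j x‖ - ‖f j x‖ ^ 3 / 3 - (‖f j y‖ - ‖f j y‖ ^ 3 / 3))
  have k2 := le_abs_self (‖f j z‖ - ‖f j z‖ ^ 3 / 3 - (‖f j x‖ - ‖f j x‖ ^ 3 / 3))
  rw [hadd]
  set I₁ := ∫ t in y..x, wellDensity (ε j) (f j) (g j) t
  set I₂ := ∫ t in x..z, wellDensity (ε j) (f j) (g j) t
  have k3 : 4 / 3 - η ≤ √2 * (I₁ + I₂) := by linarith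
  have h2 : √2 ^ 2 = 2 := Real.sq_sqrt (by norm_num)
  have h2p : 1 ≤ √2 := by rw [Real.one_le_sqrt]; norm_num
  have k4 : √2 * (2 * √2 / 3 - η) ≤ √2 * (I₁ + I₂) := by
    have : √2 * (2 * √2 / 3 - η) = 4 / 3 - √2 * η := by linear_combination 2 / 3 * h2
    rw [this]
    nlinarith
  exact le_of_mul_le_mul_left k4 (by linarith)

/-- The factor 2 makes the intervals of radius s about the points disjoint, so that their costs add
up. -/
theorem exists_separation (S : Finset ℝ) :
    ∃ s > 0, ∀ p ∈ S, ∀ q ∈ S, p ≠ q → 2 * s ≤ |p - q| := by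
  rcases S.offDiag.eq_empty_or_nonempty with he | hne
  · refine ⟨1, one_pos, fun p hp q hq hpq => ?_⟩
    have : (p, q) ∈ S.offDiag := Finset.mem_offDiag.2 ⟨hp, hq, hpq⟩
    simp [he] at this
  · obtain ⟨m, hm, hmin⟩ := S.offDiag.exists_min_image (fun z => |z.1 - z.2|) hne
    have := (Finset.mem_offDiag.1 hm).2.2
    refine ⟨|m.1 - m.2| / 2, half_pos (abs_pos.2 (sub_ne_zero.2 this)), fun p hp q hq hpq => ?_⟩
    have := hmin (p, q) (Finset.mem_offDiag.2 ⟨hp, hq, hpq⟩)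
    simp only at this
    linarith

theorem dips_cost (h : BoundedSequence L N e M ε f g u) {𝒰 : Ultrafilter ℕ}
    (h𝒰 : (𝒰 : Filter ℕ) ≤ atTop) {S : Finset ℝ} (hS : ∀ p ∈ S, p ∈ Icc (0 : ℝ) 1 ∧ IsDip 𝒰 f p)
    {η : ℝ} (hη : 0 < η) : ∀ᶠ j in (𝒰 : Filter ℕ),
      S.card * (2 * √2 / 3 - η) ≤ ∫ x in (0 : ℝ)..1, wellDensity (ε j) (f j) (g j) x := by
  obtain ⟨s, hs, hsep⟩ := exists_separation S
  have hc : ∀ p : ℝ, ∃ y z : ℝ, p ∈ S → y ≤ z ∧ 0 ≤ y ∧ z ≤ 1 ∧ p - s < y ∧ z < p + s ∧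
      ∀ η > 0, ∀ᶠ j in (𝒰 : Filter ℕ),
        2 * √2 / 3 - η ≤ ∫ x in y..z, wellDensity (ε j) (f j) (g j) x := by
    intro p
    by_cases hp : p ∈ S
    · obtain ⟨y, z, hyz⟩ := h.dip_cost h𝒰 (hS p hp).1 (hS p hp).2 hs
      exact ⟨y, z, fun _ => hyz⟩
    · exact ⟨0, 0, fun hp' => absurd hp' hp⟩
  choose y z hyz using hc
  have hev : ∀ᶠ j in (𝒰 : Filter ℕ), ∀ p ∈ S,
      2 * √2 / 3 - η ≤ ∫ x in (y p)..(z p), wellDensity (ε j) (f j) (g j) x :=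
    (Finset.eventually_all S).2 fun p hp => (hyz p hp).2.2.2.2.2 η hη
  filter_upwards [hev] with j hj
  have hint := (intervalIntegrable_iff_integrableOn_Ioc_of_le zero_le_one).1
    ((h.ac j).intervalIntegrable_wellDensity (h.memLp j) (ε j))
  have hsub : ∀ p ∈ S, Ioc (y p) (z p) ⊆ Ioc 0 1 := fun p hp =>
    Ioc_subset_Ioc (hyz p hp).2.1 (hyz p hp).2.2.1
  calc (S.card : ℝ) * (2 * √2 / 3 - η) = ∑ p ∈ S, (2 * √2 / 3 - η) := by
        rw [Finset.sum_const, nsmul_eq_mul]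
    _ ≤ ∑ p ∈ S, ∫ x in Ioc (y p) (z p), wellDensity (ε j) (f j) (g j) x := by
        refine Finset.sum_le_sum fun p hp => ?_
        rw [← intervalIntegral.integral_of_le (hyz p hp).1]
        exact hj p hp
    _ = ∫ x in ⋃ p ∈ S, Ioc (y p) (z p), wellDensity (ε j) (f j) (g j) x := by
        rw [integral_biUnion_finset S (fun p _ => measurableSet_Ioc) ?_
          fun p hp => hint.mono_set (hsub p hp)]
        intro p hp q hq hpq
        have h1 := hsep p hp q hq hpq
        obtain ⟨-, -, -, a1, a2, -⟩ := hyz p hp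
        obtain ⟨-, -, -, b1, b2, -⟩ := hyz q hq
        refine Set.disjoint_left.2 fun x hx hx' => ?_
        have : |p - q| < 2 * s := by
          rw [abs_lt]
          constructor <;> linarith [hx.1, hx.2, hx'.1, hx'.2]
        linarith
    _ ≤ ∫ x in Ioc 0 1, wellDensity (ε j) (f j) (g j) x := by
        refine setIntegral_mono_set hint
          (Eventually.of_forall fun x => wellDensity_nonneg (h.eps_pos j) _ _ x)
          (iUnion₂_subset hsub).eventuallyLE
    _ = _ := by rw [intervalIntegral.integral_of_le zero_le_one]

theorem finite_dips (h : BoundedSequence L N e M ε f g u) {𝒰 : Ultrafilter ℕ}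
    (h𝒰 : (𝒰 : Filter ℕ) ≤ atTop) : {p | p ∈ Icc (0 : ℝ) 1 ∧ IsDip 𝒰 f p}.Finite := by
  by_contra hinf
  -- With tolerance 1/3 each dip still costs at least 1/3, because √2 ≥ 1; so n > 3M dips would
  -- exceed the bound M.
  obtain ⟨n, hn⟩ := exists_nat_gt (M * 3)
  obtain ⟨S, hS, hcard⟩ := Set.Infinite.exists_subset_card_eq hinf n
  obtain ⟨j, hj⟩ := (h.dips_cost h𝒰 (S := S) (fun p hp => hS hp) (η := 1 / 3) (by norm_num)).exists
  have h2p : 1 ≤ √2 := by rw [Real.one_le_sqrt]; norm_num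
  have h1 : (S.card : ℝ) * (1 / 3) ≤ S.card * (2 * √2 / 3 - 1 / 3) := by
    gcongr; linarith
  rw [hcard] at hj h1
  linarith [h.well_le j]

theorem exists_lower_bound_of_isCompact {𝒰 : Ultrafilter ℕ} {K : Set ℝ} (hK : IsCompact K)
    (hd : ∀ p ∈ K, ¬ IsDip 𝒰 f p) :
    ∃ δ > 0, ∀ᶠ j in (𝒰 : Filter ℕ), ∀ x ∈ K ∩ Icc 0 1, δ ≤ ‖f j x‖ := by
  refine hK.induction_on (p := fun s => ∃ δ > 0, ∀ᶠ j in (𝒰 : Filter ℕ),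
    ∀ x ∈ s ∩ Icc 0 1, δ ≤ ‖f j x‖) ⟨1, one_pos, by simp⟩ ?_ ?_ ?_
  · rintro s t hst ⟨δ, hδ, hev⟩
    refine ⟨δ, hδ, ?_⟩
    filter_upwards [hev] with j hj x hx using hj x ⟨hst hx.1, hx.2⟩
  · rintro s t ⟨δ, hδ, hev⟩ ⟨δ', hδ', hev'⟩
    refine ⟨min δ δ', lt_min hδ hδ', ?_⟩
    filter_upwards [hev, hev'] with j hj hj' x hx
    rcases hx.1 with hs | ht
    · exact (min_le_left _ _).trans (hj x ⟨hs, hx.2⟩)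
    · exact (min_le_right _ _).trans (hj' x ⟨ht, hx.2⟩)
  · intro p hp
    obtain ⟨r, hr, δ, hδ, hev⟩ := exists_of_not_isDip (hd p hp)
    refine ⟨_, mem_nhdsWithin_of_mem_nhds (Metric.ball_mem_nhds p hr), δ, hδ, ?_⟩
    filter_upwards [hev] with j hj x hx
    exact hj x hx.2 (by simpa [Real.dist_eq] using hx.1)

end BoundedSequence

end Compactness

/-! ### Passage to the limit in the equation for the direction -/

section LimitEquation

theorem setIntegral_eq_of_subset_of_forall_notMem {U V : Set ℝ} (hV : MeasurableSet V)
    (hVU : V ⊆ U) {F : ℝ → ℂ} (hF : ∀ x, x ∉ V → F x = 0) :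
    ∫ x in V, F x = ∫ x in U, F x := by
  rw [← setIntegral_eq_integral_of_forall_compl_eq_zero (s := V) (μ := volume.restrict U)
    fun x hx => hF x hx, Measure.restrict_restrict hV, inter_eq_left.2 hVU]

theorem integrable_smul_of_memLp {X : Type*} [MeasurableSpace X] {μ : Measure X}
    [IsFiniteMeasure μ] {σ : X → ℝ} (hσ : MemLp σ 2 μ) {k : X → ℂ}
    (hk : AEStronglyMeasurable k μ) {C : ℝ} (hC : ∀ᵐ x ∂μ, ‖k x‖ ≤ C) :
    Integrable (fun x => σ x • k x) μ :=
  (hσ.integrable (by norm_num)).smul_bdd C hk hC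

theorem integral_smul_eq {X : Type*} [MeasurableSpace X] {μ : Measure X}
    [IsFiniteMeasure μ] {σ : X → ℝ} (hσ : MemLp σ 2 μ) {k : X → ℂ}
    (hk : AEStronglyMeasurable k μ) {C : ℝ} (hC : ∀ᵐ x ∂μ, ‖k x‖ ≤ C) :
    ∫ x, σ x • k x ∂μ = ((∫ x, σ x * (k x).re ∂μ : ℝ) : ℂ) +
      ((∫ x, σ x * (k x).im ∂μ : ℝ) : ℂ) * Complex.I := by
  rw [← integral_re_add_im (integrable_smul_of_memLp hσ hk hC)]
  simp

theorem tendsto_integral_smul {X : Type*} [MeasurableSpace X] {μ : Measure X}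
    [IsFiniteMeasure μ] {σ : ℕ → X → ℝ} {τ : X → ℝ} {l : Filter ℕ} (hσ : ∀ j, MemLp (σ j) 2 μ)
    (hτ : MemLp τ 2 μ)
    (hw : ∀ (k : ℕ → X → ℝ) (k' : X → ℝ) (C : ℝ), (∀ j, AEStronglyMeasurable (k j) μ) →
        (∀ j, ∀ᵐ x ∂μ, |k j x| ≤ C) →
        (∀ᵐ x ∂μ, Tendsto (fun j => k j x) atTop (𝓝 (k' x))) →
        Tendsto (fun j => ∫ x, σ j x * k j x ∂μ) l (𝓝 (∫ x, τ x * k' x ∂μ)))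
    {k : ℕ → X → ℂ} {k' : X → ℂ} {C : ℝ} (hk : ∀ j, AEStronglyMeasurable (k j) μ)
    (hC : ∀ j, ∀ᵐ x ∂μ, ‖k j x‖ ≤ C)
    (hlim : ∀ᵐ x ∂μ, Tendsto (fun j => k j x) atTop (𝓝 (k' x))) :
    Tendsto (fun j => ∫ x, σ j x • k j x ∂μ) l (𝓝 (∫ x, τ x • k' x ∂μ)) := by
  have hk' : AEStronglyMeasurable k' μ := aestronglyMeasurable_of_tendsto_ae atTop hk hlim
  have hC' : ∀ᵐ x ∂μ, ‖k' x‖ ≤ C := by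
    filter_upwards [ae_all_iff.2 hC, hlim] with x h1 h2
    exact le_of_tendsto h2.norm (Eventually.of_forall h1)
  rw [integral_smul_eq hτ hk' hC']
  simp only [integral_smul_eq (hσ _) (hk _) (hC _)]
  have h1 := hw (fun j x => (k j x).re) (fun x => (k' x).re) C
    (fun j => Complex.continuous_re.comp_aestronglyMeasurable (hk j))
    (fun j => by filter_upwards [hC j] with x hx using (Complex.abs_re_le_norm _).trans hx)
    (by filter_upwards [hlim] with x hx using (Complex.continuous_re.tendsto _).comp hx)
  have h2 := hw (fun j x => (k j x).im) (fun x => (k' x).im) C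
    (fun j => Complex.continuous_im.comp_aestronglyMeasurable (hk j))
    (fun j => by filter_upwards [hC j] with x hx using (Complex.abs_im_le_norm _).trans hx)
    (by filter_upwards [hlim] with x hx using (Complex.continuous_im.tendsto _).comp hx)
  exact ((Complex.continuous_ofReal.tendsto _).comp h1).add
    (((Complex.continuous_ofReal.tendsto _).comp h2).mul_const _)

/-- The factor `k` in the formula `(f / |f|)' = (f₁ f₂' - f₂ f₁') k`, truncated near the zeros of
`f`. -/
noncomputable def radialFactor (δ : ℝ) (z : ℂ) : ℂ :=
  ((max ‖z‖ δ) ^ 2)⁻¹ • (Complex.I * radial δ z)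

theorem norm_radialFactor_le {δ : ℝ} (hδ : 0 < δ) (z : ℂ) : ‖radialFactor δ z‖ ≤ (δ ^ 2)⁻¹ := by
  have h1 : δ ≤ max ‖z‖ δ := le_max_right _ _
  rw [radialFactor, norm_smul, norm_mul, Complex.norm_I, one_mul, norm_inv, norm_pow,
    Real.norm_of_nonneg (hδ.le.trans h1)]
  calc _ ≤ (δ ^ 2)⁻¹ * 1 := by
        gcongr
        exact norm_radial_le hδ z
    _ = _ := mul_one _

theorem continuous_radialFactor {δ : ℝ} (hδ : 0 < δ) : Continuous (radialFactor δ) := by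
  unfold radialFactor
  have := continuous_radial hδ
  refine Continuous.smul (Continuous.inv₀ (f := fun z : ℂ => (max ‖z‖ δ) ^ 2) (by fun_prop)
    fun z => ?_) (by fun_prop)
  exact (pow_pos (lt_max_of_lt_right hδ) 2).ne'

theorem radial_of_norm_eq_one {δ : ℝ} (hδ : δ ≤ 1) {z : ℂ} (hz : ‖z‖ = 1) : radial δ z = z := by
  rw [radial_of_le (by rwa [hz]), hz, inv_one, one_smul]

theorem radialFactor_of_norm_eq_one {δ : ℝ} (hδ : δ ≤ 1) {z : ℂ} (hz : ‖z‖ = 1) :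
    radialFactor δ z = Complex.I * z := by
  rw [radialFactor, radial_of_norm_eq_one hδ hz, hz, max_eq_left hδ]; simp

theorem hasDerivAt_radial' {f : ℝ → ℂ} {g : ℂ} {x δ : ℝ} (hδ : 0 < δ) (hf : HasDerivAt f g x)
    (h : δ < ‖f x‖) :
    HasDerivAt (fun y => radial δ (f y)) (twist (f x) g • radialFactor δ (f x)) x :=
  (hasDerivAt_radial hδ hf h).congr_deriv (by rw [radialFactor, smul_smul])

namespace BoundedSequence

variable {L : ℝ} {N : ℕ} {e : ℂ} {M : ℝ} {ε : ℕ → ℝ} {f g : ℕ → ℝ → ℂ} {u : ℝ → ℂ}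

/-- Integration by parts for φ · f/|f|. On the support of φ the truncation is inactive; off it the
product vanishes locally, so zeros of f there do no harm. -/
theorem integral_test (h : BoundedSequence L N e M ε f g u) (j : ℕ) {φ : ℝ → ℝ}
    (h1 : ContDiff ℝ ∞ φ) (h2 : HasCompactSupport φ) (h3 : tsupport φ ⊆ Ioo 0 1) {δ : ℝ}
    (hδ : 0 < δ) (hlow : ∀ x ∈ tsupport φ, δ < ‖f j x‖) :
    ∫ x in Ioo 0 1, deriv φ x • radial δ (f j x) =
      -∫ x in Ioo 0 1, twist (f j x) (g j x) • φ x • radialFactor δ (f j x) := by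
  obtain ⟨C, hC⟩ := h2.exists_bound_of_continuous h1.continuous
  have hi1 : IntegrableOn (fun x => deriv φ x • radial δ (f j x)) (Ioo 0 1) := by
    refine intervalIntegrable_iff_Ioo.1 (ContinuousOn.intervalIntegrable ?_)
    exact (continuous_deriv_of_smooth h1).continuousOn.smul
      ((continuous_radial hδ).comp_continuousOn (h.ac j).continuousOn)
  have hi2 : IntegrableOn (fun x => twist (f j x) (g j x) • φ x • radialFactor δ (f j x))
      (Ioo 0 1) := by
    refine integrable_smul_of_memLp ((h.ac j).memLp_twist (h.memLp j))
      (h1.continuous.aestronglyMeasurable.smul ((continuous_radialFactor hδ).comp_aestronglyMeasurable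
        (h.ac j).aestronglyMeasurable)) (C := C * (δ ^ 2)⁻¹) (Eventually.of_forall fun x => ?_)
    rw [norm_smul]
    exact mul_le_mul (hC x) (norm_radialFactor_le hδ _) (norm_nonneg _)
      ((norm_nonneg _).trans (hC x))
  have hAC : ACWith (fun x => φ x • radial δ (f j x)) (fun x => deriv φ x • radial δ (f j x) +
      twist (f j x) (g j x) • φ x • radialFactor δ (f j x)) 0 1 := by
    refine ⟨(ACWith.of_contDiff h1 0 1).ac.fun_smul (ac_radial hδ (h.ac j).ac), ?_,
      intervalIntegrable_iff_Ioo.2 (hi1.add hi2)⟩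
    filter_upwards [(h.ac j).hasDerivAt] with x hx hm
    by_cases hxs : x ∈ tsupport φ
    · have hd := hasDerivAt_radial' hδ (hx hm) (hlow x hxs)
      have hφ : HasDerivAt φ (deriv φ x) x :=
        ((h1.differentiable (by simp)) x).hasDerivAt
      refine (hφ.fun_smul hd).congr_deriv ?_
      rw [add_comm, smul_comm]
    · rw [deriv_eq_zero_of_notMem_tsupport hxs, image_eq_zero_of_notMem_tsupport hxs]
      simp only [zero_smul, smul_zero, add_zero]
      refine (hasDerivAt_const x (0 : ℂ)).congr_of_eventuallyEq ?_
      filter_upwards [(isClosed_tsupport φ).isOpen_compl.mem_nhds hxs] with y hy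
      rw [image_eq_zero_of_notMem_tsupport hy, zero_smul]
  have hz : ∀ x, x ∉ Ioo (0 : ℝ) 1 → φ x = 0 := fun x hx =>
    image_eq_zero_of_notMem_tsupport fun hm => hx (h3 hm)
  have := hAC.integral_eq_sub
  rw [hz 0 (by simp), hz 1 (by simp), zero_smul, zero_smul, sub_zero,
    intervalIntegral.integral_of_le zero_le_one, integral_Ioc_eq_integral_Ioo,
    integral_add hi1 hi2] at this
  exact eq_neg_of_add_eq_zero_left this

/-- On the compact support of a test function the moduli are bounded below, uniformly for 𝒰-almost
all j. The directions then converge boundedly and the twists weakly, so both sides of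
`integral_test` converge. -/
theorem isWeakDeriv_limit (h : BoundedSequence L N e M ε f g u) {𝒰 : Ultrafilter ℕ}
    (h𝒰 : (𝒰 : Filter ℕ) ≤ atTop) {τ : ℝ → ℝ} (hτ : MemLp τ 2 (volume.restrict (Ioo 0 1)))
    (hw : ∀ (k : ℕ → ℝ → ℝ) (k' : ℝ → ℝ) (C : ℝ),
        (∀ j, AEStronglyMeasurable (k j) (volume.restrict (Ioo 0 1))) →
        (∀ j, ∀ᵐ x ∂(volume.restrict (Ioo 0 1)), |k j x| ≤ C) →
        (∀ᵐ x ∂(volume.restrict (Ioo 0 1)), Tendsto (fun j => k j x) atTop (𝓝 (k' x))) →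
        Tendsto (fun j => ∫ x in Ioo 0 1, twist (f j x) (g j x) * k j x) 𝒰
          (𝓝 (∫ x in Ioo 0 1, τ x * k' x)))
    {U : Set ℝ} (hU : IsOpen U) (hUs : U ⊆ Ioo 0 1) (hd : ∀ p ∈ U, ¬ IsDip 𝒰 f p) :
    IsWeakDeriv U u (fun x => τ x • (Complex.I * u x)) := by
  intro φ h1 h2 h3
  obtain ⟨δ', hδ', hev⟩ := exists_lower_bound_of_isCompact h2 fun p hp => hd p (h3 hp)
  -- Halving gives the strict inequality δ < ‖f j x‖ needed to differentiate the truncated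
  -- direction; the cap at 1 keeps the truncation inactive on the unit circle, where the limit lies.
  set δ := min δ' 1 / 2 with hδdef
  have hδ : 0 < δ := half_pos (lt_min hδ' one_pos)
  have hδ1 : δ ≤ 1 := by linarith [min_le_right δ' 1]
  have hδ2 : δ < δ' := by linarith [min_le_left δ' 1]
  have hlimu : ∀ᵐ x ∂(volume.restrict (Ioo (0 : ℝ) 1)),
      Tendsto (fun j => f j x) atTop (𝓝 (u x)) ∧ ‖u x‖ = 1 := by
    rw [ae_restrict_iff' measurableSet_Ioo]
    filter_upwards [h.tendsto, h.norm_limit] with x p1 p2 hx using ⟨p1 hx, p2 hx⟩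
  obtain ⟨C, hC⟩ := h2.exists_bound_of_continuous h1.continuous
  obtain ⟨C', hC'⟩ := h2.deriv.exists_bound_of_continuous (continuous_deriv_of_smooth h1)
  have hL : Tendsto (fun j => ∫ x in Ioo 0 1, deriv φ x • radial δ (f j x)) 𝒰
      (𝓝 (∫ x in Ioo 0 1, deriv φ x • u x)) := by
    refine Tendsto.mono_left ?_ h𝒰
    refine tendsto_integral_of_dominated_convergence (fun _ => C')
      (fun j => (continuous_deriv_of_smooth h1).aestronglyMeasurable.smul
        ((continuous_radial hδ).comp_aestronglyMeasurable (h.ac j).aestronglyMeasurable))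
      (integrable_const _) (fun j => Eventually.of_forall fun x => ?_) ?_
    · rw [norm_smul]
      calc _ ≤ C' * 1 := mul_le_mul (hC' x) (norm_radial_le hδ _) (norm_nonneg _)
            ((norm_nonneg _).trans (hC' x))
        _ = _ := mul_one _
    · filter_upwards [hlimu] with x hx
      have := (((continuous_radial hδ).tendsto _).comp hx.1).const_smul (deriv φ x)
      rwa [radial_of_norm_eq_one hδ1 hx.2] at this
  have hR : Tendsto (fun j => ∫ x in Ioo 0 1, twist (f j x) (g j x) • φ x • radialFactor δ (f j x))
      𝒰 (𝓝 (∫ x in Ioo 0 1, τ x • φ x • (Complex.I * u x))) := by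
    refine tendsto_integral_smul (fun j => (h.ac j).memLp_twist (h.memLp j)) hτ hw
      (C := C * (δ ^ 2)⁻¹) (fun j => h1.continuous.aestronglyMeasurable.smul
        ((continuous_radialFactor hδ).comp_aestronglyMeasurable (h.ac j).aestronglyMeasurable))
      (fun j => Eventually.of_forall fun x => ?_) ?_
    · rw [norm_smul]
      exact mul_le_mul (hC x) (norm_radialFactor_le hδ _) (norm_nonneg _)
        ((norm_nonneg _).trans (hC x))
    · filter_upwards [hlimu] with x hx
      have := (((continuous_radialFactor hδ).tendsto _).comp hx.1).const_smul (φ x)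
      rwa [radialFactor_of_norm_eq_one hδ1 hx.2] at this
  have key : ∫ x in Ioo 0 1, deriv φ x • u x =
      -∫ x in Ioo 0 1, τ x • φ x • (Complex.I * u x) := by
    refine tendsto_nhds_unique (hL.congr' ?_) hR.neg
    filter_upwards [hev] with j hj
    exact h.integral_test j h1 h2 (h3.trans hUs) hδ fun x hx =>
      hδ2.trans_le (hj x ⟨hx, Ioo_subset_Icc_self (hUs (h3 hx))⟩)
  rw [setIntegral_eq_of_subset_of_forall_notMem hU.measurableSet hUs fun x hx => by
      rw [deriv_eq_zero_of_notMem_tsupport fun hm => hx (h3 hm), zero_smul],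
    setIntegral_eq_of_subset_of_forall_notMem hU.measurableSet hUs fun x hx => by
      rw [image_eq_zero_of_notMem_tsupport fun hm => hx (h3 hm), zero_smul], key]
  simp only [smul_comm (φ _) (τ _)]

/-- Near a point that is not a dip, the L² bound on the twists makes the directions 1/2-Hölder with
a constant independent of j. The prescribed value at p therefore survives in the limit as a trace.
-/
theorem norm_sub_le_sqrt (h : BoundedSequence L N e M ε f g u) {𝒰 : Ultrafilter ℕ}
    (h𝒰 : (𝒰 : Filter ℕ) ≤ atTop) {p : ℝ} (hp : p ∈ Icc (0 : ℝ) 1) (hd : ¬ IsDip 𝒰 f p) {c : ℂ}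
    (hc : ‖c‖ = 1) (hfp : ∀ j, f j p = c) :
    ∃ r > 0, ∃ K, ∀ᵐ x, x ∈ Ioo (0 : ℝ) 1 → |x - p| < r → ‖u x - c‖ ≤ K * √|x - p| := by
  obtain ⟨r, hr, δ', hδ', hev⟩ := exists_of_not_isDip hd
  set δ := min δ' 1 / 2 with hδdef
  have hδ : 0 < δ := half_pos (lt_min hδ' one_pos)
  have hδ1 : δ ≤ 1 := by linarith [min_le_right δ' 1]
  have hδ2 : δ < δ' := by linarith [min_le_left δ' 1]
  set R := 4 * M / L + 2 * (2 * Real.pi * N) ^ 2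
  refine ⟨r, hr, (δ ^ 2)⁻¹ * ((R + 1) / 2), ?_⟩
  filter_upwards [h.norm_limit, h.tendsto] with x hx1 hx2 hx hxr
  have hlim := ((((continuous_radial hδ).tendsto _).comp (hx2 hx)).mono_left h𝒰).sub_const c |>.norm
  rw [radial_of_norm_eq_one hδ1 (hx1 hx)] at hlim
  refine le_of_tendsto hlim ?_
  filter_upwards [hev] with j hj
  simp only [Function.comp_apply]
  rcases eq_or_ne x p with rfl | hxp
  · rw [hfp, radial_of_norm_eq_one hδ1 hc]; simp
  have hxI : x ∈ Icc (0 : ℝ) 1 := Ioo_subset_Icc_self hx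
  have hsub : uIcc p x ⊆ uIcc 0 1 := by
    rw [uIcc_of_le (zero_le_one' ℝ)]
    exact uIcc_subset_Icc hp hxI
  have hsub' : uIoc p x ⊆ Ioc 0 1 := by
    rw [← uIoc_of_le (zero_le_one' ℝ)]; exact uIoc_subset_uIoc_of_uIcc_subset_uIcc hsub
  have hmem : ∀ y ∈ uIcc p x, |y - p| < r := fun y hy =>
    (abs_sub_left_of_mem_uIcc hy).trans_lt hxr
  have hT := (h.ac j).memLp_twist (h.memLp j)
  have hT2 : IntegrableOn (fun y => twist (f j y) (g j y) ^ 2) (Ioc 0 1) :=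
    (integrableOn_Ioc_iff_integrableOn_Ioo).2 hT.integrable_sq
  have hi : IntegrableOn (fun y => twist (f j y) (g j y) • radialFactor δ (f j y)) (Ioc 0 1) :=
    (integrableOn_Ioc_iff_integrableOn_Ioo).2 (integrable_smul_of_memLp hT
      ((continuous_radialFactor hδ).comp_aestronglyMeasurable (h.ac j).aestronglyMeasurable)
      (Eventually.of_forall fun _ => norm_radialFactor_le hδ _))
  have hAC : ACWith (fun y => radial δ (f j y))
      (fun y => twist (f j y) (g j y) • radialFactor δ (f j y)) p x := by
    refine ⟨ac_radial hδ ((h.ac j).ac.mono hsub), ?_, ?_⟩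
    · filter_upwards [(h.ac j).hasDerivAt] with y hy hm
      refine hasDerivAt_radial' hδ (hy (hsub hm)) (hδ2.trans_le (hj y ?_ (hmem y hm)))
      rw [← uIcc_of_le (zero_le_one' ℝ)]; exact hsub hm
    · rw [intervalIntegrable_iff]; exact hi.mono_set hsub'
  have hpos : 0 < |x - p| := abs_pos.2 (sub_ne_zero.2 hxp)
  -- The weight in |a| ≤ (t/2)a² + 1/(2t). Integrated over an interval of length t², the bound is (R
  -- + 1)t/2, up to the factor (δ²)⁻¹.
  set t := √|x - p|
  have ht : 0 < t := Real.sqrt_pos.2 hpos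
  have htt : t ^ 2 = |x - p| := Real.sq_sqrt hpos.le
  have hc' : radial δ (f j p) = c := by rw [hfp, radial_of_norm_eq_one hδ1 hc]
  rw [← hc', ← hAC.integral_eq_sub]
  refine (intervalIntegral.norm_integral_le_integral_norm_uIoc).trans ?_
  have hconst : IntegrableOn (fun _ : ℝ => 1 / (2 * t)) (uIoc p x) := by
    refine integrableOn_const ?_
    rw [Real.volume_uIoc]; simp
  calc ∫ y in uIoc p x, ‖twist (f j y) (g j y) • radialFactor δ (f j y)‖
      ≤ ∫ y in uIoc p x, (δ ^ 2)⁻¹ * (t / 2 * twist (f j y) (g j y) ^ 2 + 1 / (2 * t)) := by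
        refine setIntegral_mono (hi.mono_set hsub').norm
          ((((hT2.mono_set hsub').const_mul _).add hconst).const_mul _) fun y => ?_
        simp only [norm_smul, Real.norm_eq_abs]
        rw [mul_comm]
        refine mul_le_mul (norm_radialFactor_le hδ _) ?_ (abs_nonneg _) (by positivity)
        rw [← sq_abs]
        set a := |twist (f j y) (g j y)|
        have : t / 2 * a ^ 2 + 1 / (2 * t) - a = (t * a - 1) ^ 2 / (2 * t) := by
          field_simp; ring
        have : 0 ≤ (t * a - 1) ^ 2 / (2 * t) := by positivity
        linarith
    _ = (δ ^ 2)⁻¹ * (t / 2 * (∫ y in uIoc p x, twist (f j y) (g j y) ^ 2) +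
          |x - p| * (1 / (2 * t))) := by
        rw [integral_const_mul, integral_add ((hT2.mono_set hsub').const_mul _) hconst,
          integral_const_mul, setIntegral_const, smul_eq_mul, measureReal_def, Real.volume_uIoc,
          ENNReal.toReal_ofReal (abs_nonneg _)]
    _ ≤ (δ ^ 2)⁻¹ * (t / 2 * R + |x - p| * (1 / (2 * t))) := by
        gcongr
        refine le_trans ?_ (h.integral_twist_sq_le j)
        rw [← integral_Ioc_eq_integral_Ioo]
        exact setIntegral_mono_set hT2 (Eventually.of_forall fun _ => sq_nonneg _)
          hsub'.eventuallyLE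
    _ = (δ ^ 2)⁻¹ * ((R + 1) / 2) * t := by
        rw [← htt]; field_simp

theorem traceAtZero (h : BoundedSequence L N e M ε f g u) {𝒰 : Ultrafilter ℕ}
    (h𝒰 : (𝒰 : Filter ℕ) ≤ atTop) (hd : ¬ IsDip 𝒰 f 0) : TraceAtZero u 1 := by
  obtain ⟨r, hr, K, hK⟩ := h.norm_sub_le_sqrt h𝒰 (by simp) hd norm_one h.zero
  rw [TraceAtZero, tendsto_iff_norm_sub_tendsto_zero]
  have h0 : Tendsto (fun x : ℝ => K * √|x - 0|) (𝓝[>] 0 ⊓ ae volume) (𝓝 0) := by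
    have : Continuous fun x : ℝ => K * √|x - 0| := by fun_prop
    have := this.tendsto 0
    simp only [sub_zero, abs_zero, Real.sqrt_zero, mul_zero] at this
    simpa using (this.mono_left nhdsWithin_le_nhds).mono_left inf_le_left
  refine squeeze_zero' (Eventually.of_forall fun _ => norm_nonneg _) ?_ h0
  filter_upwards [eventually_nhdsGT_zero_inf_ae hK, mem_inf_of_left (g := ae volume)
    (mem_nhdsWithin_of_mem_nhds (Metric.ball_mem_nhds (0 : ℝ) hr))] with x h1 h2
  exact h1 (by simpa using h2)

theorem traceAtOne (h : BoundedSequence L N e M ε f g u) {𝒰 : Ultrafilter ℕ}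
    (h𝒰 : (𝒰 : Filter ℕ) ≤ atTop) (hd : ¬ IsDip 𝒰 f 1) : TraceAtOne u e := by
  obtain ⟨r, hr, K, hK⟩ := h.norm_sub_le_sqrt h𝒰 (by simp) hd h.norm_e h.one
  rw [TraceAtOne, tendsto_iff_norm_sub_tendsto_zero]
  have h0 : Tendsto (fun x : ℝ => K * √|x - 1|) (𝓝[<] 1 ⊓ ae volume) (𝓝 0) := by
    have : Continuous fun x : ℝ => K * √|x - 1| := by fun_prop
    have := this.tendsto 1
    simp only [sub_self, abs_zero, Real.sqrt_zero, mul_zero] at this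
    exact (this.mono_left nhdsWithin_le_nhds).mono_left inf_le_left
  refine squeeze_zero' (Eventually.of_forall fun _ => norm_nonneg _) ?_ h0
  filter_upwards [eventually_nhdsLT_one_inf_ae hK, mem_inf_of_left (g := ae volume)
    (mem_nhdsWithin_of_mem_nhds (Metric.ball_mem_nhds (1 : ℝ) hr))] with x h1 h2
  exact h1 (by simpa [Real.dist_eq] using h2)

theorem exists_limit (h : BoundedSequence L N e M ε f g u) :
    ∃ (B : Finset ℝ) (τ : ℝ → ℝ), MemLp τ 2 (volume.restrict (Ioo 0 1)) ∧
      IsWeakDeriv (Ioo 0 1 \ (B : Set ℝ)) u (fun x => τ x • (Complex.I * u x)) ∧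
      B.card * (2 * √2 / 3) + L / 2 * ∫ x in Ioo 0 1, (τ x - 2 * Real.pi * N) ^ 2 ≤ M ∧
      (0 ∉ B → TraceAtZero u 1) ∧ (1 ∉ B → TraceAtOne u e) := by
  have h𝒰 : ((hyperfilter ℕ : Ultrafilter ℕ) : Filter ℕ) ≤ atTop := Nat.hyperfilter_le_atTop
  set 𝒰 : Ultrafilter ℕ := hyperfilter ℕ
  obtain ⟨τ, hτ, hw, hlsc⟩ := exists_weak_limit (fun j => (h.ac j).memLp_twist (h.memLp j))
    h.integral_twist_sq_le 𝒰 h𝒰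
  set B := (h.finite_dips h𝒰).toFinset with hB
  have hBm : ∀ p, p ∈ B ↔ p ∈ Icc (0 : ℝ) 1 ∧ IsDip 𝒰 f p := fun p => by
    rw [hB, Set.Finite.mem_toFinset]; rfl
  refine ⟨B, τ, hτ, ?_, ?_, ?_, ?_⟩
  · refine h.isWeakDeriv_limit h𝒰 hτ hw (isOpen_Ioo_diff B) sdiff_subset fun p hp hd => ?_
    exact hp.2 ((hBm p).2 ⟨Ioo_subset_Icc_self hp.1, hd⟩)
  · have hL := h.L_pos
    refine le_of_forall_pos_le_add fun η hη => ?_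
    -- The tolerances at all dips add up to at most η; the summand 1 allows B to be empty.
    set η' := η / (B.card + 1)
    have hη' : 0 < η' := by positivity
    have hev := h.dips_cost h𝒰 (S := B) (fun p hp => (hBm p).1 hp) hη'
    have := hlsc (fun _ => 2 * Real.pi * N) ((M - B.card * (2 * √2 / 3 - η')) / (L / 2))
      (memLp_const _) (by
        filter_upwards [hev] with j hj
        rw [le_div_iff₀ (by positivity)]
        linarith [h.bound j])
    rw [le_div_iff₀ (by positivity)] at this
    have h1 : B.card * η' ≤ η := by
      simp only [η']
      rw [← mul_div_assoc, div_le_iff₀ (by positivity)]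
      nlinarith
    linarith
  · exact fun h0 => h.traceAtZero h𝒰 fun hd => h0 ((hBm 0).2 ⟨by simp, hd⟩)
  · exact fun h1 => h.traceAtOne h𝒰 fun hd => h1 ((hBm 1).2 ⟨by simp, hd⟩)

end BoundedSequence

end LimitEquation

/-! ### Existence of the jump set and removal of points -/

section JumpSets

theorem memH1Circle_congr {J J' : Finset ℝ} {u : ℝ → ℂ}
    (h : Ioo (0 : ℝ) 1 \ (J : Set ℝ) = Ioo (0 : ℝ) 1 \ (J' : Set ℝ)) :
    MemH1Circle J u ↔ MemH1Circle J' u := by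
  rw [MemH1Circle, MemH1Circle, h]

theorem exists_isJumpSet {α : ℝ} {u : ℝ → ℂ} {B : Finset ℝ} (hB : MemH1Circle B u) :
    ∃ J, IsJumpSet α u J := by
  classical
  -- An interior exceptional set of least cardinality is minimal. The endpoints demanded by the
  -- traces are added afterwards, which does not change (0,1) ∖ J.
  have hex : ∃ n, ∃ J : Finset ℝ, (J : Set ℝ) ⊆ Ioo 0 1 ∧ MemH1Circle J u ∧ J.card = n := by
    refine ⟨_, B.filter (· ∈ Ioo (0 : ℝ) 1), fun x hx => (Finset.mem_filter.1 hx).2,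
      (memH1Circle_congr ?_).1 hB, rfl⟩
    ext x
    simp only [Set.mem_sdiff, Finset.mem_coe, Finset.mem_filter]
    tauto
  obtain ⟨J, hJs, hJ, hcard⟩ := Nat.find_spec hex
  set E : Finset ℝ := (if TraceAtZero u 1 then ∅ else {0}) ∪
    (if TraceAtOne u (Complex.exp (α * Complex.I)) then ∅ else {1})
  have hE : ∀ x ∈ E, x = 0 ∨ x = 1 := by
    intro x hx
    simp only [E, Finset.mem_union] at hx
    split_ifs at hx <;> simp_all
  have hEI : ∀ x ∈ E, x ∉ Ioo (0 : ℝ) 1 := by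
    intro x hx
    rcases hE x hx with rfl | rfl <;> simp
  refine ⟨J ∪ E, ⟨?_, ?_, ?_, ?_, ?_⟩⟩
  · intro x hx
    rcases Finset.mem_union.1 hx with hx | hx
    · exact Ioo_subset_Icc_self (hJs hx)
    · rcases hE x hx with rfl | rfl <;> simp
  · refine (memH1Circle_congr ?_).1 hJ
    ext x
    simp only [Set.mem_sdiff, Finset.mem_coe, Finset.mem_union]
    have := hEI x
    tauto
  · intro x hx hxI hmem
    have hxJ : x ∈ J := by
      rcases Finset.mem_union.1 hx with h | h
      · exact h
      · exact absurd hxI (hEI x h)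
    have h2 : MemH1Circle (J.erase x) u := by
      refine (memH1Circle_congr ?_).1 hmem
      ext y
      simp only [Set.mem_sdiff, Finset.mem_coe, Finset.mem_union, Finset.mem_erase]
      have := hEI y
      tauto
    refine Nat.find_min hex (m := (J.erase x).card) ?_
      ⟨J.erase x, fun y hy => hJs (Finset.mem_of_mem_erase hy), h2, rfl⟩
    rw [← hcard]
    exact Finset.card_erase_lt_of_mem hxJ
  · have : (0 : ℝ) ∉ J := fun h => by simpa using hJs h
    simp only [Finset.mem_union, this, E, false_or]
    split_ifs <;> simp_all
  · have : (1 : ℝ) ∉ J := fun h => by simpa using hJs h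
    simp only [Finset.mem_union, this, E, false_or]
    split_ifs <;> simp_all

/-- Gluing by a partition of unity: with a bump χ at x supported off B, the function χh + (1 − χ)g
is a weak derivative across x. -/
theorem memH1_erase {J B : Finset ℝ} {u h : ℝ → ℂ} {x : ℝ} (hJ : MemH1 (Ioo 0 1 \ (J : Set ℝ)) u)
    (hh : MemLp h 2 (volume.restrict (Ioo 0 1))) (hB : IsWeakDeriv (Ioo 0 1 \ (B : Set ℝ)) u h)
    (hx : x ∈ Ioo (0 : ℝ) 1) (hxB : x ∉ B) : MemH1 (Ioo 0 1 \ (J.erase x : Set ℝ)) u := by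
  obtain ⟨hu, g, hg, hgw⟩ := hJ
  rw [restrict_Ioo_diff] at hu hg
  obtain ⟨r, hr, hrs⟩ := Metric.isOpen_iff.1 (isOpen_Ioo_diff B) x ⟨hx, hxB⟩
  let χ : ContDiffBump x := ⟨r / 4, r / 2, by linarith, by linarith⟩
  have hχs : tsupport χ ⊆ Ioo 0 1 \ (B : Set ℝ) := by
    rw [χ.tsupport_eq]
    exact (Metric.closedBall_subset_ball (by simp only [χ]; linarith)).trans hrs
  have hχ1 : ∀ᶠ y in 𝓝 x, χ y = 1 := χ.eventuallyEq_one
  have hχc : ContDiff ℝ ∞ χ := χ.contDiff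
  have hmem : ∀ {k : ℝ → ℂ}, MemLp k 2 (volume.restrict (Ioo 0 1)) →
      MemLp (fun y => χ y • k y) 2 (volume.restrict (Ioo 0 1)) := fun {k} hk => by
    refine MemLp.of_le hk (hχc.continuous.aestronglyMeasurable.smul hk.1)
      (Eventually.of_forall fun y => ?_)
    rw [norm_smul, Real.norm_of_nonneg χ.nonneg]
    exact mul_le_of_le_one_left (norm_nonneg _) χ.le_one
  have ui := integrableOn_of_memLp Subset.rfl hu
  have hi := integrableOn_of_memLp Subset.rfl hh
  have gi := integrableOn_of_memLp Subset.rfl hg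
  have hχg := hmem hg
  rw [← restrict_Ioo_diff (J.erase x)] at hu
  refine ⟨hu, fun y => χ y • h y + (g y - χ y • g y), ?_, ?_⟩
  · rw [restrict_Ioo_diff]
    exact (hmem hh).add (hg.sub hχg)
  · intro φ h1 h2 h3
    have e1 := hB (fun y => φ y * χ y) (h1.mul hχc) h2.mul_right
      ((tsupport_mul_subset_right).trans hχs)
    -- Since χ = 1 near x, the function φ − φχ vanishes near x; its support avoids all of J and not
    -- just `J.erase x`.
    have hs2 : tsupport (fun y => φ y - φ y * χ y) ⊆ Ioo 0 1 \ (J : Set ℝ) := by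
      have hsub : tsupport (fun y => φ y - φ y * χ y) ⊆ tsupport φ :=
        (tsupport_sub _ _).trans (union_subset Subset.rfl tsupport_mul_subset_left)
      intro y hy
      have h4 := h3 (hsub hy)
      refine ⟨h4.1, fun hyJ => ?_⟩
      by_cases hyx : y = x
      · subst hyx
        rw [tsupport, mem_closure_iff_frequently] at hy
        refine hy ?_
        filter_upwards [hχ1] with z hz
        simp [hz]
      · exact h4.2 (Finset.mem_coe.2 (Finset.mem_erase.2 ⟨hyx, hyJ⟩))
    have h2' : HasCompactSupport (fun y => φ y - φ y * χ y) := h2.sub h2.mul_right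
    have e2 := hgw _ (h1.sub (h1.mul hχc)) h2' hs2
    rw [restrict_Ioo_diff] at e1 e2 ⊢
    have hφχ : ContDiff ℝ ∞ (fun y => φ y * χ y) := h1.mul hχc
    have hφχ' : ContDiff ℝ ∞ (fun y => φ y - φ y * χ y) := h1.sub hφχ
    have hder : ∀ y, deriv φ y • u y = deriv (fun y => φ y * χ y) y • u y +
        deriv (fun y => φ y - φ y * χ y) y • u y := by
      intro y
      rw [← add_smul, deriv_fun_sub (h1.differentiable (by simp) y)
        (hφχ.differentiable (by simp) y)]
      congr 1; ring
    have hval : ∀ y, φ y • (χ y • h y + (g y - χ y • g y)) = (φ y * χ y) • h y +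
        (φ y - φ y * χ y) • g y := by
      intro y
      rw [smul_add, smul_sub, smul_smul, smul_smul, sub_smul]
    simp only [hder, hval]
    rw [integral_add, integral_add, e1, e2, neg_add]
    · exact integrableOn_smul_test hi hφχ.continuous h2.mul_right
    · exact integrableOn_smul_test gi hφχ'.continuous h2'
    · exact integrableOn_smul_test ui (continuous_deriv_of_smooth hφχ) h2.mul_right.deriv
    · exact integrableOn_smul_test ui (continuous_deriv_of_smooth hφχ') h2'.deriv

end JumpSets

/-! ### The lower bound for the energies -/

section Energy

theorem twist_smul_I_mul (t : ℝ) (z : ℂ) : twist z (t • (Complex.I * z)) = t * ‖z‖ ^ 2 := by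
  rw [Complex.sq_norm, Complex.normSq_apply]
  simp [twist]; ring

theorem admissible_of_acWith {α : ℝ} {u f g : ℝ → ℂ}
    (hu : MemLp u 2 (volume.restrict (Ioo 0 1))) (huf : ∀ᵐ x, x ∈ Ioo (0 : ℝ) 1 → u x = f x)
    (hf : ACWith f g 0 1) (hg : MemLp g 2 (volume.restrict (Ioo 0 1))) (h0 : f 0 = 1)
    (h1 : f 1 = Complex.exp (α * Complex.I)) : Admissible α u := by
  have hfu : ∀ᵐ x, x ∈ Ioo (0 : ℝ) 1 → f x = u x := by
    filter_upwards [huf] with x hx hm using (hx hm).symm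
  have hc := hf.continuousOn
  rw [uIcc_of_le zero_le_one] at hc
  refine ⟨⟨hu, g, hg, (hf.isWeakDeriv zero_le_one).congr
    ((ae_restrict_iff' measurableSet_Ioo).2 hfu) (Eventually.of_forall fun _ => rfl)⟩, ?_, ?_⟩
  · refine TraceAtZero.congr (u := f) ?_ hfu
    have : Tendsto f (𝓝[>] 0) (𝓝 1) := by
      rw [← h0, ← nhdsWithin_Ioo_eq_nhdsGT (zero_lt_one' ℝ)]
      exact (hc 0 (by simp)).mono_left (nhdsWithin_mono _ Ioo_subset_Icc_self)
    exact this.mono_left inf_le_left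
  · refine TraceAtOne.congr (u := f) ?_ hfu
    have : Tendsto f (𝓝[<] 1) (𝓝 (Complex.exp (α * Complex.I))) := by
      rw [← h1, ← nhdsWithin_Ioo_eq_nhdsLT (zero_lt_one' ℝ)]
      exact (hc 1 (by simp)).mono_left (nhdsWithin_mono _ Ioo_subset_Icc_self)
    exact this.mono_left inf_le_left

theorem energy_eq_ofReal {L α ε : ℝ} {N : ℕ} {u : L2} {f g : ℝ → ℂ} (hL : 0 < L) (hε : 0 < ε)
    (hA : Admissible α u) (huf : ∀ᵐ x, x ∈ Ioo (0 : ℝ) 1 → u x = f x) (hf : ACWith f g 0 1)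
    (hg : MemLp g 2 (volume.restrict (Ioo 0 1))) :
    energy L N α ε u = ENNReal.ofReal ((∫ x in (0 : ℝ)..1, wellDensity ε f g x) +
      L / 2 * ∫ x in Ioo 0 1, (twist (f x) (g x) - 2 * Real.pi * N) ^ 2) := by
  have hwd : IsWeakDeriv (Ioo 0 1) u g := (hf.isWeakDeriv zero_le_one).congr
    ((ae_restrict_iff' measurableSet_Ioo).2 (by
      filter_upwards [huf] with x hx hm using (hx hm).symm)) (Eventually.of_forall fun _ => rfl)
  have hge := IsWeakDeriv.unique isOpen_Ioo
    (integrableOn_of_memLp Subset.rfl (weakDeriv_memLp hA.1))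
    (integrableOn_of_memLp Subset.rfl hg) (isWeakDeriv_weakDeriv hA.1) hwd
  have hi1 := (intervalIntegrable_iff_integrableOn_Ioo_of_le zero_le_one).1
    (hf.intervalIntegrable_wellDensity hg ε)
  have hi2 : IntegrableOn (fun x => L / 2 * (twist (f x) (g x) - 2 * Real.pi * N) ^ 2)
      (Ioo 0 1) := (((hf.memLp_twist hg).sub (memLp_const _)).integrable_sq).const_mul _
  have hi3 : Integrable (fun x => wellDensity ε f g x +
      L / 2 * (twist (f x) (g x) - 2 * Real.pi * N) ^ 2) (volume.restrict (Ioo 0 1)) :=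
    Integrable.add hi1 hi2
  rw [energy, if_pos hA, intervalIntegral.integral_of_le zero_le_one, integral_Ioc_eq_integral_Ioo,
    ← integral_const_mul, ← integral_add hi1 hi2, ofReal_integral_eq_lintegral_ofReal
    (f := fun x => wellDensity ε f g x + L / 2 * (twist (f x) (g x) - 2 * Real.pi * N) ^ 2)
    hi3 (Eventually.of_forall fun x => ?_)]
  · refine lintegral_congr_ae ((ae_restrict_iff' measurableSet_Ioo).2 ?_)
    filter_upwards [huf, hge] with x h1 h2 hx
    rw [h1 hx, h2 hx, wellDensity]
  · have := wellDensity_nonneg hε f g x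
    have : 0 ≤ L / 2 * (twist (f x) (g x) - 2 * Real.pi * N) ^ 2 := by positivity
    simp only [Pi.zero_apply]
    linarith

/-- Since the weak derivative is iτu and |u| = 1, the twist of u is τ; it then remains to compare
the number of jumps with the number of dips. -/
theorem BoundedSequence.limitEnergy_le {L α M : ℝ} {N : ℕ} {ε : ℕ → ℝ} {f g : ℕ → ℝ → ℂ} {u : L2}
    (h : BoundedSequence L N (Complex.exp (α * Complex.I)) M ε f g u) :
    limitEnergy L N α u ≤ ENNReal.ofReal M := by
  obtain ⟨B, τ, hτ, hB, hM, h0, h1⟩ := h.exists_limit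
  have hu1 : ∀ᵐ x ∂(volume.restrict (Ioo (0 : ℝ) 1)), ‖u x‖ = 1 :=
    (ae_restrict_iff' measurableSet_Ioo).2 h.norm_limit
  have hu : MemLp u 2 (volume.restrict (Ioo 0 1)) := Lp.memLp u
  have hG : MemLp (fun x => τ x • (Complex.I * u x)) 2 (volume.restrict (Ioo 0 1)) := by
    refine MemLp.of_le hτ (hτ.1.smul (hu.1.const_mul _)) ?_
    filter_upwards [hu1] with x hx
    rw [norm_smul, norm_mul, Complex.norm_I, hx, one_mul, mul_one]
  have hex : ∃ J : Finset ℝ, IsJumpSet α u J := by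
    refine exists_isJumpSet (B := B) ⟨⟨?_, _, ?_, hB⟩, hu1⟩
    · rwa [restrict_Ioo_diff]
    · rwa [restrict_Ioo_diff]
  rw [limitEnergy, dif_pos hex]
  set J := hex.choose
  have hJ : IsJumpSet α u J := hex.choose_spec
  -- Off B the traces are attained at the endpoints, and an interior point could be removed from J,
  -- against its minimality.
  have hJB : J ⊆ B := by
    intro x hx
    by_contra hxB
    rcases (hJ.subset hx).1.eq_or_lt with rfl | hx0
    · exact hJ.zero_mem.1 hx (h0 hxB)
    rcases (hJ.subset hx).2.eq_or_lt with rfl | hx1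
    · exact hJ.one_mem.1 hx (h1 hxB)
    exact hJ.minimal x hx ⟨hx0, hx1⟩ ⟨memH1_erase hJ.memH1.1 hG hB ⟨hx0, hx1⟩ hxB, hu1⟩
  have hwd : ∀ᵐ x, x ∈ Ioo (0 : ℝ) 1 →
      weakDeriv (Ioo 0 1 \ (J : Set ℝ)) u x = τ x • (Complex.I * u x) := by
    have hW := weakDeriv_memLp hJ.memH1.1
    have hsub : Ioo (0 : ℝ) 1 \ (B : Set ℝ) ⊆ Ioo 0 1 \ (J : Set ℝ) :=
      sdiff_subset_sdiff_right (by exact_mod_cast hJB)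
    have := IsWeakDeriv.unique (isOpen_Ioo_diff B)
      ((integrableOn_of_memLp sdiff_subset hW).mono_set hsub)
      ((integrableOn_of_memLp Subset.rfl hG).mono_set sdiff_subset)
      ((isWeakDeriv_weakDeriv hJ.memH1.1).mono (isOpen_Ioo_diff B) hsub) hB
    filter_upwards [this, (compl_mem_ae_iff.2 (B.finite_toSet.measure_zero volume))] with x h1 h2 hx
    exact h1 ⟨hx, h2⟩
  have hi : IntegrableOn (fun x => L / 2 * (τ x - 2 * Real.pi * N) ^ 2) (Ioo 0 1) :=
    ((hτ.sub (memLp_const _)).integrable_sq).const_mul _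
  have hLpos := h.L_pos
  have e1 : ∫⁻ x in Ioo (0 : ℝ) 1, ENNReal.ofReal
      (L / 2 * (twist (u x) (weakDeriv (Ioo 0 1 \ (J : Set ℝ)) u x) - 2 * Real.pi * N) ^ 2) =
      ENNReal.ofReal (L / 2 * ∫ x in Ioo 0 1, (τ x - 2 * Real.pi * N) ^ 2) := by
    rw [← integral_const_mul, ofReal_integral_eq_lintegral_ofReal hi
      (Eventually.of_forall fun x => by simp only [Pi.zero_apply]; positivity)]
    refine lintegral_congr_ae ((ae_restrict_iff' measurableSet_Ioo).2 ?_)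
    filter_upwards [hwd, h.norm_limit] with x p1 p2 hx
    rw [p1 hx, twist_smul_I_mul, p2 hx, one_pow, mul_one]
  rw [e1, ← ENNReal.ofReal_natCast, ← ENNReal.ofReal_mul (by positivity),
    ← ENNReal.ofReal_add (mul_nonneg (by positivity) (integral_nonneg fun _ => sq_nonneg _))
      (by positivity)]
  refine ENNReal.ofReal_le_ofReal (le_trans ?_ hM)
  have hc : (J.card : ℝ) ≤ B.card := by exact_mod_cast Finset.card_le_card hJB
  have h2p : 0 ≤ 2 * √2 / 3 := by positivity
  nlinarith

theorem limitEnergy_le_liminf {L α : ℝ} {N : ℕ} (hL : 0 < L) {u : L2} {ε : ℕ → ℝ} {v : ℕ → L2}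
    (hε : Tendsto ε atTop (𝓝[>] 0)) (hv : Tendsto v atTop (𝓝 u)) :
    limitEnergy L N α u ≤ liminf (fun j => energy L N α (ε j) (v j)) atTop := by
  -- A level c strictly between the two sides bounds the energies along a subsequence, which makes
  -- its members admissible; a further subsequence converges almost everywhere.
  by_contra! hlt
  obtain ⟨c, hc1, hc2⟩ := exists_between hlt
  have hctop : c ≠ ⊤ := (hc2.trans_le le_top).ne
  have hfr := (frequently_lt_of_liminf_lt (by isBoundedDefault) hc1).and_eventually
    (hε.eventually self_mem_nhdsWithin)
  obtain ⟨φ, hφ, hφc⟩ := extraction_of_frequently_atTop hfr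
  have hvm : TendstoInMeasure (volume.restrict (Ioo (0 : ℝ) 1)) (fun j => v (φ j)) atTop u :=
    tendstoInMeasure_of_tendsto_Lp (hv.comp hφ.tendsto_atTop)
  obtain ⟨ψ, hψ, hψl⟩ := hvm.exists_seq_tendsto_ae
  have hA : ∀ j, Admissible α (v (φ (ψ j))) := by
    intro j
    by_contra hna
    have := (hφc (ψ j)).1
    rw [energy, if_neg hna] at this
    exact absurd le_top (not_le.2 this)
  choose f huf hf hf0 hf1 using fun j => (hA j).exists_rep
  have hεlim : Tendsto (fun j => ε (φ (ψ j))) atTop (𝓝[>] 0) :=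
    (hε.comp hφ.tendsto_atTop).comp hψ.tendsto_atTop
  have hB : BoundedSequence L N (Complex.exp (α * Complex.I)) c.toReal (fun j => ε (φ (ψ j))) f
      (fun j => weakDeriv (Ioo 0 1) (v (φ (ψ j)))) u := by
    refine ⟨hL, Complex.norm_exp_ofReal_mul_I α, fun j => (hφc (ψ j)).2,
      hεlim.mono_right nhdsWithin_le_nhds, hf, fun j => weakDeriv_memLp (hA j).1, hf0, hf1,
      fun j => ?_, ?_⟩
    · have h1 := (hφc (ψ j)).1
      rw [energy_eq_ofReal hL (hφc (ψ j)).2 (hA j) (huf j) (hf j) (weakDeriv_memLp (hA j).1)] at h1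
      rw [← ENNReal.ofReal_le_iff_le_toReal hctop]
      exact h1.le
    · filter_upwards [(ae_restrict_iff' measurableSet_Ioo).1 hψl, ae_all_iff.2 huf]
        with x h1 h2 hx
      exact (h1 hx).congr fun j => h2 j hx
  have := hB.limitEnergy_le
  rw [ENNReal.ofReal_toReal hctop] at this
  exact absurd this (not_le.2 hc2)

end Energy

/-! ### The optimal profile and the modulus of the recovery maps -/

section Profile

theorem hasDerivAt_tanh (x : ℝ) : HasDerivAt Real.tanh (1 - Real.tanh x ^ 2) x := by
  have h := (Real.hasDerivAt_sinh x).fun_div (Real.hasDerivAt_cosh x) (Real.cosh_pos x).ne'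
  have e : Real.tanh = fun x => Real.sinh x / Real.cosh x :=
    funext fun x => Real.tanh_eq_sinh_div_cosh x
  rw [e]
  refine h.congr_deriv ?_
  have := (Real.cosh_pos x).ne'
  field_simp

theorem strictMono_tanh : StrictMono Real.tanh := by
  refine strictMono_of_deriv_pos fun x => ?_
  rw [(hasDerivAt_tanh x).deriv]
  linarith [Real.tanh_sq_lt_one x]

theorem lipschitzWith_tanh : LipschitzWith 1 Real.tanh := by
  refine lipschitzWith_of_nnnorm_deriv_le (fun x => (hasDerivAt_tanh x).differentiableAt)
    fun x => ?_
  rw [(hasDerivAt_tanh x).deriv, ← NNReal.coe_le_coe, coe_nnnorm, Real.norm_eq_abs,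
    NNReal.coe_one, abs_le]
  constructor <;> nlinarith [Real.tanh_sq_lt_one x, sq_nonneg (Real.tanh x)]

theorem tendsto_tanh_atTop : Tendsto Real.tanh atTop (𝓝 1) := by
  have e : Real.tanh = fun x => 1 - 2 / (Real.exp (2 * x) + 1) := by
    ext x
    rw [Real.tanh_eq, two_mul, Real.exp_add, Real.exp_neg]
    have := Real.exp_pos x
    field_simp
    ring
  rw [e]
  have h : Tendsto (fun x : ℝ => 2 / (Real.exp (2 * x) + 1)) atTop (𝓝 0) :=
    (tendsto_atTop_add_const_right _ _ (Real.tendsto_exp_atTop.comp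
      (tendsto_id.const_mul_atTop two_pos))).const_div_atTop 2
  simpa using h.const_sub 1

theorem tanh_pos {x : ℝ} (hx : 0 < x) : 0 < Real.tanh x := by
  simpa using strictMono_tanh hx

/-- A nearly optimal profile, vanishing at `0` and equal to `1` off `(-η, η)`. -/
noncomputable def profile (ε η t : ℝ) : ℝ :=
  min 1 (Real.tanh (|t| / (√2 * ε)) / Real.tanh (η / (√2 * ε)))

/-- The energy density of the optimal profile on the line. -/
noncomputable def profileDensity (ε t : ℝ) : ℝ :=
  1 / (2 * ε) * (1 - Real.tanh (t / (√2 * ε)) ^ 2) ^ 2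

variable {ε η : ℝ}

theorem tanh_scale_pos (hε : 0 < ε) (hη : 0 < η) : 0 < Real.tanh (η / (√2 * ε)) :=
  tanh_pos (by positivity)

theorem profile_zero : profile ε η 0 = 0 := by simp [profile]

theorem profile_nonneg (hε : 0 < ε) (hη : 0 < η) (t : ℝ) : 0 ≤ profile ε η t := by
  refine le_min zero_le_one (div_nonneg ?_ (tanh_scale_pos hε hη).le)
  have : 0 ≤ |t| / (√2 * ε) := by positivity
  simpa using strictMono_tanh.monotone this

theorem profile_le_one (t : ℝ) : profile ε η t ≤ 1 := min_le_left _ _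

theorem profile_eq_one (hε : 0 < ε) (hη : 0 < η) {t : ℝ} (ht : η ≤ |t|) : profile ε η t = 1 := by
  refine min_eq_left ?_
  rw [le_div_iff₀ (tanh_scale_pos hε hη), one_mul]
  exact strictMono_tanh.monotone (by gcongr)

theorem profile_of_abs_lt (hε : 0 < ε) (hη : 0 < η) {t : ℝ} (ht : |t| < η) :
    profile ε η t = Real.tanh (|t| / (√2 * ε)) / Real.tanh (η / (√2 * ε)) := by
  refine min_eq_right ?_
  rw [div_le_iff₀ (tanh_scale_pos hε hη), one_mul]
  exact strictMono_tanh.monotone (by gcongr)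

theorem continuous_profile : Continuous (profile ε η) := by
  have := lipschitzWith_tanh.continuous
  unfold profile
  fun_prop

theorem ac_profile (hε : 0 < ε) (hη : 0 < η) (p a b : ℝ) :
    AbsolutelyContinuousOnInterval (fun x => profile ε η (x - p)) a b := by
  have hid : AbsolutelyContinuousOnInterval (fun x : ℝ => x) a b := by
    exact (contDiff_id (𝕜 := ℝ) (n := 1)).contDiffOn.absolutelyContinuousOnInterval
  refine ac_of_dist_le ((√2 * ε)⁻¹ / Real.tanh (η / (√2 * ε))) hid fun x _ y _ => ?_
  have hT := tanh_scale_pos hε hη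
  simp only [profile, Real.dist_eq]
  refine (abs_min_sub_min_le_max _ _ _ _).trans ?_
  rw [sub_self, abs_zero, max_eq_right (abs_nonneg _), ← sub_div, abs_div, abs_of_pos hT,
    div_mul_eq_mul_div]
  gcongr
  have h1 := lipschitzWith_tanh.dist_le_mul (|x - p| / (√2 * ε)) (|y - p| / (√2 * ε))
  rw [Real.dist_eq, Real.dist_eq, NNReal.coe_one, one_mul] at h1
  refine h1.trans ?_
  rw [← sub_div, abs_div, abs_of_pos (by positivity : 0 < √2 * ε), div_eq_inv_mul]
  have h2 := abs_abs_sub_abs_le (x - p) (y - p)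
  rw [sub_sub_sub_cancel_right] at h2
  gcongr

theorem profileDensity_nonneg (hε : 0 < ε) (t : ℝ) : 0 ≤ profileDensity ε t := by
  unfold profileDensity; positivity

theorem profileDensity_le (hε : 0 < ε) (t : ℝ) : profileDensity ε t ≤ 1 / (2 * ε) := by
  unfold profileDensity
  have h1 := Real.tanh_sq_lt_one (t / (√2 * ε))
  have h2 := sq_nonneg (Real.tanh (t / (√2 * ε)))
  refine mul_le_of_le_one_right (by positivity) (pow_le_one₀ (by linarith) (by linarith))

theorem continuous_profileDensity : Continuous (profileDensity ε) := by
  have := lipschitzWith_tanh.continuous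
  unfold profileDensity
  fun_prop

/-- The function θ = tanh(t/(√2 ε)) has equal gradient and potential terms, (1 − θ²)²/(4ε) each, for
t > 0. Dividing by T < 1 to reach the value 1 at distance η multiplies the gradient term by T⁻² and
does not increase the potential term, since θ ≤ θ/T ≤ 1. -/
theorem exists_hasDerivAt_profile (hε : 0 < ε) (hη : 0 < η) {t : ℝ} (ht0 : t ≠ 0)
    (ht : |t| < η) : ∃ d, HasDerivAt (profile ε η) d t ∧
      ε / 2 * d ^ 2 + 1 / (4 * ε) * (profile ε η t ^ 2 - 1) ^ 2 ≤
        (Real.tanh (η / (√2 * ε)) ^ 2)⁻¹ * profileDensity ε t := by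
  set T := Real.tanh (η / (√2 * ε)) with hTdef
  have hT : 0 < T := tanh_scale_pos hε hη
  have hT1 : T < 1 := Real.tanh_lt_one _
  set θ := Real.tanh (|t| / (√2 * ε)) with hθdef
  have hθ1 : θ ^ 2 < 1 := Real.tanh_sq_lt_one _
  have hθT : θ ≤ T := strictMono_tanh.monotone (by gcongr)
  have hθ0 : 0 ≤ θ := by
    have : 0 ≤ |t| / (√2 * ε) := by positivity
    simpa using strictMono_tanh.monotone this
  have h1 := ((hasDerivAt_tanh (|t| / (√2 * ε))).comp t
    ((hasDerivAt_abs ht0).div_const (√2 * ε))).div_const T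
  refine ⟨_, h1.congr_of_eventuallyEq ?_, ?_⟩
  · filter_upwards [continuous_abs.continuousAt.eventually (gt_mem_nhds ht)] with s hs
    rw [profile_of_abs_lt hε hη hs]; rfl
  · rw [profile_of_abs_lt hε hη ht, ← hTdef, ← hθdef]
    have hsgn : ((SignType.sign t : ℝ)) ^ 2 = 1 := by
      rcases lt_or_gt_of_ne ht0 with h | h
      · simp [sign_neg h]
      · simp [sign_pos h]
    have h2 : √2 ^ 2 = 2 := Real.sq_sqrt (by norm_num)
    have hpd : profileDensity ε t = 1 / (2 * ε) * (1 - θ ^ 2) ^ 2 := by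
      rw [profileDensity, hθdef]
      rcases abs_choice t with h | h <;> rw [h]
      rw [neg_div, Real.tanh_neg, neg_sq]
    have hd : ((1 - θ ^ 2) * ((SignType.sign t : ℝ) / (√2 * ε)) / T) ^ 2 =
        (T ^ 2)⁻¹ * ((1 - θ ^ 2) ^ 2 / (2 * ε ^ 2)) := by
      rw [div_pow, mul_pow, div_pow, hsgn, mul_pow, h2]
      field_simp
    have hw : ((θ / T) ^ 2 - 1) ^ 2 ≤ (T ^ 2)⁻¹ * (1 - θ ^ 2) ^ 2 := by
      have a1 : θ ^ 2 ≤ (θ / T) ^ 2 := by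
        refine pow_le_pow_left₀ hθ0 ?_ 2
        rw [le_div_iff₀ hT]; nlinarith
      have a2 : (θ / T) ^ 2 ≤ 1 := by
        refine pow_le_one₀ (by positivity) ?_
        rwa [div_le_one hT]
      have a3 : 1 ≤ (T ^ 2)⁻¹ := by
        rw [one_le_inv₀ (by positivity)]; nlinarith
      have a4 : ((θ / T) ^ 2 - 1) ^ 2 ≤ (1 - θ ^ 2) ^ 2 := by nlinarith
      nlinarith [sq_nonneg (1 - θ ^ 2)]
    rw [hd, hpd]
    have : 1 / (4 * ε) * ((θ / T) ^ 2 - 1) ^ 2 ≤ 1 / (4 * ε) * ((T ^ 2)⁻¹ * (1 - θ ^ 2) ^ 2) := by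
      gcongr
    calc _ ≤ _ := add_le_add le_rfl this
      _ = _ := by field_simp; ring

theorem integral_profileDensity_le (hε : 0 < ε) (p : ℝ) (hη : 0 < η) :
    ∫ x in Ioo (p - η) (p + η), profileDensity ε (x - p) ≤ 2 * √2 / 3 := by
  have h2 : √2 ^ 2 = 2 := Real.sq_sqrt (by norm_num)
  have h2p : 0 < √2 := by positivity
  rw [← integral_Ioc_eq_integral_Ioo, ← intervalIntegral.integral_of_le (by linarith),
    intervalIntegral.integral_comp_sub_right (fun x => profileDensity ε x) p,
    intervalIntegral.integral_eq_sub_of_hasDerivAt (f := fun t => 1 / √2 *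
      (Real.tanh (t / (√2 * ε)) - Real.tanh (t / (√2 * ε)) ^ 3 / 3)) ?_
      (continuous_profileDensity.intervalIntegrable _ _)]
  · rw [show p - η - p = -η by ring, show p + η - p = η by ring, neg_div, Real.tanh_neg]
    set T := Real.tanh (η / (√2 * ε))
    have hT1 : T < 1 := Real.tanh_lt_one _
    have hT : 0 < T := tanh_scale_pos hε hη
    -- The gap is 2/3 − T + T³/3 = (T − 1)²(T + 2)/3.
    have h3 : T - T ^ 3 / 3 ≤ 2 / 3 := by nlinarith [mul_nonneg (sq_nonneg (T - 1)) (by linarith : 0 ≤ T + 2)]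
    have h4 : 1 / √2 = √2 / 2 := by field_simp; exact h2.symm
    rw [h4]
    nlinarith
  · intro t _
    have hd := (hasDerivAt_tanh (t / (√2 * ε))).comp t
      ((hasDerivAt_id t).div_const (√2 * ε))
    refine ((hd.sub ((hd.pow 3).div_const 3)).const_mul (1 / √2)).congr_deriv ?_
    simp only [profileDensity, Function.comp_apply, id]
    field_simp
    rw [h2]
    push_cast
    ring

/-- The modulus of the recovery maps: a product of profiles centred at the points of `P`. -/
noncomputable def modulus (ε η : ℝ) (P : Finset ℝ) (x : ℝ) : ℝ := ∏ p ∈ P, profile ε η (x - p)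

variable {P : Finset ℝ}

theorem modulus_nonneg (hε : 0 < ε) (hη : 0 < η) (x : ℝ) : 0 ≤ modulus ε η P x :=
  Finset.prod_nonneg fun _ _ => profile_nonneg hε hη _

theorem modulus_le_one (hε : 0 < ε) (hη : 0 < η) (x : ℝ) : modulus ε η P x ≤ 1 :=
  Finset.prod_le_one (fun _ _ => profile_nonneg hε hη _) fun _ _ => profile_le_one _

theorem modulus_of_mem {p : ℝ} (hp : p ∈ P) : modulus ε η P p = 0 :=
  Finset.prod_eq_zero hp (by rw [sub_self, profile_zero])

theorem modulus_eq_one (hε : 0 < ε) (hη : 0 < η) {x : ℝ} (h : ∀ p ∈ P, η ≤ |x - p|) :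
    modulus ε η P x = 1 :=
  Finset.prod_eq_one fun p hp => profile_eq_one hε hη (h p hp)

theorem continuous_modulus : Continuous (modulus ε η P) := by
  have := continuous_profile (ε := ε) (η := η)
  unfold modulus
  fun_prop

theorem ac_modulus (hε : 0 < ε) (hη : 0 < η) (P : Finset ℝ) (a b : ℝ) :
    AbsolutelyContinuousOnInterval (modulus ε η P) a b := by
  classical
  induction P using Finset.induction_on with
  | empty =>
    have : modulus ε η ∅ = fun _ => (1 : ℝ) := by ext; simp [modulus]
    rw [this]
    exact contDiff_const.contDiffOn.absolutelyContinuousOnInterval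
  | insert p P hp ih =>
    have : modulus ε η (insert p P) = fun x => profile ε η (x - p) * modulus ε η P x := by
      ext; simp [modulus, Finset.prod_insert hp]
    rw [this]
    exact (ac_profile hε hη p a b).fun_mul ih

/-- The sum of the energy densities of the profiles centred at the points of `P`. -/
noncomputable def modulusDensity (ε η : ℝ) (P : Finset ℝ) (x : ℝ) : ℝ :=
  ∑ p ∈ P, (Ioo (p - η) (p + η)).indicator (fun x => profileDensity ε (x - p)) x

/-- The finite set off which the modulus is differentiable. -/
noncomputable def modulusCorners (η : ℝ) (P : Finset ℝ) : Finset ℝ :=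
  P ∪ (P.image (· + η) ∪ P.image (· - η))

theorem mem_modulusCorners_of_abs_eq {p x : ℝ} (hp : p ∈ P) (h : |x - p| = η) :
    x ∈ modulusCorners η P := by
  simp only [modulusCorners, Finset.mem_union, Finset.mem_image]
  rcases abs_choice (x - p) with h' | h' <;> rw [h'] at h
  · exact Or.inr (Or.inl ⟨p, hp, by linarith⟩)
  · exact Or.inr (Or.inr ⟨p, hp, by linarith⟩)

theorem modulusDensity_nonneg (hε : 0 < ε) (x : ℝ) : 0 ≤ modulusDensity ε η P x :=
  Finset.sum_nonneg fun _ _ => indicator_nonneg (fun _ _ => profileDensity_nonneg hε _) _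

/-- As the centres are at least 2η apart, at most one factor differs from 1 near a point that is not
a corner, and the estimate reduces to a single profile. -/
theorem hasDerivAt_modulus (hε : 0 < ε) (hη : 0 < η)
    (hsep : ∀ p ∈ P, ∀ q ∈ P, p ≠ q → 2 * η ≤ |p - q|) {x : ℝ} (hx : x ∉ modulusCorners η P) :
    HasDerivAt (modulus ε η P) (deriv (modulus ε η P) x) x ∧
      ε / 2 * deriv (modulus ε η P) x ^ 2 + 1 / (4 * ε) * (modulus ε η P x ^ 2 - 1) ^ 2 ≤
        (Real.tanh (η / (√2 * ε)) ^ 2)⁻¹ * modulusDensity ε η P x := by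
  have hT := tanh_scale_pos hε hη
  have hcont : ∀ q : ℝ, Continuous fun y : ℝ => |y - q| := fun q => by fun_prop
  suffices ∃ d, HasDerivAt (modulus ε η P) d x ∧
      ε / 2 * d ^ 2 + 1 / (4 * ε) * (modulus ε η P x ^ 2 - 1) ^ 2 ≤
        (Real.tanh (η / (√2 * ε)) ^ 2)⁻¹ * modulusDensity ε η P x by
    obtain ⟨d, hd, hle⟩ := this
    rw [hd.deriv]; exact ⟨hd, hle⟩
  by_cases hex : ∃ p ∈ P, |x - p| < η
  · obtain ⟨p, hp, hpx⟩ := hex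
    have hfar : ∀ q ∈ P, q ≠ p → η < |x - q| := by
      intro q hq hqp
      have h1 := hsep p hp q hq (Ne.symm hqp)
      have h2 := abs_sub_le p x q
      rw [abs_sub_comm p x] at h2
      linarith
    have hev : modulus ε η P =ᶠ[𝓝 x] fun y => profile ε η (y - p) := by
      have : ∀ᶠ y in 𝓝 x, ∀ q ∈ P, q ≠ p → η < |y - q| := by
        rw [Finset.eventually_all]
        intro q hq
        by_cases hqp : q = p
        · exact Eventually.of_forall fun y h => absurd hqp h
        · filter_upwards [(hcont q).continuousAt.eventually (lt_mem_nhds (hfar q hq hqp))] with y hy _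
          exact hy
      filter_upwards [this] with y hy
      exact Finset.prod_eq_single_of_mem p hp fun q hq hqp =>
        profile_eq_one hε hη (hy q hq hqp).le
    have hxp : x - p ≠ 0 := by
      intro h0
      refine hx (Finset.mem_union_left _ ?_)
      rwa [sub_eq_zero.1 h0]
    obtain ⟨d, hd, hle⟩ := exists_hasDerivAt_profile hε hη hxp hpx
    refine ⟨d, ?_, ?_⟩
    · exact (HasDerivAt.comp_sub_const x p hd).congr_of_eventuallyEq hev
    · rw [hev.eq_of_nhds]
      refine hle.trans ?_
      gcongr
      have hmem : x ∈ Ioo (p - η) (p + η) := by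
        rw [abs_lt] at hpx
        constructor <;> linarith [hpx.1, hpx.2]
      calc profileDensity ε (x - p)
          = (Ioo (p - η) (p + η)).indicator (fun x => profileDensity ε (x - p)) x := by
            rw [indicator_of_mem hmem]
        _ ≤ _ := Finset.single_le_sum (f := fun p => (Ioo (p - η) (p + η)).indicator
            (fun x => profileDensity ε (x - p)) x)
            (fun q _ => indicator_nonneg (fun _ _ => profileDensity_nonneg hε _) _) hp
  · push Not at hex
    have hfar : ∀ q ∈ P, η < |x - q| := fun q hq =>
      lt_of_le_of_ne (hex q hq) fun h => hx (mem_modulusCorners_of_abs_eq hq h.symm)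
    have hev : modulus ε η P =ᶠ[𝓝 x] fun _ => (1 : ℝ) := by
      have : ∀ᶠ y in 𝓝 x, ∀ q ∈ P, η < |y - q| := by
        rw [Finset.eventually_all]
        exact fun q hq => (hcont q).continuousAt.eventually (lt_mem_nhds (hfar q hq))
      filter_upwards [this] with y hy
      exact modulus_eq_one hε hη fun q hq => (hy q hq).le
    refine ⟨0, (hasDerivAt_const x (1 : ℝ)).congr_of_eventuallyEq hev, ?_⟩
    rw [hev.eq_of_nhds]
    have := modulusDensity_nonneg (P := P) (η := η) hε x
    simp only [ne_eq, OfNat.ofNat_ne_zero, not_false_eq_true, zero_pow, mul_zero, one_pow,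
      sub_self, add_zero]
    positivity

theorem integrable_modulusDensity (ε η : ℝ) (P : Finset ℝ) (U : Set ℝ) :
    IntegrableOn (modulusDensity ε η P) U := by
  refine Integrable.integrableOn (integrable_finsetSum _ fun p _ => ?_)
  rw [integrable_indicator_iff measurableSet_Ioo]
  exact ((continuous_profileDensity.comp (continuous_sub_right p)).integrableOn_Icc).mono_set
    Ioo_subset_Icc_self

theorem integral_modulusDensity_le (hε : 0 < ε) (hη : 0 < η) (P : Finset ℝ) :
    ∫ x in Ioo 0 1, modulusDensity ε η P x ≤ P.card * (2 * √2 / 3) := by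
  refine (setIntegral_le_integral
    (integrableOn_univ.1 (integrable_modulusDensity ε η P univ))
    (Eventually.of_forall fun x => modulusDensity_nonneg hε x)).trans ?_
  unfold modulusDensity
  rw [integral_finsetSum]
  · rw [← nsmul_eq_mul]
    refine Finset.sum_le_card_nsmul _ _ _ fun p _ => ?_
    rw [integral_indicator measurableSet_Ioo]
    exact integral_profileDensity_le hε p hη
  · intro p _
    rw [integrable_indicator_iff measurableSet_Ioo]
    exact ((continuous_profileDensity.comp (continuous_sub_right p)).integrableOn_Icc).mono_set
      Ioo_subset_Icc_self

/-- A crude bound, not uniform in ε, that serves only to place the derivative of the modulus in L².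
-/
theorem modulusDensity_le (hε : 0 < ε) (x : ℝ) :
    modulusDensity ε η P x ≤ P.card * (1 / (2 * ε)) := by
  rw [← nsmul_eq_mul]
  refine Finset.sum_le_card_nsmul _ _ _ fun p _ => ?_
  by_cases hx : x ∈ Ioo (p - η) (p + η)
  · rw [indicator_of_mem hx]; exact profileDensity_le hε _
  · rw [indicator_of_notMem hx]; positivity

end Profile

/-! ### Pointwise representatives and products that remove jumps -/

section Representative

theorem continuousAt_integral_of_mem {g : ℝ → ℂ} (hg : IntegrableOn g (Ioo 0 1)) {x : ℝ}
    (hx : x ∈ Ioo (0 : ℝ) 1) : ContinuousAt (fun x => ∫ t in (0 : ℝ)..x, g t) x := by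
  have hW := (ac_integral (intervalIntegrable_iff_Ioo.2 hg) left_mem_uIcc).continuousOn
  rw [uIcc_of_le zero_le_one] at hW
  exact hW.continuousAt (Icc_mem_nhds hx.1 hx.2)

/-- The modulus is 1 almost everywhere and continuous off J, hence 1 at each point there. At an
endpoint outside J the trace determines the constant value of s nearby. -/
theorem IsJumpSet.exists_rep {α : ℝ} {u : ℝ → ℂ} {J : Finset ℝ} (hJ : IsJumpSet α u J)
    {g : ℝ → ℂ} (hg : IntegrableOn g (Ioo 0 1))
    (hw : IsWeakDeriv (Ioo 0 1 \ (J : Set ℝ)) u g) :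
    ∃ s : ℝ → ℂ, (∀ x ∈ Ioo (0 : ℝ) 1 \ (J : Set ℝ), ∀ᶠ y in 𝓝 x, s y = s x) ∧
      (∀ᵐ x, x ∈ Ioo (0 : ℝ) 1 → u x = (∫ t in (0 : ℝ)..x, g t) + s x) ∧
      (∀ x ∈ Ioo (0 : ℝ) 1, ‖(∫ t in (0 : ℝ)..x, g t) + s x‖ = 1) ∧
      (0 ∉ J → ∀ᶠ x in 𝓝[>] (0 : ℝ), s x = 1) ∧
      (1 ∉ J → ∀ᶠ x in 𝓝[<] (1 : ℝ),
        s x = Complex.exp (α * Complex.I) - ∫ t in (0 : ℝ)..1, g t) := by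
  classical
  have hu : IntegrableOn u (Ioo 0 1) := by
    have := hJ.memH1.1.1
    rw [restrict_Ioo_diff] at this
    exact integrableOn_of_memLp Subset.rfl this
  obtain ⟨s₀, h1, h2⟩ := Twist.exists_rep hu hg hw
  set w : ℝ → ℂ := fun x => ∫ t in (0 : ℝ)..x, g t with hwdef
  have hW := (ac_integral (intervalIntegrable_iff_Ioo.2 hg) left_mem_uIcc).continuousOn
  rw [uIcc_of_le zero_le_one] at hW
  -- On the null set J the value is chosen so that the representative equals 1 there; its modulus is
  -- then 1 at every point of (0,1).
  set s : ℝ → ℂ := fun x => if x ∈ J then 1 - w x else s₀ x with hsdef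
  have hss : ∀ x, x ∉ J → s x = s₀ x := fun x hx => if_neg hx
  have hs1 : ∀ x ∈ Ioo (0 : ℝ) 1 \ (J : Set ℝ), ∀ᶠ y in 𝓝 x, s y = s x := by
    intro x hx
    filter_upwards [h1 x hx, (isOpen_Ioo_diff J).mem_nhds hx] with y hy hyJ
    rw [hss y hyJ.2, hss x hx.2, hy]
  have hs2 : ∀ᵐ x, x ∈ Ioo (0 : ℝ) 1 → u x = w x + s x := by
    filter_upwards [h2, compl_mem_ae_iff.2 (J.finite_toSet.measure_zero volume)] with x hx hxJ hm
    rw [hx ⟨hm, hxJ⟩, hss x hxJ]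
  have hnorm : ∀ᵐ x, x ∈ Ioo (0 : ℝ) 1 → ‖w x + s x‖ = 1 := by
    filter_upwards [hs2, (ae_restrict_iff' measurableSet_Ioo).1 hJ.memH1.2] with x h3 h4 hx
    rw [← h3 hx, h4 hx]
  refine ⟨s, hs1, hs2, ?_, ?_, ?_⟩
  · intro x hx
    by_cases hxJ : x ∈ J
    · simp only [hsdef, if_pos hxJ]
      change ‖w x + (1 - w x)‖ = 1
      simp
    · have hc : ContinuousAt (fun y => ‖w y + s y‖) x := by
        have hsc : ContinuousAt s x :=
          (continuousAt_const (y := s x)).congr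
            ((hs1 x ⟨hx, hxJ⟩).mono fun y hy => hy.symm)
        exact ((continuousAt_integral_of_mem hg hx).add hsc).norm
      have ht : Tendsto (fun y => ‖w y + s y‖) (𝓝[>] x ⊓ ae volume) (𝓝 ‖w x + s x‖) :=
        hc.mono_left (inf_le_left.trans nhdsWithin_le_nhds)
      have he : ∀ᶠ y in 𝓝[>] x ⊓ ae volume, ‖w y + s y‖ = 1 := by
        filter_upwards [mem_inf_of_right (f := 𝓝[>] x) hnorm, mem_inf_of_left (g := ae volume)
          (mem_nhdsWithin_of_mem_nhds (Ioo_mem_nhds hx.1 hx.2))] with y h3 h4 using h3 h4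
      exact tendsto_nhds_unique ht (tendsto_const_nhds.congr' (he.mono fun y hy => hy.symm))
  · intro h0
    have htr : TraceAtZero u 1 := by
      by_contra h
      exact h0 (hJ.zero_mem.2 h)
    obtain ⟨r, hr, hrJ⟩ := Metric.isOpen_iff.1 J.finite_toSet.isClosed.isOpen_compl 0 h0
    set t := min r 1
    have ht : 0 < t := lt_min hr one_pos
    have hsub : ∀ x ∈ Ioo 0 t, x ∈ Ioo (0 : ℝ) 1 \ (J : Set ℝ) := by
      intro x hx
      refine ⟨⟨hx.1, hx.2.trans_le (min_le_right _ _)⟩, hrJ ?_⟩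
      rw [Metric.mem_ball, Real.dist_eq, sub_zero, abs_of_pos hx.1]
      exact hx.2.trans_le (min_le_left _ _)
    have hconst : ∀ x ∈ Ioo 0 t, s x = s (t / 2) := fun x hx =>
      eq_of_eventually_const (fun y hy => hs1 y (hsub y hy)) hx ⟨by linarith, by linarith⟩
    have hev : ∀ᶠ x in 𝓝[>] (0 : ℝ), s x = s (t / 2) := by
      filter_upwards [Ioo_mem_nhdsGT ht] with x hx using hconst x hx
    have hlim : Tendsto (fun x => w x + s x) (𝓝[>] 0) (𝓝 (s (t / 2))) := by
      have hw0 : Tendsto w (𝓝[>] 0) (𝓝 0) := by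
        have := (hW 0 (by simp)).mono_left
          ((nhdsWithin_Ioo_eq_nhdsGT (zero_lt_one' ℝ)).symm.le.trans
            (nhdsWithin_mono _ Ioo_subset_Icc_self))
        simpa using this
      have := hw0.add (tendsto_const_nhds (x := s (t / 2)))
      rw [zero_add] at this
      refine this.congr' ?_
      filter_upwards [hev] with x hx
      rw [hx]
    rw [htr.eq_of_tendsto hs2 hlim] at hev
    exact hev
  · intro h0
    have htr : TraceAtOne u (Complex.exp (α * Complex.I)) := by
      by_contra h
      exact h0 (hJ.one_mem.2 h)
    obtain ⟨r, hr, hrJ⟩ := Metric.isOpen_iff.1 J.finite_toSet.isClosed.isOpen_compl 1 h0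
    set t := min r 1
    have ht : 0 < t := lt_min hr one_pos
    have hsub : ∀ x ∈ Ioo (1 - t) 1, x ∈ Ioo (0 : ℝ) 1 \ (J : Set ℝ) := by
      intro x hx
      have ht1 : t ≤ 1 := min_le_right _ _
      have htr : t ≤ r := min_le_left _ _
      refine ⟨⟨by linarith [hx.1], hx.2⟩, hrJ ?_⟩
      rw [Metric.mem_ball, Real.dist_eq, abs_sub_comm, abs_of_pos (sub_pos.2 hx.2)]
      linarith [hx.1]
    have hconst : ∀ x ∈ Ioo (1 - t) 1, s x = s (1 - t / 2) := fun x hx =>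
      eq_of_eventually_const (fun y hy => hs1 y (hsub y hy)) hx ⟨by linarith, by linarith⟩
    have hev : ∀ᶠ x in 𝓝[<] (1 : ℝ), s x = s (1 - t / 2) := by
      filter_upwards [Ioo_mem_nhdsLT (show 1 - t < 1 by linarith)] with x hx using hconst x hx
    have hlim : Tendsto (fun x => w x + s x) (𝓝[<] 1) (𝓝 (w 1 + s (1 - t / 2))) := by
      have hw0 : Tendsto w (𝓝[<] 1) (𝓝 (w 1)) :=
        (hW 1 (by simp)).mono_left
          ((nhdsWithin_Ioo_eq_nhdsLT (zero_lt_one' ℝ)).symm.le.trans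
            (nhdsWithin_mono _ Ioo_subset_Icc_self))
      refine (hw0.add (tendsto_const_nhds (x := s (1 - t / 2)))).congr' ?_
      filter_upwards [hev] with x hx
      rw [hx]
    have := htr.eq_of_tendsto hs2 hlim
    filter_upwards [hev] with x hx
    rw [hx, ← this]
    change _ = w 1 + s (1 - t / 2) - w 1
    ring

/-- Multiplying by a function that vanishes at the jumps of `F` removes these jumps. -/
theorem acWith_smul_of_jumps {ρ : ℝ → ℝ} {F G : ℝ → ℂ} {P Q : Finset ℝ} (hρc : Continuous ρ)
    (hρ : AbsolutelyContinuousOnInterval ρ 0 1)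
    (hρd : ∀ x, x ∉ Q → HasDerivAt ρ (deriv ρ x) x) (hρP : ∀ p ∈ P, ρ p = 0)
    (hG : IntegrableOn G (Ioo 0 1)) {C : ℝ} (hF : ∀ x ∈ Icc (0 : ℝ) 1, ‖F x‖ ≤ C)
    (hS : ∀ x ∈ Ioo (0 : ℝ) 1 \ (P : Set ℝ), ∀ᶠ y in 𝓝 x,
      F y - ∫ t in (0 : ℝ)..y, G t = F x - ∫ t in (0 : ℝ)..x, G t)
    (h0 : ∀ᶠ y in 𝓝[>] (0 : ℝ), F y - ∫ t in (0 : ℝ)..y, G t = F 0 - ∫ t in (0 : ℝ)..0, G t)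
    (h1 : ∀ᶠ y in 𝓝[<] (1 : ℝ), F y - ∫ t in (0 : ℝ)..y, G t = F 1 - ∫ t in (0 : ℝ)..1, G t) :
    ACWith (fun x => ρ x • F x) (fun x => deriv ρ x • F x + ρ x • G x) 0 1 := by
  have hGi := intervalIntegrable_iff_Ioo.2 hG
  set W : ℝ → ℂ := fun x => ∫ t in (0 : ℝ)..x, G t with hW
  have hWac : ACWith W G 0 1 := .of_integral hGi (by simp [hW])
  have hρac : ACWith ρ (deriv ρ) 0 1 := .of_ac hρ
  -- F = W + S with W absolutely continuous and S bounded and locally constant off P. Only ρS needs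
  -- care: at points of P it is continuous because ρ vanishes there and S is bounded.
  set S : ℝ → ℂ := fun x => F x - W x with hSdef
  obtain ⟨D, hD⟩ := hWac.exists_bound
  have hSb : ∀ x ∈ Icc (0 : ℝ) 1, ‖S x‖ ≤ C + D := fun x hx =>
    (norm_sub_le _ _).trans (add_le_add (hF x hx) (hD x hx))
  have hSd : ∀ x ∈ Ioo (0 : ℝ) 1 \ (P : Set ℝ), HasDerivAt S 0 x := fun x hx =>
    (hasDerivAt_const x (S x)).congr_of_eventuallyEq (hS x hx)
  have hSm : AEStronglyMeasurable S (volume.restrict (Ioo 0 1)) := by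
    rw [← restrict_Ioo_diff P]
    exact ContinuousOn.aestronglyMeasurable
      (fun x hx => (hSd x hx).continuousAt.continuousWithinAt) (isOpen_Ioo_diff P).measurableSet
  have hcont : ContinuousOn (fun x => ρ x • S x) (Icc 0 1) := by
    intro x hx
    by_cases hxP : x ∈ P
    · rw [ContinuousWithinAt, hρP x hxP, zero_smul]
      have hlim : Tendsto (fun y => |ρ y| * (C + D)) (𝓝[Icc 0 1] x) (𝓝 0) := by
        have hc : Continuous fun y => |ρ y| * (C + D) := by fun_prop
        have := hc.tendsto x
        simp only [hρP x hxP, abs_zero, zero_mul] at this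
        exact this.mono_left nhdsWithin_le_nhds
      refine squeeze_zero_norm' ?_ hlim
      filter_upwards [self_mem_nhdsWithin] with y hy
      rw [norm_smul, Real.norm_eq_abs]
      gcongr
      exact hSb y hy
    · refine hρc.continuousWithinAt.smul ?_
      rcases hx.1.eq_or_lt with rfl | hx0
      · refine (continuousWithinAt_const (b := S 0)).congr_of_eventuallyEq ?_ rfl
        rw [nhdsWithin_Icc_eq_nhdsGE zero_lt_one, ← Ioi_insert, nhdsWithin_insert]
        exact eventually_sup.2 ⟨by simp, h0⟩
      rcases hx.2.eq_or_lt with rfl | hx1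
      · refine (continuousWithinAt_const (b := S 1)).congr_of_eventuallyEq ?_ rfl
        rw [nhdsWithin_Icc_eq_nhdsLE zero_lt_one, ← Iio_insert, nhdsWithin_insert]
        exact eventually_sup.2 ⟨by simp, h1⟩
      · exact (hSd x ⟨⟨hx0, hx1⟩, hxP⟩).continuousAt.continuousWithinAt
  have hint : IntervalIntegrable (fun x => deriv ρ x • S x) volume 0 1 := by
    rw [intervalIntegrable_iff_Ioo]
    refine Integrable.smul_bdd ((intervalIntegrable_iff_integrableOn_Ioo_of_le
      zero_le_one).1 hρac.integrable) (C + D) hSm ?_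
    exact (ae_restrict_iff' measurableSet_Ioo).2
      (Eventually.of_forall fun x hx => hSb x (Ioo_subset_Icc_self hx))
  -- Continuity on [0,1] and the derivative ρ'S off the finite set P ∪ Q suffice, as ρ'S is
  -- integrable.
  have hρS : ACWith (fun x => ρ x • S x) (fun x => deriv ρ x • S x) 0 1 := by
    refine .of_integral hint fun x hx => ?_
    rw [uIcc_of_le zero_le_one] at hx
    have hsub : Icc 0 x ⊆ Icc (0 : ℝ) 1 := Icc_subset_Icc le_rfl hx.2
    rw [integral_eq_of_hasDerivAt_off_countable_of_le (fun x => ρ x • S x) _ hx.1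
      ((P ∪ Q).finite_toSet.countable) (hcont.mono hsub) ?_ ?_]
    · ring
    · intro y hy
      have hyPQ : y ∉ P ∧ y ∉ Q := by
        have := hy.2
        simpa only [Finset.coe_union, mem_union, Finset.mem_coe, not_or] using this
      have := (hρd y hyPQ.2).fun_smul (hSd y ⟨⟨hy.1.1, hy.1.2.trans_le hx.2⟩, hyPQ.1⟩)
      simpa using this
    · refine hint.mono_set ?_
      rw [uIcc_of_le hx.1, uIcc_of_le zero_le_one]; exact hsub
  have hsum := (hWac.smul hρac).add hρS
  have e1 : (fun x => ρ x • W x + ρ x • S x) = fun x => ρ x • F x := by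
    ext x
    rw [← smul_add]; congr 1; simp only [hSdef]; ring
  have e2 : (fun x => deriv ρ x • W x + ρ x • G x + deriv ρ x • S x) =
      fun x => deriv ρ x • F x + ρ x • G x := by
    ext x
    have : F x = W x + S x := by simp only [hSdef]; ring
    rw [this, smul_add]; ring
  rwa [e1, e2] at hsum

end Representative

/-! ### Replacing a map by its boundary values near the ends -/

section CutMap

/-- The map equal to `1` up to `a`, to `f` between `a` and `b`, and to `e` from `b` on. -/
noncomputable def cutMap (a b : ℝ) (e : ℂ) (f : ℝ → ℂ) (x : ℝ) : ℂ :=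
  if x ≤ a then 1 else if b ≤ x then e else f x

variable {a b : ℝ} {e : ℂ} {f g : ℝ → ℂ} {x : ℝ}

theorem cutMap_left (hx : x ≤ a) : cutMap a b e f x = 1 := if_pos hx

theorem cutMap_mid (hx : x ∈ Ioo a b) : cutMap a b e f x = f x := by
  rw [cutMap, if_neg (not_le.2 hx.1), if_neg (not_le.2 hx.2)]

theorem cutMap_right (hab : a < b) (hx : b ≤ x) : cutMap a b e f x = e := by
  rw [cutMap, if_neg (not_le.2 (hab.trans_le hx)), if_pos hx]

theorem norm_cutMap (hab : a < b) (he : ‖e‖ = 1) (hf : x ∈ Ioo a b → ‖f x‖ = 1) :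
    ‖cutMap a b e f x‖ = 1 := by
  rcases le_or_gt x a with h | h
  · rw [cutMap_left h, norm_one]
  rcases le_or_gt b x with h' | h'
  · rw [cutMap_right hab h', he]
  · rw [cutMap_mid ⟨h, h'⟩, hf ⟨h, h'⟩]

theorem integral_indicator_of_le_left {y : ℝ} (hx : x ≤ a) (hy : y ≤ a) :
    ∫ t in x..y, (Ioo a b).indicator g t = 0 := by
  rw [intervalIntegral.integral_congr (g := fun _ => (0 : ℂ)), intervalIntegral.integral_zero]
  intro t ht
  exact indicator_of_notMem (fun h => absurd h.1 (not_lt.2 (ht.2.trans (max_le hx hy)))) _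

theorem integral_indicator_of_ge_right {y : ℝ} (hx : b ≤ x) (hy : b ≤ y) :
    ∫ t in x..y, (Ioo a b).indicator g t = 0 := by
  rw [intervalIntegral.integral_congr (g := fun _ => (0 : ℂ)), intervalIntegral.integral_zero]
  intro t ht
  exact indicator_of_notMem (fun h => absurd h.2 (not_lt.2 ((le_min hx hy).trans ht.1))) _

theorem integral_indicator_of_mem {y : ℝ} (hx : x ∈ Icc a b) (hy : y ∈ Icc a b) :
    ∫ t in x..y, (Ioo a b).indicator g t = ∫ t in x..y, g t := by
  refine intervalIntegral.integral_congr_ae ?_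
  filter_upwards [ae_mem_uIoo_of_mem_uIcc x y] with t ht hm
  have := ht (uIoc_subset_uIcc hm)
  have htm : t ∈ Ioo a b :=
    ⟨(le_min hx.1 hy.1).trans_lt this.1, this.2.trans_le (max_le hx.2 hy.2)⟩
  exact indicator_of_mem htm g

/-- The cut map can jump only at a, at b and at the old jumps between them. An end that is not cut
(a = 0 or b = 1) creates no jump, because s already matches the boundary value there. -/
theorem cutMap_jumps {J P : Finset ℝ} {s : ℝ → ℂ} (ha : 0 ≤ a) (hab : a < b) (hb : b ≤ 1)
    (hg : IntegrableOn g (Ioo 0 1)) (hf : f = fun x => (∫ t in (0 : ℝ)..x, g t) + s x)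
    (hs : ∀ x ∈ Ioo (0 : ℝ) 1 \ (J : Set ℝ), ∀ᶠ y in 𝓝 x, s y = s x)
    (haP : a ≠ 0 → a ∈ P) (hbP : b ≠ 1 → b ∈ P) (hJP : ∀ x ∈ J, x ∈ Ioo a b → x ∈ P)
    (hs0 : a = 0 → ∀ᶠ x in 𝓝[>] (0 : ℝ), s x = 1)
    (hs1 : b = 1 → ∀ᶠ x in 𝓝[<] (1 : ℝ), s x = e - ∫ t in (0 : ℝ)..1, g t) :
    (∀ x ∈ Ioo (0 : ℝ) 1 \ (P : Set ℝ), ∀ᶠ y in 𝓝 x,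
      cutMap a b e f y - ∫ t in (0 : ℝ)..y, (Ioo a b).indicator g t =
        cutMap a b e f x - ∫ t in (0 : ℝ)..x, (Ioo a b).indicator g t) ∧
    (∀ᶠ y in 𝓝[>] (0 : ℝ), cutMap a b e f y - ∫ t in (0 : ℝ)..y, (Ioo a b).indicator g t =
      cutMap a b e f 0 - ∫ t in (0 : ℝ)..0, (Ioo a b).indicator g t) ∧
    (∀ᶠ y in 𝓝[<] (1 : ℝ), cutMap a b e f y - ∫ t in (0 : ℝ)..y, (Ioo a b).indicator g t =
      cutMap a b e f 1 - ∫ t in (0 : ℝ)..1, (Ioo a b).indicator g t) := by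
  have hgi := intervalIntegrable_iff_Ioo.2 hg
  have hGi : IntervalIntegrable ((Ioo a b).indicator g) volume 0 1 :=
    intervalIntegrable_iff_Ioo.2 (hg.indicator measurableSet_Ioo)
  have hsub : ∀ {k : ℝ → ℂ}, IntervalIntegrable k volume 0 1 → ∀ x ∈ Icc (0 : ℝ) 1,
      ∀ y ∈ Icc (0 : ℝ) 1, ∫ t in (0 : ℝ)..y, k t = (∫ t in (0 : ℝ)..x, k t) + ∫ t in x..y, k t := by
    intro k hk x hx y hy
    rw [← uIcc_of_le zero_le_one] at hx hy
    rw [intervalIntegral.integral_add_adjacent_intervals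
      (hk.mono_set (uIcc_subset_uIcc left_mem_uIcc hx)) (hk.mono_set (uIcc_subset_uIcc hx hy))]
  refine ⟨fun x hx => ?_, ?_, ?_⟩
  · have hxI := Ioo_subset_Icc_self hx.1
    rcases lt_trichotomy x a with hxa | hxa | hxa
    · filter_upwards [Iio_mem_nhds hxa] with y hy
      rw [cutMap_left hxa.le, cutMap_left (le_of_lt hy), integral_indicator_of_le_left ha hxa.le,
        integral_indicator_of_le_left ha (le_of_lt hy)]
    · refine absurd (haP ?_) (hxa ▸ hx.2)
      rw [← hxa]; exact hx.1.1.ne'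
    rcases lt_trichotomy x b with hxb | hxb | hxb
    · have hxJ : x ∉ J := fun h => hx.2 (hJP x h ⟨hxa, hxb⟩)
      filter_upwards [Ioo_mem_nhds hxa hxb, hs x ⟨hx.1, hxJ⟩, Ioo_mem_nhds hx.1.1 hx.1.2]
        with y hy hsy hyI
      rw [cutMap_mid ⟨hxa, hxb⟩, cutMap_mid hy, hsub hGi x hxI y (Ioo_subset_Icc_self hyI),
        integral_indicator_of_mem ⟨hxa.le, hxb.le⟩ (Ioo_subset_Icc_self hy), hf]
      simp only
      rw [hsub hgi x hxI y (Ioo_subset_Icc_self hyI), hsy]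
      ring
    · refine absurd (hbP ?_) (hxb ▸ hx.2)
      rw [← hxb]; exact hx.1.2.ne
    · filter_upwards [Ioi_mem_nhds hxb, Ioo_mem_nhds hx.1.1 hx.1.2] with y hy hyI
      rw [cutMap_right hab hxb.le, cutMap_right hab (le_of_lt hy),
        hsub hGi x hxI y (Ioo_subset_Icc_self hyI),
        integral_indicator_of_ge_right hxb.le (le_of_lt hy), add_zero]
  · rw [intervalIntegral.integral_same, sub_zero, cutMap_left ha]
    rcases ha.eq_or_lt with ha0 | ha0
    · filter_upwards [hs0 ha0.symm, Ioo_mem_nhdsGT (ha0.le.trans_lt hab)] with y hsy hy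
      have hy' : y ∈ Ioo a b := ha0 ▸ hy
      rw [cutMap_mid hy', integral_indicator_of_mem ⟨ha0.symm.le, hab.le.trans' ha⟩
        (Ioo_subset_Icc_self hy'), hf]
      simp only
      rw [hsy]; ring
    · filter_upwards [Ioo_mem_nhdsGT ha0] with y hy
      rw [cutMap_left hy.2.le, integral_indicator_of_le_left ha hy.2.le, sub_zero]
  · rw [cutMap_right hab hb]
    rcases hb.eq_or_lt with hb1 | hb1
    · have ha1 : a < 1 := hb1 ▸ hab
      filter_upwards [hs1 hb1, Ioo_mem_nhdsLT ha1] with y hsy hy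
      have hy' : y ∈ Ioo a b := hb1 ▸ hy
      have hyI : y ∈ Icc (0 : ℝ) 1 := ⟨ha.trans hy.1.le, hy.2.le⟩
      rw [cutMap_mid hy', hsub hGi y hyI 1 (by simp),
        integral_indicator_of_mem (Ioo_subset_Icc_self hy') (x := y) (y := 1)
        ⟨ha1.le, hb1.symm.le⟩, hf]
      simp only
      rw [hsy, hsub hgi y hyI 1 (by simp)]; ring
    · filter_upwards [Ioo_mem_nhdsLT hb1] with y hy
      have hyI : y ∈ Icc (0 : ℝ) 1 := ⟨(ha.trans hab.le).trans hy.1.le, hy.2.le⟩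
      rw [cutMap_right hab hy.1.le, hsub hGi y hyI 1 (by simp),
        integral_indicator_of_ge_right hy.1.le hb, add_zero]

end CutMap

/-! ### Moving boundary jumps into the interior -/

section ShiftedJumps

/-- Move a point of `[0, 1]` into `[η, 1 - η]`. -/
noncomputable def clampPoint (η p : ℝ) : ℝ := max η (min p (1 - η))

theorem clampPoint_mem {η p : ℝ} (hη : 2 * η ≤ 1) : clampPoint η p ∈ Icc η (1 - η) :=
  ⟨le_max_left _ _, max_le (by linarith) (min_le_right _ _)⟩

theorem clampPoint_of_mem {η p : ℝ} (hp : p ∈ Icc η (1 - η)) : clampPoint η p = p := by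
  rw [clampPoint, min_eq_left hp.2, max_eq_right hp.1]

theorem abs_clampPoint_sub_le {η p : ℝ} (hη0 : 0 ≤ η) (hp : p ∈ Icc (0 : ℝ) 1) :
    |clampPoint η p - p| ≤ η := by
  rw [clampPoint, abs_le]
  constructor
  · have : p - η ≤ min p (1 - η) := le_min (by linarith) (by linarith [hp.2])
    linarith [le_max_right η (min p (1 - η))]
  · have : max η (min p (1 - η)) ≤ p + η :=
      max_le (by linarith [hp.1]) ((min_le_left _ _).trans (by linarith))
    linarith

/-- Each point moves by at most η, so a distance of 4η shrinks to no less than 2η. -/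
theorem clampPoint_separated {η p q : ℝ} (hη0 : 0 ≤ η) (hp : p ∈ Icc (0 : ℝ) 1)
    (hq : q ∈ Icc (0 : ℝ) 1) (hpq : 4 * η ≤ |p - q|) :
    2 * η ≤ |clampPoint η p - clampPoint η q| := by
  have h1 := abs_clampPoint_sub_le hη0 hp
  have h2 := abs_clampPoint_sub_le hη0 hq
  have h3 := abs_sub_le p (clampPoint η p) q
  have h4 := abs_sub_le (clampPoint η p) (clampPoint η q) q
  rw [abs_sub_comm p (clampPoint η p)] at h3
  linarith

end ShiftedJumps

/-! ### Construction and energy of the recovery maps -/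

section Recovery

/-- The region where the recovery map may differ from its limit. -/
def transition (η : ℝ) (P : Finset ℝ) : Set ℝ :=
  (⋃ p ∈ P, Ioo (p - η) (p + η)) ∪ (Icc 0 η ∪ Icc (1 - η) 1)

theorem measurableSet_transition (η : ℝ) (P : Finset ℝ) : MeasurableSet (transition η P) :=
  (P.measurableSet_biUnion fun _ _ => measurableSet_Ioo).union
    (measurableSet_Icc.union measurableSet_Icc)

theorem volume_transition_le {η : ℝ} (hη : 0 ≤ η) (P : Finset ℝ) :
    volume (transition η P) ≤ ENNReal.ofReal ((2 * P.card + 2) * η) := by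
  have h1 : volume (⋃ p ∈ P, Ioo (p - η) (p + η)) ≤ P.card • ENNReal.ofReal (2 * η) := by
    refine (measure_biUnion_finset_le _ _).trans (Finset.sum_le_card_nsmul _ _ _ fun p _ => ?_)
    rw [Real.volume_Ioo]
    exact ENNReal.ofReal_le_ofReal (by linarith)
  have h2 : volume (Icc 0 η ∪ Icc (1 - η) 1) ≤ ENNReal.ofReal η + ENNReal.ofReal η := by
    refine (measure_union_le _ _).trans (le_of_eq ?_)
    rw [Real.volume_Icc, Real.volume_Icc]; congr 2 <;> ring
  refine (measure_union_le _ _).trans ((add_le_add h1 h2).trans (le_of_eq ?_))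
  rw [nsmul_eq_mul, ← ENNReal.ofReal_natCast, ← ENNReal.ofReal_mul (by positivity),
    ← ENNReal.ofReal_add hη hη, ← ENNReal.ofReal_add (by positivity) (by positivity)]
  congr 1; ring

theorem twist_real_smul (r r' : ℝ) (z w : ℂ) :
    twist (r • z) (r' • z + r • w) = r ^ 2 * twist z w := by
  simp [twist]; ring

/-- Young's inequality (s + t)² ≤ (1 + η)s² + (1 + 1/η)t², multiplied by ε/2 with ε = η². At this
scale the profile term is multiplied by 1 + η → 1 and the coefficient of t² tends to 0. -/
theorem add_sq_le_of_pos {η : ℝ} (hη : 0 < η) (s t : ℝ) :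
    η ^ 2 / 2 * (s + t) ^ 2 ≤ (1 + η) * (η ^ 2 / 2 * s ^ 2) + (η ^ 2 + η) / 2 * t ^ 2 := by
  have h : 0 ≤ η / 2 * (η * s - t) ^ 2 := by positivity
  nlinarith

/-- By convexity (χt − c)² ≤ χ(t − c)² + (1 − χ)c², as χt lies between 0 and t. -/
theorem cut_sq_le {χ t c : ℝ} (h0 : 0 ≤ χ) (h1 : χ ≤ 1) :
    (χ * t - c) ^ 2 ≤ (t - c) ^ 2 + c ^ 2 * (1 - χ) := by
  nlinarith [mul_nonneg h0 (sub_nonneg.2 h1), mul_nonneg (mul_nonneg h0 (sub_nonneg.2 h1))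
    (sq_nonneg t), sq_nonneg (t - c), mul_nonneg (sub_nonneg.2 h1) (sq_nonneg (t - c))]

/-- Scaling the twist by `ρ²`, and cutting it off inside a set `S` on which `ρ` may differ from `1`,
costs at most `c²|S|`. -/
theorem integral_cut_sq_le {μ : Measure ℝ} [IsFiniteMeasure μ] {t τ χ : ℝ → ℝ} {S : Set ℝ}
    (hS : MeasurableSet S) (ht : MemLp t 2 μ) (hτ : MemLp τ 2 μ) (c : ℝ)
    (hχ0 : ∀ x, 0 ≤ χ x) (hχ1 : ∀ x, χ x ≤ 1) (hχS : ∀ᵐ x ∂μ, x ∉ S → χ x = 1)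
    (hτt : ∀ᵐ x ∂μ, τ x = χ x * t x) :
    ∫ x, (τ x - c) ^ 2 ∂μ ≤ (∫ x, (t x - c) ^ 2 ∂μ) + c ^ 2 * μ.real S := by
  have hi1 : Integrable (fun x => (t x - c) ^ 2) μ := (ht.sub (memLp_const c)).integrable_sq
  have hi2 : Integrable (fun x => c ^ 2 * S.indicator (fun _ => (1 : ℝ)) x) μ :=
    ((integrable_const (1 : ℝ)).indicator hS).const_mul _
  calc ∫ x, (τ x - c) ^ 2 ∂μ
      ≤ ∫ x, ((t x - c) ^ 2 + c ^ 2 * S.indicator (fun _ => (1 : ℝ)) x) ∂μ := by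
        refine integral_mono_ae (hτ.sub (memLp_const c)).integrable_sq (hi1.add hi2) ?_
        filter_upwards [hχS, hτt] with x h1 h2
        rw [h2]
        refine (cut_sq_le (hχ0 x) (hχ1 x)).trans ?_
        gcongr
        by_cases hx : x ∈ S
        · rw [indicator_of_mem hx]; linarith [hχ0 x]
        · rw [h1 hx]; simp [hx]
    _ = _ := by
        rw [integral_add hi1 hi2, integral_const_mul, integral_indicator_const _ hS,
          smul_eq_mul, mul_one]

/-- The bound for the energy of the recovery map at scale `η = √ε`, for `n` jumps. -/
noncomputable def recoveryBound (L c A B : ℝ) (n : ℕ) (η : ℝ) : ℝ :=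
  (1 + η) * ((Real.tanh (η / (√2 * η ^ 2)) ^ 2)⁻¹ * (n * (2 * √2 / 3))) + (η ^ 2 + η) / 2 * A +
    L / 2 * (B + c ^ 2 * ((2 * n + 2) * η))

/-- `F` is a map into the circle that attains the boundary values, has derivative `G` off its jumps
in `P`, and agrees with `u` off the transition region around `P`. -/
structure IsCut (α : ℝ) (u g : ℝ → ℂ) (η : ℝ) (P : Finset ℝ) (F G : ℝ → ℂ) : Prop where
  mem_Icc : ∀ p ∈ P, p ∈ Icc η (1 - η)
  separated : ∀ p ∈ P, ∀ q ∈ P, p ≠ q → 2 * η ≤ |p - q|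
  memLp : MemLp G 2 (volume.restrict (Ioo 0 1))
  norm_le : ∀ x, ‖G x‖ ≤ ‖g x‖
  norm_eq_one : ∀ x ∈ Icc (0 : ℝ) 1, ‖F x‖ = 1
  map_zero : F 0 = 1
  map_one : F 1 = Complex.exp (α * Complex.I)
  jumps : ∀ x ∈ Ioo (0 : ℝ) 1 \ (P : Set ℝ), ∀ᶠ y in 𝓝 x,
    F y - ∫ t in (0 : ℝ)..y, G t = F x - ∫ t in (0 : ℝ)..x, G t
  jumps_zero : ∀ᶠ y in 𝓝[>] (0 : ℝ), F y - ∫ t in (0 : ℝ)..y, G t = F 0 - ∫ t in (0 : ℝ)..0, G t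
  jumps_one : ∀ᶠ y in 𝓝[<] (1 : ℝ), F y - ∫ t in (0 : ℝ)..y, G t = F 1 - ∫ t in (0 : ℝ)..1, G t
  eq_or : ∀ᵐ x, x ∈ Ioo (0 : ℝ) 1 → F x = u x ∧ G x = g x ∨ G x = 0 ∧ x ∈ transition η P

/-- Including 0 and 1 in the separation hypothesis keeps interior jumps at distance 4η from the
ends, so that clamping moves only the jumps at 0 and 1. -/
theorem IsJumpSet.exists_isCut {α : ℝ} {u : ℝ → ℂ} {J : Finset ℝ} (hJ : IsJumpSet α u J)
    {g : ℝ → ℂ} (hg : MemLp g 2 (volume.restrict (Ioo 0 1)))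
    (hw : IsWeakDeriv (Ioo 0 1 \ (J : Set ℝ)) u g) {η : ℝ} (hη : 0 < η)
    (hsep : ∀ p ∈ insert 0 (insert 1 J), ∀ q ∈ insert 0 (insert 1 J), p ≠ q → 4 * η ≤ |p - q|) :
    ∃ P F G, P.card ≤ J.card ∧ IsCut α u g η P F G := by
  classical
  have hgi := integrableOn_of_memLp Subset.rfl hg
  obtain ⟨s, hs, hus, hnorm, hs0, hs1⟩ := hJ.exists_rep hgi hw
  set f : ℝ → ℂ := fun x => (∫ t in (0 : ℝ)..x, g t) + s x with hf
  set e : ℂ := Complex.exp (α * Complex.I) with he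
  have he1 : ‖e‖ = 1 := Complex.norm_exp_ofReal_mul_I α
  have hη4 : 4 * η ≤ 1 := by simpa using hsep 0 (by simp) 1 (by simp) (by norm_num)
  -- The map is cut only at an end where the boundary value is not attained; the jump then sits at η
  -- instead of 0, and similarly at 1.
  set a : ℝ := if (0 : ℝ) ∈ J then η else 0 with ha
  set b : ℝ := if (1 : ℝ) ∈ J then 1 - η else 1 with hb
  have ha0 : 0 ≤ a := by rw [ha]; split_ifs <;> linarith
  have haη : a ≤ η := by rw [ha]; split_ifs <;> linarith
  have hb1 : b ≤ 1 := by rw [hb]; split_ifs <;> linarith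
  have hbη : 1 - η ≤ b := by rw [hb]; split_ifs <;> linarith
  have hab : a < b := by linarith
  set P : Finset ℝ := J.image (clampPoint η) with hP
  have hPm : ∀ p ∈ P, p ∈ Icc η (1 - η) := by
    intro p hp
    obtain ⟨q, -, rfl⟩ := Finset.mem_image.1 hp
    exact clampPoint_mem (by linarith)
  have hPsep : ∀ p ∈ P, ∀ q ∈ P, p ≠ q → 2 * η ≤ |p - q| := by
    intro p hp q hq hpq
    obtain ⟨p', hp', rfl⟩ := Finset.mem_image.1 hp
    obtain ⟨q', hq', rfl⟩ := Finset.mem_image.1 hq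
    exact clampPoint_separated hη.le (hJ.subset hp') (hJ.subset hq') (hsep p' (by simp [hp']) q'
      (by simp [hq']) fun h => hpq (by rw [h]))
  have haP : a ≠ 0 → a ∈ P := by
    intro h
    have h0 : (0 : ℝ) ∈ J := by
      by_contra h0; exact h (by rw [ha, if_neg h0])
    refine Finset.mem_image.2 ⟨0, h0, ?_⟩
    rw [ha, if_pos h0, clampPoint, min_eq_left (by linarith), max_eq_left hη.le]
  have hbP : b ≠ 1 → b ∈ P := by
    intro h
    have h0 : (1 : ℝ) ∈ J := by
      by_contra h0; exact h (by rw [hb, if_neg h0])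
    refine Finset.mem_image.2 ⟨1, h0, ?_⟩
    rw [hb, if_pos h0, clampPoint, min_eq_right (by linarith), max_eq_right (by linarith)]
  have hJP : ∀ x ∈ J, x ∈ Ioo a b → x ∈ P := by
    intro x hx hxab
    have h0 : x ≠ 0 := (ha0.trans_lt hxab.1).ne'
    have h1 : x ≠ 1 := (hxab.2.trans_le hb1).ne
    have d0 := hsep x (by simp [hx]) 0 (by simp) h0
    have d1 := hsep x (by simp [hx]) 1 (by simp) h1
    rw [sub_zero, abs_of_nonneg (hJ.subset hx).1] at d0
    rw [abs_sub_comm, abs_of_nonneg (sub_nonneg.2 (hJ.subset hx).2)] at d1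
    exact Finset.mem_image.2 ⟨x, hx, clampPoint_of_mem ⟨by linarith, by linarith⟩⟩
  obtain ⟨j1, j2, j3⟩ := cutMap_jumps (e := e) (f := f) ha0 hab hb1 hgi hf hs haP hbP hJP
    (fun h => hs0 fun h0 => by rw [ha, if_pos h0] at h; exact hη.ne' h)
    (fun h => hs1 fun h0 => by rw [hb, if_pos h0] at h; linarith)
  refine ⟨P, cutMap a b e f, (Ioo a b).indicator g, Finset.card_image_le,
    hPm, hPsep, hg.indicator measurableSet_Ioo, fun x => norm_indicator_le_norm_self _ _,
    fun x _ => norm_cutMap hab he1 fun hx => hnorm x ⟨ha0.trans_lt hx.1, hx.2.trans_le hb1⟩,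
    cutMap_left ha0, cutMap_right hab hb1, j1, j2, j3, ?_⟩
  filter_upwards [hus] with x hx hxI
  by_cases hxab : x ∈ Ioo a b
  · exact Or.inl ⟨(cutMap_mid hxab).trans (hx hxI).symm, indicator_of_mem hxab g⟩
  · refine Or.inr ⟨indicator_of_notMem hxab g, Or.inr ?_⟩
    rcases le_or_gt x a with h | h
    · exact Or.inl ⟨hxI.1.le, h.trans haη⟩
    · exact Or.inr ⟨hbη.trans (not_lt.1 fun h' => hxab ⟨h, h'⟩), hxI.2.le⟩

/-- The map is ρF. Since |F| = 1, its modulus is ρ and ‖(ρF)'‖ ≤ |ρ'| + ‖g‖, so the well energy is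
that of ρ up to the Young error. Both the twist and the map itself change only in the transition
region, of measure O(η). -/
theorem IsCut.exists_le_recoveryBound {L α : ℝ} {N : ℕ} (hL : 0 < L) {u : L2}
    (hu1 : ∀ᵐ x ∂(volume.restrict (Ioo (0 : ℝ) 1)), ‖u x‖ = 1) {g : ℝ → ℂ}
    (hg : MemLp g 2 (volume.restrict (Ioo 0 1))) {η : ℝ} (hη : 0 < η) {P : Finset ℝ}
    {F G : ℝ → ℂ} (hc : IsCut α u g η P F G) :
    ∃ v : L2, energy L N α (η ^ 2) v ≤ ENNReal.ofReal (recoveryBound L (2 * Real.pi * N)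
        (∫ x in Ioo 0 1, ‖g x‖ ^ 2)
        (∫ x in Ioo 0 1, (twist (u x) (g x) - 2 * Real.pi * N) ^ 2) P.card η) ∧
      eLpNorm (⇑v - ⇑u) 2 (volume.restrict (Ioo 0 1)) ≤
        2 * ENNReal.ofReal ((2 * P.card + 2) * η) ^ (1 / 2 : ℝ) := by
  classical
  set ε := η ^ 2 with hεdef
  have hε : 0 < ε := by positivity
  set ρ := modulus ε η P with hρ
  set T := Real.tanh (η / (√2 * ε)) with hT
  have hρd : ∀ x, x ∉ modulusCorners η P → HasDerivAt ρ (deriv ρ x) x := fun x hx =>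
    (hasDerivAt_modulus hε hη hc.separated hx).1
  have hρle : ∀ x, x ∉ modulusCorners η P → ε / 2 * deriv ρ x ^ 2 +
      1 / (4 * ε) * (ρ x ^ 2 - 1) ^ 2 ≤ (T ^ 2)⁻¹ * modulusDensity ε η P x := fun x hx =>
    (hasDerivAt_modulus hε hη hc.separated hx).2
  have hρ0 : ∀ x, 0 ≤ ρ x := fun x => modulus_nonneg hε hη x
  have hρ1 : ∀ x, ρ x ≤ 1 := fun x => modulus_le_one hε hη x
  have hT0 : 0 < T := tanh_scale_pos hε hη
  have hcorner : ∀ᵐ x : ℝ, x ∉ modulusCorners η P :=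
    compl_mem_ae_iff.2 ((modulusCorners η P).finite_toSet.measure_zero volume)
  have hgi := integrableOn_of_memLp Subset.rfl hc.memLp
  have hAC := acWith_smul_of_jumps continuous_modulus (ac_modulus hε hη P 0 1) hρd
    (fun p hp => modulus_of_mem hp) hgi (fun x hx => (hc.norm_eq_one x hx).le)
    hc.jumps hc.jumps_zero hc.jumps_one
  set V : ℝ → ℂ := fun x => ρ x • F x with hV
  set V' : ℝ → ℂ := fun x => deriv ρ x • F x + ρ x • G x with hV'
  have hρ'm : MemLp (deriv ρ) 2 (volume.restrict (Ioo 0 1)) := by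
    refine MemLp.of_bound (measurable_deriv ρ).aestronglyMeasurable
      (√(2 / ε * ((T ^ 2)⁻¹ * (P.card * (1 / (2 * ε)))))) (ae_restrict_of_ae ?_)
    filter_upwards [hcorner] with x hx
    rw [Real.norm_eq_abs]
    refine Real.abs_le_sqrt ?_
    have h1 := hρle x hx
    have h2 : (T ^ 2)⁻¹ * modulusDensity ε η P x ≤ (T ^ 2)⁻¹ * (P.card * (1 / (2 * ε))) := by
      gcongr; exact modulusDensity_le hε x
    have h3 : 0 ≤ 1 / (4 * ε) * (ρ x ^ 2 - 1) ^ 2 := by positivity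
    have h4 : ε / 2 * deriv ρ x ^ 2 ≤ (T ^ 2)⁻¹ * (P.card * (1 / (2 * ε))) := by linarith
    calc deriv ρ x ^ 2 = 2 / ε * (ε / 2 * deriv ρ x ^ 2) := by field_simp
      _ ≤ _ := by gcongr
  have hVnorm : ∀ x ∈ Icc (0 : ℝ) 1, ‖V x‖ = ρ x := by
    intro x hx
    rw [hV]
    simp only
    rw [norm_smul, hc.norm_eq_one x hx, mul_one, Real.norm_of_nonneg (hρ0 x)]
  have hV'n : ∀ x ∈ Icc (0 : ℝ) 1, ‖V' x‖ ≤ |deriv ρ x| + ‖g x‖ := by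
    intro x hx
    refine (norm_add_le _ _).trans ?_
    rw [norm_smul, norm_smul, hc.norm_eq_one x hx, mul_one, Real.norm_eq_abs, Real.norm_of_nonneg (hρ0 x)]
    gcongr
    exact (mul_le_of_le_one_left (norm_nonneg _) (hρ1 x)).trans (hc.norm_le x)
  have hV'm : MemLp V' 2 (volume.restrict (Ioo 0 1)) := by
    refine MemLp.of_le (hρ'm.norm.add hg.norm)
      (intervalIntegrable_iff_Ioo.1 hAC.integrable).aestronglyMeasurable
      ((ae_restrict_iff' measurableSet_Ioo).2 (Eventually.of_forall fun x hx => ?_))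
    refine (hV'n x (Ioo_subset_Icc_self hx)).trans (le_of_eq ?_)
    exact (abs_of_nonneg (add_nonneg (abs_nonneg (deriv ρ x)) (norm_nonneg (g x)))).symm
  have hVm : MemLp V 2 (volume.restrict (Ioo 0 1)) := by
    refine MemLp.of_bound hAC.aestronglyMeasurable 1
      ((ae_restrict_iff' measurableSet_Ioo).2 (Eventually.of_forall fun x hx => ?_))
    rw [hVnorm x (Ioo_subset_Icc_self hx)]; exact hρ1 x
  have hoff : ∀ x, x ∉ transition η P → ρ x = 1 := by
    intro x hxt
    refine modulus_eq_one hε hη fun p hp => ?_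
    by_contra! hlt
    rw [abs_lt] at hlt
    exact hxt (Or.inl (mem_iUnion₂.2 ⟨p, hp, by linarith [hlt.1], by linarith [hlt.2]⟩))
  set v : L2 := hVm.toLp V with hv
  have hvV : ∀ᵐ x, x ∈ Ioo (0 : ℝ) 1 → v x = V x :=
    (ae_restrict_iff' measurableSet_Ioo).1 hVm.coeFn_toLp
  have hV0 : V 0 = 1 := by
    have : ρ 0 = 1 := modulus_eq_one hε hη fun p hp => by
      rw [zero_sub, abs_neg]; exact (hc.mem_Icc p hp).1.trans (le_abs_self _)
    simp only [hV, this, hc.map_zero, one_smul]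
  have hV1 : V 1 = Complex.exp (α * Complex.I) := by
    have : ρ 1 = 1 := modulus_eq_one hε hη fun p hp => by
      exact le_trans (by linarith [(hc.mem_Icc p hp).2]) (le_abs_self _)
    simp only [hV, this, hc.map_one, one_smul]
  have hA : Admissible α v := admissible_of_acWith (Lp.memLp v) hvV hAC hV'm hV0 hV1
  have hvol := volume_transition_le hη.le P
  have hvolr : (volume.restrict (Ioo 0 1)).real (transition η P) ≤ (2 * P.card + 2) * η :=
    ENNReal.toReal_le_of_le_ofReal (by positivity) ((Measure.restrict_apply_le _ _).trans hvol)
  refine ⟨v, ?_, ?_⟩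
  · rw [energy_eq_ofReal hL hε hA hvV hAC hV'm]
    refine ENNReal.ofReal_le_ofReal ?_
    have hwell : ∫ x in (0 : ℝ)..1, wellDensity ε V V' x ≤
        (1 + η) * ((T ^ 2)⁻¹ * (P.card * (2 * √2 / 3))) +
          (η ^ 2 + η) / 2 * ∫ x in Ioo 0 1, ‖g x‖ ^ 2 := by
      have hi1 := (integrable_modulusDensity ε η P (Ioo 0 1)).const_mul ((1 + η) * (T ^ 2)⁻¹)
      have hi2 : Integrable (fun x => (η ^ 2 + η) / 2 * ‖g x‖ ^ 2)
          (volume.restrict (Ioo 0 1)) := (hg.integrable_norm_pow (by norm_num)).const_mul _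
      rw [intervalIntegral.integral_of_le zero_le_one, integral_Ioc_eq_integral_Ioo]
      calc ∫ x in Ioo 0 1, wellDensity ε V V' x
          ≤ ∫ x in Ioo 0 1, ((1 + η) * (T ^ 2)⁻¹ * modulusDensity ε η P x +
              (η ^ 2 + η) / 2 * ‖g x‖ ^ 2) := by
            refine setIntegral_mono_on_ae ((intervalIntegrable_iff_integrableOn_Ioo_of_le
              zero_le_one).1 (hAC.intervalIntegrable_wellDensity hV'm ε)) (hi1.add hi2)
              measurableSet_Ioo ?_
            filter_upwards [hcorner] with x hx hxI
            have hxI' := Ioo_subset_Icc_self hxI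
            have h1 := hρle x hx
            have h2 : ε / 2 * ‖V' x‖ ^ 2 ≤ ε / 2 * (|deriv ρ x| + ‖g x‖) ^ 2 := by
              gcongr; exact hV'n x hxI'
            have h3 := add_sq_le_of_pos hη (|deriv ρ x|) ‖g x‖
            rw [← hεdef, sq_abs] at h3
            have h4 : 0 ≤ 1 / (4 * ε) * (ρ x ^ 2 - 1) ^ 2 := by positivity
            rw [wellDensity, hVnorm x hxI', mul_assoc (1 + η)]
            nlinarith
        _ = (1 + η) * (T ^ 2)⁻¹ * (∫ x in Ioo 0 1, modulusDensity ε η P x) +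
              (η ^ 2 + η) / 2 * ∫ x in Ioo 0 1, ‖g x‖ ^ 2 := by
            rw [integral_add hi1 hi2, integral_const_mul, integral_const_mul]
        _ ≤ _ := by
            rw [mul_assoc (1 + η)]
            gcongr
            refine integral_modulusDensity_le hε hη P
    have htw : ∫ x in Ioo 0 1, (twist (V x) (V' x) - 2 * Real.pi * N) ^ 2 ≤
        (∫ x in Ioo 0 1, (twist (u x) (g x) - 2 * Real.pi * N) ^ 2) +
          (2 * Real.pi * N) ^ 2 * ((2 * P.card + 2) * η) := by
      have hum : MemLp (fun x => twist (u x) (g x)) 2 (volume.restrict (Ioo 0 1)) :=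
        memLp_twist (Lp.memLp u).1 hg (C := 1) (hu1.mono fun x hx => hx.le)
      -- The twist of ρF is ρ² times that of (u, g) where the map was kept, and 0 where it was cut.
      -- Where G = g = 0 the alternatives overlap, but both twists vanish.
      refine (integral_cut_sq_le (χ := fun x => if G x = g x then ρ x ^ 2 else 0)
        (measurableSet_transition η P) hum (hAC.memLp_twist hV'm) (2 * Real.pi * N) (fun x => ?_)
        (fun x => ?_) ?_ ?_).trans (by gcongr)
      · split_ifs
        · exact sq_nonneg _
        · exact le_rfl
      · split_ifs
        · exact pow_le_one₀ (hρ0 x) (hρ1 x)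
        · exact zero_le_one
      · refine (ae_restrict_iff' measurableSet_Ioo).2 (hc.eq_or.mono fun x hx hxI hxt => ?_)
        rcases hx hxI with h | h
        · rw [if_pos h.2, hoff x hxt, one_pow]
        · exact absurd h.2 hxt
      · refine (ae_restrict_iff' measurableSet_Ioo).2 (hc.eq_or.mono fun x hx hxI => ?_)
        simp only [hV, hV', twist_real_smul]
        rcases hx hxI with h | h
        · rw [if_pos h.2, h.1, h.2]
        · have h0 : ∀ z, twist z 0 = 0 := fun z => by simp [twist]
          rw [h.1, h0, mul_zero]
          split_ifs with h'
          · rw [← h', h0, mul_zero]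
          · rw [zero_mul]
    rw [recoveryBound]
    have := mul_le_mul_of_nonneg_left htw (half_pos hL).le
    rw [← hεdef, ← hT]
    linarith
  · have hle : eLpNorm (⇑v - ⇑u) 2 (volume.restrict (Ioo 0 1)) ≤
        eLpNorm ((transition η P).indicator fun _ => (2 : ℝ)) 2 (volume.restrict (Ioo 0 1)) := by
      refine eLpNorm_mono_ae ((ae_restrict_iff' measurableSet_Ioo).2 ?_)
      filter_upwards [hvV, hc.eq_or, (ae_restrict_iff' measurableSet_Ioo).1 hu1] with x h1 h2 h3 hx
      rw [Pi.sub_apply, h1 hx]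
      by_cases hxt : x ∈ transition η P
      · rw [indicator_of_mem hxt]
        refine (norm_sub_le _ _).trans ?_
        rw [hVnorm x (Ioo_subset_Icc_self hx), h3 hx, Real.norm_of_nonneg zero_le_two]
        linarith [hρ1 x]
      · have hFu : F x = u x := ((h2 hx).resolve_right fun h => hxt h.2).1
        simp only [hV, hoff x hxt, hFu, one_smul, sub_self, norm_zero]
        exact norm_nonneg _
    refine hle.trans ?_
    rw [eLpNorm_indicator_const (measurableSet_transition η P) (by norm_num) (by norm_num)]
    have : ‖(2 : ℝ)‖ₑ = 2 := by
      rw [Real.enorm_eq_ofReal zero_le_two]; simp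
    rw [this, ENNReal.toReal_ofNat]
    gcongr
    exact (Measure.restrict_apply_le _ _).trans hvol

end Recovery

/-! ### Convergence of the recovery energies and the Γ-limit -/

section GammaLimit

theorem recoveryBound_mono {L c A B η : ℝ} (hL : 0 < L) (hη : 0 < η) {m n : ℕ} (hmn : m ≤ n) :
    recoveryBound L c A B m η ≤ recoveryBound L c A B n η := by
  have h : (m : ℝ) ≤ n := by exact_mod_cast hmn
  unfold recoveryBound
  gcongr

theorem tendsto_recoveryBound (L c A B : ℝ) (n : ℕ) :
    Tendsto (recoveryBound L c A B n) (𝓝[>] 0) (𝓝 (n * (2 * √2 / 3) + L / 2 * B)) := by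
  have hid : Tendsto (fun η : ℝ => η) (𝓝[>] 0) (𝓝 0) := nhdsWithin_le_nhds
  have hT : Tendsto (fun η : ℝ => (Real.tanh (η / (√2 * η ^ 2)) ^ 2)⁻¹) (𝓝[>] 0) (𝓝 1) := by
    -- The argument of tanh is 1/(√2 η): the profile is truncated at a distance much larger than its
    -- width ε = η².
    have h1 : Tendsto (fun η : ℝ => η / (√2 * η ^ 2)) (𝓝[>] 0) atTop := by
      refine (tendsto_inv_nhdsGT_zero.const_mul_atTop
        (show (0 : ℝ) < (√2)⁻¹ by positivity)).congr' ?_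
      filter_upwards [self_mem_nhdsWithin] with η hη
      have : η ≠ 0 := ne_of_gt hη
      field_simp
    simpa using ((tendsto_tanh_atTop.comp h1).pow 2).inv₀ (by norm_num)
  have hlim : Tendsto (recoveryBound L c A B n) (𝓝[>] 0)
      (𝓝 ((1 + 0) * (1 * (n * (2 * √2 / 3))) + (0 ^ 2 + 0) / 2 * A +
        L / 2 * (B + c ^ 2 * ((2 * n + 2) * 0)))) :=
    (((hid.const_add 1).mul (hT.mul_const _)).add
      ((((hid.pow 2).add hid).div_const 2).mul_const A)).add
      ((((hid.const_mul (2 * (n : ℝ) + 2)).const_mul (c ^ 2)).const_add B).const_mul (L / 2))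
  convert hlim using 2
  ring

theorem limitEnergy_eq {L α : ℝ} {N : ℕ} (hL : 0 < L) {u : L2}
    (h : ∃ J : Finset ℝ, IsJumpSet α u J) :
    ∃ (J : Finset ℝ) (g : ℝ → ℂ), IsJumpSet α u J ∧ MemLp g 2 (volume.restrict (Ioo 0 1)) ∧
      IsWeakDeriv (Ioo 0 1 \ (J : Set ℝ)) u g ∧
      limitEnergy L N α u = ENNReal.ofReal (J.card * (2 * √2 / 3) +
        L / 2 * ∫ x in Ioo 0 1, (twist (u x) (g x) - 2 * Real.pi * N) ^ 2) := by
  have hJ := h.choose_spec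
  have hg := weakDeriv_memLp hJ.memH1.1
  rw [restrict_Ioo_diff] at hg
  refine ⟨h.choose, _, hJ, hg, isWeakDeriv_weakDeriv hJ.memH1.1, ?_⟩
  rw [limitEnergy, dif_pos h]
  set J := h.choose
  have hum : MemLp (fun x => twist (u x) (weakDeriv (Ioo 0 1 \ (J : Set ℝ)) u x)) 2
      (volume.restrict (Ioo 0 1)) :=
    memLp_twist (Lp.memLp u).1 hg (C := 1) (hJ.memH1.2.mono fun x hx => hx.le)
  have hi : IntegrableOn (fun x => L / 2 * (twist (u x) (weakDeriv (Ioo 0 1 \ (J : Set ℝ)) u x) -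
      2 * Real.pi * N) ^ 2) (Ioo 0 1) :=
    ((hum.sub (memLp_const (2 * Real.pi * N : ℝ))).integrable_sq).const_mul (L / 2)
  rw [← ofReal_integral_eq_lintegral_ofReal hi
    (Eventually.of_forall fun x => by simp only [Pi.zero_apply]; positivity),
    integral_const_mul, ← ENNReal.ofReal_natCast, ← ENNReal.ofReal_mul (by positivity),
    ← ENNReal.ofReal_add (mul_nonneg (by positivity) (integral_nonneg fun _ => sq_nonneg _))
      (by positivity)]
  congr 1
  ring

theorem exists_recoveryFamily {L α : ℝ} {N : ℕ} (hL : 0 < L) {u : L2}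
    (h : ∃ J : Finset ℝ, IsJumpSet α u J) :
    ∃ (v : ℝ → L2) (b : ℝ → ℝ≥0∞), Tendsto v (𝓝[>] 0) (𝓝 u) ∧
      Tendsto b (𝓝[>] 0) (𝓝 (limitEnergy L N α u)) ∧
      ∀ᶠ ε in 𝓝[>] 0, energy L N α ε (v ε) ≤ b ε := by
  classical
  obtain ⟨J, g, hJ, hg, hw, hE⟩ := limitEnergy_eq (N := N) hL h
  set R := recoveryBound L (2 * Real.pi * N) (∫ x in Ioo 0 1, ‖g x‖ ^ 2)
    (∫ x in Ioo 0 1, (twist (u x) (g x) - 2 * Real.pi * N) ^ 2) J.card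
  set D : ℝ → ℝ≥0∞ := fun η => 2 * ENNReal.ofReal ((2 * J.card + 2) * η) ^ (1 / 2 : ℝ)
  obtain ⟨s, hs, hsep⟩ := BoundedSequence.exists_separation (insert 0 (insert 1 J))
  have hv : ∀ ε : ℝ, ∃ v : L2, 0 < ε → √ε < s / 2 → energy L N α ε v ≤ ENNReal.ofReal (R √ε) ∧
      eLpNorm (⇑v - ⇑u) 2 (volume.restrict (Ioo 0 1)) ≤ D √ε := by
    intro ε
    by_cases hε : 0 < ε ∧ √ε < s / 2
    · have hη : 0 < √ε := Real.sqrt_pos.2 hε.1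
      obtain ⟨P, F, G, hPJ, hc⟩ := hJ.exists_isCut hg hw hη fun p hp q hq hpq =>
        le_trans (by linarith [hε.2]) (hsep p hp q hq hpq)
      obtain ⟨v, h1, h2⟩ := hc.exists_le_recoveryBound (N := N) hL hJ.memH1.2 hg hη
      rw [Real.sq_sqrt hε.1.le] at h1
      refine ⟨v, fun _ _ => ⟨h1.trans (ENNReal.ofReal_le_ofReal (recoveryBound_mono hL hη hPJ)),
        h2.trans ?_⟩⟩
      have : (P.card : ℝ) ≤ J.card := by exact_mod_cast hPJ
      simp only [D]
      gcongr
    · exact ⟨u, fun h1 h2 => absurd ⟨h1, h2⟩ hε⟩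
  choose v hv using hv
  have hsqrt : Tendsto (fun ε : ℝ => √ε) (𝓝[>] 0) (𝓝[>] 0) := by
    refine tendsto_nhdsWithin_iff.2 ⟨?_, ?_⟩
    · simpa using (Real.continuous_sqrt.tendsto 0).mono_left (nhdsWithin_le_nhds (s := Ioi 0))
    · filter_upwards [self_mem_nhdsWithin] with ε hε using Real.sqrt_pos.2 hε
  have hsmall : ∀ᶠ ε : ℝ in 𝓝[>] 0, √ε < s / 2 :=
    (hsqrt.mono_right nhdsWithin_le_nhds).eventually_lt_const (half_pos hs)
  have hD : Tendsto D (𝓝[>] 0) (𝓝 0) := by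
    have hid : Tendsto (fun η : ℝ => (2 * (J.card : ℝ) + 2) * η) (𝓝[>] 0) (𝓝 0) := by
      simpa using (tendsto_id.const_mul (2 * (J.card : ℝ) + 2)).mono_left
        (nhdsWithin_le_nhds (a := (0 : ℝ)) (s := Ioi 0))
    have h1 := ((ENNReal.tendsto_ofReal hid).ennrpow_const (1 / 2 : ℝ))
    have h2 := ENNReal.Tendsto.const_mul h1 (Or.inr (ENNReal.ofNat_ne_top (n := 2)))
    rw [ENNReal.ofReal_zero, ENNReal.zero_rpow_of_pos (by norm_num), mul_zero] at h2
    exact h2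
  refine ⟨v, fun ε => ENNReal.ofReal (R √ε), ?_, ?_, ?_⟩
  · rw [Lp.tendsto_Lp_iff_tendsto_eLpNorm']
    refine tendsto_of_tendsto_of_tendsto_of_le_of_le' tendsto_const_nhds (hD.comp hsqrt)
      (Eventually.of_forall fun _ => zero_le) ?_
    filter_upwards [self_mem_nhdsWithin, hsmall] with ε h1 h2 using (hv ε h1 h2).2
  · rw [hE]
    exact ENNReal.tendsto_ofReal ((tendsto_recoveryBound _ _ _ _ _).comp hsqrt)
  · filter_upwards [self_mem_nhdsWithin, hsmall] with ε h1 h2 using (hv ε h1 h2).1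

theorem gammaConverges {L α : ℝ} {N : ℕ} (hL : 0 < L) :
    GammaConverges (energy L N α) (limitEnergy L N α) := by
  refine ⟨fun u ε v hε hv => limitEnergy_le_liminf hL hε hv, fun u => ?_⟩
  by_cases h : ∃ J : Finset ℝ, IsJumpSet α u J
  · obtain ⟨v, b, hv, hb, hle⟩ := exists_recoveryFamily (N := N) hL h
    refine ⟨v, hv, tendsto_of_seq_tendsto fun ε hε => ?_⟩
    refine tendsto_of_le_liminf_of_limsup_le (limitEnergy_le_liminf hL hε (hv.comp hε)) ?_
    refine le_trans ?_ (hb.comp hε).limsup_eq.le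
    exact limsup_le_limsup (hε.eventually hle)
  -- When the limit energy is infinite, the lower bound for the constant family already forces the
  -- energies to infinity.
  · refine ⟨fun _ => u, tendsto_const_nhds, tendsto_of_seq_tendsto fun ε hε => ?_⟩
    refine tendsto_of_le_liminf_of_limsup_le
      (limitEnergy_le_liminf hL hε tendsto_const_nhds) ?_
    rw [limitEnergy, dif_neg h]
    exact le_top

end GammaLimit

end Twist

theorem theorem3p1 (L α : ℝ) (N : ℕ) (hL : 0 < L) (hN : 0 < N)
    (hα : α ∈ Set.Ico 0 (2 * Real.pi)) :
    Twist.GammaConverges (Twist.energy L N α) (Twist.limitEnergy L N α) :=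
  Twist.gammaConverges hL
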